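/- **Theorem (thermal form-factor expansion).** *Model.* Let $d\ge 1$, and let $R(\lambda,\mu)\in\operatorname{End}(\mathbb C^d\otimes\mathbb C^d)$ be defined for $\lambda,\mu$ in a neighbourhood $U$ of $0\in\mathbb C$, with $\lambda\mapsto R(\lambda,0)$ differentiable at $0$, such that for all $\lambda,\mu,\nu\in U$ $$R_{1,2}(\lambda,\mu)R_{1,3}(\lambda,\nu)R_{2,3}(\mu,\nu)=R_{2,3}(\mu,\nu)R_{1,3}(\lambda,\nu)R_{1,2}(\lambda,\mu),$$ $R(\lambda,\lambda)=P$ (the transposition), $R_{1,2}(\lambda,\mu)R_{2,1}(\mu,\lambda)=\mathrm{id}$ and $R^t(\lambda,\mu)=R(\lambda,\mu)$. Let $\hat\varphi\in\operatorname{End}\mathbb C^d$ be such that $\theta(\alpha)=e^{\alpha\hat\varphi}$ satisfies $R_{1,2}(\lambda,\mu)\theta_1(\alpha)\theta_2(\alpha)=\theta_2(\alpha)\theta_1(\alpha)R_{1,2}(\lambda,\mu)$ for all $\alpha\in\mathbb C$. On $(\mathbb C^d)^{\otimes L}$ put $\hat\Phi=\sum_j\hat\varphi_j$, $t_\perp(\lambda)=\operatorname{tr}_0\{R_{0,L}(\lambda,0)\cdots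 R_{0,1}(\lambda,0)\}$, $\overline t_\perp(\lambda)=\operatorname{tr}_0\{R_{1,0}(0,\lambda)\cdots R_{L,0}(0,\lambda)\}$, and, with $\kappa\in\mathbb C\setminus\{0\}$ and $h\in\mathbb R$, $H=\frac1\kappa t_\perp'(0)t_\perp^{-1}(0)-h\hat\Phi$. *Correlation function.* Let $T>0$, $t\in\mathbb R$, let $X_{[1,\ell]}=x^{(1)}_1\cdots x^{(\ell)}_\ell$ and $Y_{[1,r]}=y^{(1)}_1\cdots y^{(r)}_r$ with $x^{(j)},y^{(k)}\in\operatorname{End}\mathbb C^d$ satisfy $[\hat\Phi,X]=s(X)X$, $[\hat\Phi,Y]=s(Y)Y$, and let $m\ge\ell$ be an integer. Assume that $Z_L=\operatorname{tr}e^{-H/T}\ne0$ for all large $L$, and let $$\langle X_{[1,\ell]}(t)Y_{[1+m,r+m]}\rangle_T=\lim_{L\to\infty}Z_L^{-1}\operatorname{tr}\{e^{(it-1/T)H}X_{[1,\ell]}e^{-itH}Y_{[1+m,r+m]}\}.$$ *Quantum transfer matrix.* For even $N$ let $T(\lambda|h)=\theta_0(h/T)R^{(\sigma_{2N})}_{0,2N}(\lambda,\nu_{2N})\cdots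 R^{(\sigma_1)}_{0,1}(\lambda,\nu_1)$, where $R^{(1)}_{0,j}(\lambda,\nu)=R_{0,j}(\lambda,\nu)$, $R^{(-1)}_{0,j}(\lambda,\nu)=R_{j,0}^{t_1}(\nu,\lambda)$ ($t_1$ is the transposition in the first space on which $R$ acts), $\sigma_{2k-1}=-\sigma_{2k}=1$, and $\nu_{2k-1}=-\nu_{2k}$ equals $\frac{it}{\kappa N}$ for $1\le k\le N/2$ and $(\frac1T-it)\frac1{\kappa N}$ for $N/2<k\le N$. Let $t(\lambda|h)=\operatorname{tr}_0T(\lambda|h)$. *Assumptions*, (1)–(3) being required for all sufficiently large even $N$: 1. There are a basis of joint right eigenvectors $|\Psi_n\rangle$ of the operators $t(\lambda|h)$, $\lambda\in U$, with eigenvalues $\Lambda_n(\lambda)$, and left eigenvectors $\langle\Psi_n|$ with the same eigenvalues, such that $\langle\Psi_n|\Psi_k\rangle=0$ if and only if $n\ne k$. 2. $|\Lambda_0(0)|>|\Lambda_n(0)|$ for all $n\ne0$. 3. If $t\ne0$, then $\Lambda_n(0)$ and $\Lambda_n(\pm\frac{it}{\kappa N})$ are non-zero for all $n$. 4. The Trotter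 and the thermodynamic limit commute. Precisely, put $\rho_{N,L}(\beta)=(t_\perp(-\frac{\beta}{\kappa N})\overline t_\perp(\frac{\beta}{\kappa N}))^{N/2}$ and $E(\beta)=e^{\beta h\hat\Phi}\rho_{N,L}(\beta)$, and let $$C_{N,L}=\frac{\operatorname{tr}\{E(\frac1T-it)\,X_{[1,\ell]}\,E(it)\,Y_{[1+m,r+m]}\}}{\operatorname{tr}\{E(\frac1T-it)E(it)\}}.$$ If the inner limits $\lim_{N}C_{N,L}$ (all large $L$) and $\lim_{L}C_{N,L}$ (all large even $N$) exist, then $\lim_L\lim_NC_{N,L}$ and $\lim_N\lim_LC_{N,L}$ exist and are equal. *Conclusion.* The limits on both sides of the following formula exist, and $$\langle X_{[1,\ell]}(t)Y_{[1+m,r+m]}\rangle_T=e^{-iht\,s(X)}\lim_{N\to\infty}\sum_n\frac{\langle\Psi_0|\prod_{k=1}^{\ell}\operatorname{tr}_0\{x^{(k)}_0T(0|h)\}|\Psi_n\rangle}{\langle\Psi_0|\Psi_0\rangle\,\Lambda_n^\ell(0)}\;\frac{\langle\Psi_n|\prod_{k=1}^{r}\operatorname{tr}_0\{y^{(k)}_0T(0|h)\}|\Psi_0\rangle}{\langle\Psi_n|\Psi_n\rangle\,\Lambda_0^r(0)}\left(\frac{\Lambda_n(0)}{\Lambda_0(0)}\right)^{m}\left(\frac{\Lambda_0(\frac{it}{\kappa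 N})}{\Lambda_n(\frac{it}{\kappa N})}\right)^{N/2}\left(\frac{\Lambda_n(-\frac{it}{\kappa N})}{\Lambda_0(-\frac{it}{\kappa N})}\right)^{N/2},$$ with products ordered by ascending $k$ from left to right and $N$ running through the even integers. For $t=0$, terms with $\Lambda_n(0)=0$ are omitted from the sum. -/

import Mathlib

open scoped Matrix Kronecker Topology

noncomputable section

namespace FormFactor

/-! ### Local and two-site operators on `(ℂ^d)^{⊗ L}`

Basis vectors of `(ℂ^d)^{⊗ L}` are configurations `Fin L → Fin d`; sites are numbered from `0`. -/

/-- Endomorphisms of `(ℂ^d)^{⊗ L}`. -/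
abbrev Op (d L : ℕ) : Type := Matrix (Fin L → Fin d) (Fin L → Fin d) ℂ

/-- The one-site operator `A_j`, acting as `A` on site `j` and as the identity elsewhere. -/
def site {d L : ℕ} (j : Fin L) (A : Matrix (Fin d) (Fin d) ℂ) : Op d L :=
  Matrix.of fun s s' => if ∀ k, k ≠ j → s k = s' k then A (s j) (s' j) else 0

/-- The two-site operator `A_{i,j}` for `i ≠ j`: the first tensor factor of `A` acts on site `i`,
the second one on site `j`. -/
def twoSite {d L : ℕ} (i j : Fin L) (A : Matrix (Fin d × Fin d) (Fin d × Fin d) ℂ) : Op d L :=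
  Matrix.of fun s s' =>
    if ∀ k, k ≠ i → k ≠ j → s k = s' k then A (s i, s j) (s' i, s' j) else 0

/-- The product of `z 0, …, z (q - 1)` placed on the `q` consecutive sites that follow the first
`off` sites of the chain (only used when `off + q ≤ L`). -/
def localOp {d q : ℕ} (L off : ℕ) (z : Fin q → Matrix (Fin d) (Fin d) ℂ) : Op d L :=
  (List.ofFn fun k : Fin q =>
    if hk : off + (k : ℕ) < L then site ⟨off + (k : ℕ), hk⟩ (z k) else 1).prod

/-! ### Fundamental `R`-matrices with `U(1)` symmetry -/

/-- The transposition `P (u ⊗ v) = v ⊗ u`. -/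
def perm (d : ℕ) : Matrix (Fin d × Fin d) (Fin d × Fin d) ℂ :=
  Matrix.of fun a b => if a.1 = b.2 ∧ a.2 = b.1 then 1 else 0

/-- `R_{2,1}` for `R = R_{1,2}`. -/
def flip {d : ℕ} (A : Matrix (Fin d × Fin d) (Fin d × Fin d) ℂ) :
    Matrix (Fin d × Fin d) (Fin d × Fin d) ℂ :=
  Matrix.of fun a b => A a.swap b.swap

/-- `R` solves the Yang-Baxter equation for spectral parameters in `U`, and is regular, unitary
and symmetric there; moreover `λ ↦ R(λ, 0)` is (complex) differentiable at `0`, so that the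
Hamiltonian is defined. -/
structure IsFundamental {d : ℕ} (R : ℂ → ℂ → Matrix (Fin d × Fin d) (Fin d × Fin d) ℂ)
    (U : Set ℂ) : Prop where
  yangBaxter : ∀ lam ∈ U, ∀ mu ∈ U, ∀ nu ∈ U,
    (twoSite 0 1 (R lam mu) : Op d 3) * twoSite 0 2 (R lam nu) * twoSite 1 2 (R mu nu) =
      twoSite 1 2 (R mu nu) * twoSite 0 2 (R lam nu) * twoSite 0 1 (R lam mu)
  regular : ∀ lam ∈ U, R lam lam = perm d
  unitary : ∀ lam ∈ U, ∀ mu ∈ U, R lam mu * flip (R mu lam) = 1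
  symmetric : ∀ lam ∈ U, ∀ mu ∈ U, (R lam mu)ᵀ = R lam mu
  differentiable : ∀ a b, DifferentiableAt ℂ (fun lam => R lam 0 a b) 0

/-- `θ(α) = exp(α φ)`. -/
def theta {d : ℕ} (phi : Matrix (Fin d) (Fin d) ℂ) (a : ℂ) : Matrix (Fin d) (Fin d) ℂ :=
  NormedSpace.exp (a • phi)

/-- `R_{1,2} θ_1(α) θ_2(α) = θ_2(α) θ_1(α) R_{1,2}`. -/
def IsU1Symmetric {d : ℕ} (R : ℂ → ℂ → Matrix (Fin d × Fin d) (Fin d × Fin d) ℂ)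
    (U : Set ℂ) (phi : Matrix (Fin d) (Fin d) ℂ) : Prop :=
  ∀ lam ∈ U, ∀ mu ∈ U, ∀ a : ℂ,
    R lam mu * (theta phi a ⊗ₖ theta phi a) = (theta phi a ⊗ₖ theta phi a) * R lam mu

/-- The total charge `Φ = ∑_j φ_j`. -/
def totalCharge {d : ℕ} (L : ℕ) (phi : Matrix (Fin d) (Fin d) ℂ) : Op d L :=
  ∑ j : Fin L, site j phi

/-- The product operator `z_1 ⊗ ⋯ ⊗ z_q` has `U(1)` charge `s`. -/
def HasCharge {d q : ℕ} (phi : Matrix (Fin d) (Fin d) ℂ) (z : Fin q → Matrix (Fin d) (Fin d) ℂ)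
    (s : ℂ) : Prop :=
  totalCharge q phi * localOp q 0 z - localOp q 0 z * totalCharge q phi = s • localOp q 0 z

/-! ### Operators with an auxiliary space

An endomorphism of `V_0 ⊗ (ℂ^d)^{⊗ L}`, `V_0 = ℂ^d`, is a `d × d` matrix with entries in
`End (ℂ^d)^{⊗ L}`; composition is multiplication of such matrices, `tr_0` is `Matrix.trace`. -/

/-- Endomorphisms of `V_0 ⊗ (ℂ^d)^{⊗ L}`. -/
abbrev AuxOp (d L : ℕ) : Type := Matrix (Fin d) (Fin d) (Op d L)

/-- `x_0`: the operator `x` acting on the auxiliary space. -/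
def aux {d : ℕ} (L : ℕ) (x : Matrix (Fin d) (Fin d) ℂ) : AuxOp d L :=
  Matrix.of fun a b => x a b • (1 : Op d L)

/-- `A_{0,j}`: first factor on the auxiliary space, second factor on site `j`. -/
def auxSite {d L : ℕ} (j : Fin L) (A : Matrix (Fin d × Fin d) (Fin d × Fin d) ℂ) : AuxOp d L :=
  Matrix.of fun a b => site j (Matrix.of fun u v => A (a, u) (b, v))

/-- `A_{j,0}`: first factor on site `j`, second factor on the auxiliary space. -/
def siteAux {d L : ℕ} (j : Fin L) (A : Matrix (Fin d × Fin d) (Fin d × Fin d) ℂ) : AuxOp d L :=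
  auxSite j (flip A)

/-- Transposition with respect to the first tensor factor. -/
def transposeFst {d : ℕ} (A : Matrix (Fin d × Fin d) (Fin d × Fin d) ℂ) :
    Matrix (Fin d × Fin d) (Fin d × Fin d) ℂ :=
  Matrix.of fun a b => A (b.1, a.2) (a.1, b.2)

/-! ### Row-to-row transfer matrices, Hamiltonian and two-point functions -/

/-- `t_⊥(λ) = tr_0 {R_{0,L}(λ,0) ⋯ R_{0,1}(λ,0)}`. -/
def rowTransfer {d : ℕ} (R : ℂ → ℂ → Matrix (Fin d × Fin d) (Fin d × Fin d) ℂ) (L : ℕ)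
    (lam : ℂ) : Op d L :=
  Matrix.trace ((List.ofFn fun j : Fin L => auxSite j (R lam 0)).reverse.prod)

/-- `t̄_⊥(λ) = tr_0 {R_{1,0}(0,λ) ⋯ R_{L,0}(0,λ)}`. -/
def rowTransferBar {d : ℕ} (R : ℂ → ℂ → Matrix (Fin d × Fin d) (Fin d × Fin d) ℂ) (L : ℕ)
    (lam : ℂ) : Op d L :=
  Matrix.trace ((List.ofFn fun j : Fin L => siteAux j (R 0 lam)).prod)

/-- `H_0 = κ⁻¹ t_⊥'(0) t_⊥(0)⁻¹`. -/
def hamiltonian0 {d : ℕ} (R : ℂ → ℂ → Matrix (Fin d × Fin d) (Fin d × Fin d) ℂ) (kappa : ℂ)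
    (L : ℕ) : Op d L :=
  (1 / kappa) •
    ((Matrix.of fun s s' => deriv (fun lam => rowTransfer R L lam s s') 0) *
      (rowTransfer R L 0)⁻¹)

/-- `H = H_0 - h Φ`. -/
def hamiltonian {d : ℕ} (R : ℂ → ℂ → Matrix (Fin d × Fin d) (Fin d × Fin d) ℂ) (kappa : ℂ)
    (phi : Matrix (Fin d) (Fin d) ℂ) (h : ℝ) (L : ℕ) : Op d L :=
  hamiltonian0 R kappa L - (h : ℂ) • totalCharge L phi

/-- The partition function `Z_L = tr e^{-H/T}`. -/
def partitionFunction {d : ℕ} (R : ℂ → ℂ → Matrix (Fin d × Fin d) (Fin d × Fin d) ℂ) (kappa : ℂ)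
    (phi : Matrix (Fin d) (Fin d) ℂ) (h T : ℝ) (L : ℕ) : ℂ :=
  Matrix.trace (NormedSpace.exp ((-(1 / (T : ℂ))) • hamiltonian R kappa phi h L))

/-- The two-point function of the chain of length `L`,
`Z_L⁻¹ tr {e^{(it - 1/T) H} X_{⟦1,ℓ⟧} e^{-itH} Y_{⟦1+m,r+m⟧}}`. -/
def twoPoint {d l r : ℕ} (R : ℂ → ℂ → Matrix (Fin d × Fin d) (Fin d × Fin d) ℂ) (kappa : ℂ)
    (phi : Matrix (Fin d) (Fin d) ℂ) (h T t : ℝ) (x : Fin l → Matrix (Fin d) (Fin d) ℂ)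
    (y : Fin r → Matrix (Fin d) (Fin d) ℂ) (m L : ℕ) : ℂ :=
  Matrix.trace
      (NormedSpace.exp ((Complex.I * t - 1 / (T : ℂ)) • hamiltonian R kappa phi h L) *
        localOp L 0 x *
        NormedSpace.exp ((-(Complex.I * t)) • hamiltonian R kappa phi h L) *
        localOp L m y) /
    partitionFunction R kappa phi h T L

/-- `ρ_{N,L}(β) = (t_⊥(-β/(κN)) t̄_⊥(β/(κN)))^{N/2}` for the even Trotter number `N = 2n`. -/
def rho {d : ℕ} (R : ℂ → ℂ → Matrix (Fin d × Fin d) (Fin d × Fin d) ℂ) (kappa : ℂ) (n L : ℕ)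
    (beta : ℂ) : Op d L :=
  (rowTransfer R L (-(beta / (kappa * (2 * n : ℕ)))) *
    rowTransferBar R L (beta / (kappa * (2 * n : ℕ)))) ^ n

/-- The Trotter approximation `e^{βhΦ} ρ_{N,L}(β)` of `e^{-βH}`, `N = 2n`. -/
def trotterExp {d : ℕ} (R : ℂ → ℂ → Matrix (Fin d × Fin d) (Fin d × Fin d) ℂ) (kappa : ℂ)
    (phi : Matrix (Fin d) (Fin d) ℂ) (h : ℝ) (n L : ℕ) (beta : ℂ) : Op d L :=
  NormedSpace.exp ((beta * h) • totalCharge L phi) * rho R kappa n L beta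

/-- The two-point function of the chain of length `L` at finite Trotter number `N = 2n`: in
numerator and denominator the factors `e^{-(1/T - it)H}` and `e^{-itH}` are replaced by their
Trotter approximations. -/
def trotterTwoPoint {d l r : ℕ} (R : ℂ → ℂ → Matrix (Fin d × Fin d) (Fin d × Fin d) ℂ)
    (kappa : ℂ) (phi : Matrix (Fin d) (Fin d) ℂ) (h T t : ℝ)
    (x : Fin l → Matrix (Fin d) (Fin d) ℂ) (y : Fin r → Matrix (Fin d) (Fin d) ℂ)
    (m n L : ℕ) : ℂ :=
  Matrix.trace
      (trotterExp R kappa phi h n L (1 / (T : ℂ) - Complex.I * t) * localOp L 0 x *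
        trotterExp R kappa phi h n L (Complex.I * t) * localOp L m y) /
    Matrix.trace
      (trotterExp R kappa phi h n L (1 / (T : ℂ) - Complex.I * t) *
        trotterExp R kappa phi h n L (Complex.I * t))

/-- The limits `n → ∞` and `L → ∞` of `F n L` commute: if the inner limits exist, then both
iterated limits exist and agree. -/
def LimitsCommute (F : ℕ → ℕ → ℂ) : Prop :=
  ∀ a b : ℕ → ℂ,
    (∀ᶠ L in Filter.atTop, Filter.Tendsto (fun n => F n L) Filter.atTop (𝓝 (a L))) →
    (∀ᶠ n in Filter.atTop, Filter.Tendsto (fun L => F n L) Filter.atTop (𝓝 (b n))) →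
    ∃ g : ℂ, Filter.Tendsto a Filter.atTop (𝓝 g) ∧ Filter.Tendsto b Filter.atTop (𝓝 g)

/-! ### The dynamical quantum transfer matrix -/

/-- `R_{0,j}^{(σ)}(λ,ν)`: equal to `R_{0,j}(λ,ν)` if `σ = 1` and to `R_{j,0}^{t_1}(ν,λ)` if
`σ = -1`. -/
def stagR {d M : ℕ} (R : ℂ → ℂ → Matrix (Fin d × Fin d) (Fin d × Fin d) ℂ) (j : Fin M) (sg : ℤˣ)
    (lam nu : ℂ) : AuxOp d M :=
  if sg = 1 then auxSite j (R lam nu) else siteAux j (transposeFst (R nu lam))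

/-- The staggered monodromy matrix
`T(λ|σ,ν) = θ_0(a) R_{0,M}^{(σ_M)}(λ,ν_M) ⋯ R_{0,1}^{(σ_1)}(λ,ν_1)`, with `a = h/T`. -/
def stagMonodromy {d M : ℕ} (R : ℂ → ℂ → Matrix (Fin d × Fin d) (Fin d × Fin d) ℂ)
    (phi : Matrix (Fin d) (Fin d) ℂ) (a : ℂ) (sg : Fin M → ℤˣ) (nu : Fin M → ℂ) (lam : ℂ) :
    AuxOp d M :=
  aux M (theta phi a) * (List.ofFn fun j : Fin M => stagR R j (sg j) lam (nu j)).reverse.prod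

/-- Number of sites `M = 2N` of the dynamical quantum transfer matrix with Trotter number
`N = 2n`. -/
abbrev qtmLength (n : ℕ) : ℕ := 2 * (2 * n)

/-- The alternating staggering `σ = (1, -1, 1, -1, …)`. -/
def qtmSign (n : ℕ) (j : Fin (qtmLength n)) : ℤˣ := (-1) ^ (j : ℕ)

/-- The inhomogeneities `ν_{2k-1} = -ν_{2k}`, equal to `it/(κN)` for `k = 1, …, N/2` and to
`(1/T - it)/(κN)` for `k = N/2 + 1, …, N`, where `N = 2n`. -/
def qtmInhom (kappa : ℂ) (T t : ℝ) (n : ℕ) (j : Fin (qtmLength n)) : ℂ :=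
  (-1) ^ (j : ℕ) *
    ((if (j : ℕ) < 2 * n then Complex.I * t else 1 / (T : ℂ) - Complex.I * t) /
      (kappa * (2 * n : ℕ)))

/-- The monodromy matrix `T(λ|h)` of the dynamical quantum transfer matrix. -/
def qtmMonodromy {d : ℕ} (R : ℂ → ℂ → Matrix (Fin d × Fin d) (Fin d × Fin d) ℂ) (kappa : ℂ)
    (phi : Matrix (Fin d) (Fin d) ℂ) (h T t : ℝ) (n : ℕ) (lam : ℂ) : AuxOp d (qtmLength n) :=
  stagMonodromy R phi ((h : ℂ) / T) (qtmSign n) (qtmInhom kappa T t n) lam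

/-- The dynamical quantum transfer matrix `t(λ|h) = tr_0 T(λ|h)`. -/
def qtm {d : ℕ} (R : ℂ → ℂ → Matrix (Fin d × Fin d) (Fin d × Fin d) ℂ) (kappa : ℂ)
    (phi : Matrix (Fin d) (Fin d) ℂ) (h T t : ℝ) (n : ℕ) (lam : ℂ) : Op d (qtmLength n) :=
  Matrix.trace (qtmMonodromy R kappa phi h T t n lam)

/-- The ascending product `tr_0 {z_1 T(0|h)} ⋯ tr_0 {z_q T(0|h)}`. -/
def qtmInsertion {d q : ℕ} (R : ℂ → ℂ → Matrix (Fin d × Fin d) (Fin d × Fin d) ℂ) (kappa : ℂ)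
    (phi : Matrix (Fin d) (Fin d) ℂ) (h T t : ℝ) (n : ℕ)
    (z : Fin q → Matrix (Fin d) (Fin d) ℂ) : Op d (qtmLength n) :=
  (List.ofFn fun k : Fin q =>
    Matrix.trace (aux (qtmLength n) (z k) * qtmMonodromy R kappa phi h T t n 0)).prod

/-- `ket n`, `bra n`, `ev n` (`n = 0, …, K`) are a complete system of right eigenvectors
`|Ψ_n⟩`, dual left eigenvectors `⟨Ψ_n|` and eigenvalues `Λ_n(λ)` of the family `t(λ)`, `λ ∈ U`.
The normalization `⟨Ψ_n|Ψ_n⟩` is arbitrary. -/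
structure IsEigensystem {I : Type} [Fintype I] (t : ℂ → Matrix I I ℂ) (U : Set ℂ) {K : ℕ}
    (ket bra : Fin (K + 1) → I → ℂ) (ev : Fin (K + 1) → ℂ → ℂ) : Prop where
  right : ∀ lam ∈ U, ∀ n, t lam *ᵥ ket n = ev n lam • ket n
  left : ∀ lam ∈ U, ∀ n, bra n ᵥ* t lam = ev n lam • bra n
  orthogonal : ∀ n k, n ≠ k → bra n ⬝ᵥ ket k = 0
  normalizable : ∀ n, bra n ⬝ᵥ ket n ≠ 0
  complete : Submodule.span ℂ (Set.range ket) = ⊤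

/-- The `k`-th summand of the thermal form-factor series, with operators
`A = ∏ tr_0 {x T(0|h)}` and `B = ∏ tr_0 {y T(0|h)}`, `w = it/(κN)` and `N = 2n`. -/
def formFactorTerm {I : Type} [Fintype I] {K : ℕ} (ket bra : Fin (K + 1) → I → ℂ)
    (ev : Fin (K + 1) → ℂ → ℂ) (A B : Matrix I I ℂ) (l r m n : ℕ) (w : ℂ)
    (k : Fin (K + 1)) : ℂ :=
  (bra 0 ⬝ᵥ (A *ᵥ ket k)) / ((bra 0 ⬝ᵥ ket 0) * ev k 0 ^ l) *
    ((bra k ⬝ᵥ (B *ᵥ ket 0)) / ((bra k ⬝ᵥ ket k) * ev 0 0 ^ r)) *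
    (ev k 0 / ev 0 0) ^ m *
    (ev 0 w / ev k w) ^ n * (ev k (-w) / ev 0 (-w)) ^ n

end FormFactor

end

open scoped Matrix Kronecker Topology

noncomputable section

namespace FormFactor


/-! ### Product operators -/

/-! The finite-Trotter quotient $C_{N,L}$ has two computable inner limits, and the assumption that
the limits commute identifies what they lead to.

Limit $N\to\infty$ at fixed $L$. By regularity, unitarity and symmetry, $\overline t_\perp(z)$
agrees with $t_\perp(z)^{-1}$ to first order at $z=0$, so $t_\perp(-z)\overline t_\perp(z)=1-2\kappa
zH_0+o(z)$ with $H_0=H+h\hat\Phi$. Its $N/2$-th power at $z=\beta/(\kappa N)$ tends to $e^{-\beta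
H_0}$ (`IsFundamental.tendsto_rho`). Since $\hat\Phi$ commutes with $H_0$, $C_{N,L}$ tends to the
two-point function (`IsFundamental.tendsto_trotterTwoPoint`).

Limit $L\to\infty$ at fixed $N$. The traces are partition functions of a vertex model on a torus,
which can be summed column by column (`trace_rows_eq_trace_cols`, `rho_mul_rho_trace`). A bare
column is the quantum transfer matrix $t(0|h)$, so only its dominant state survives
(`IsEigensystem.tendsto_trace_div`). Collecting the twist in a single row moves $e^{iht\hat\Phi}$
past $X$ and leaves the phase $e^{-iht\,s(X)}$ (`trace_trotterExp_eq`).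

The operator $Y$ sits next to the twist and gives $\operatorname{tr}_0\{yT(0|h)\}$, but $X$ sits in
the middle of the column. By cyclicity its columns contain the monodromy matrix whose first $N$
sites have been moved past the twist. The transfer matrix at an inhomogeneity moves one site: at
$\nu_k$ the $k$-th vertex degenerates to a permutation (or its partial transpose), and the $RTT$
relation shows that $t(\nu_k|h)$ intertwines the monodromy matrices before and after the move
(`exchange_fst`, `exchange_snd`). Between eigenvectors each move costs a ratio of eigenvalues at
$\pm it/(\kappa N)$, and $N$ moves produce the two factors with power $N/2$
(`matrixElement_insertion_rotated`). Inserting the resolution of the identity between $X$ and $Y$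
gives the series.

For $t=0$ eigenvalues may vanish. The row carrying $X$ can then be merged with that of $Y$, and no
site has to be moved. -/

/-- The product operator `D_1 ⊗ ⋯ ⊗ D_L`. -/
def tens {d L : ℕ} (D : Fin L → Matrix (Fin d) (Fin d) ℂ) : Op d L :=
  Matrix.of fun s s' => ∏ j, D j (s j) (s' j)

theorem tens_mul {d L : ℕ} (D E : Fin L → Matrix (Fin d) (Fin d) ℂ) :
    tens D * tens E = tens (D * E) := by
  ext s s'
  simp only [tens, Matrix.mul_apply, Matrix.of_apply, Pi.mul_apply, Finset.prod_univ_sum,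
    Finset.prod_mul_distrib, Fintype.piFinset_univ]

theorem tens_one {d L : ℕ} : tens (1 : Fin L → Matrix (Fin d) (Fin d) ℂ) = 1 := by
  ext s s'
  simp only [tens, Matrix.of_apply, Pi.one_apply, Matrix.one_apply, Finset.prod_ite_zero,
    Finset.prod_const_one, funext_iff, Finset.mem_univ, true_implies]

theorem site_eq_tens {d L : ℕ} (j : Fin L) (A : Matrix (Fin d) (Fin d) ℂ) :
    site j A = tens (Function.update 1 j A) := by
  ext s s'
  rw [tens, Matrix.of_apply, site, Matrix.of_apply, ← Finset.mul_prod_erase _ _ (Finset.mem_univ j)]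
  have : ∏ k ∈ Finset.univ.erase j,
      (Function.update (1 : Fin L → Matrix (Fin d) (Fin d) ℂ) j A) k (s k) (s' k) =
      ∏ k ∈ Finset.univ.erase j, if s k = s' k then (1 : ℂ) else 0 := by
    refine Finset.prod_congr rfl fun k hk => ?_
    rw [Function.update_of_ne (Finset.ne_of_mem_erase hk), Pi.one_apply, Matrix.one_apply]
  rw [this, Finset.prod_ite_zero, Function.update_self, Finset.prod_const_one]
  simp

theorem site_one {d L : ℕ} (j : Fin L) : site j (1 : Matrix (Fin d) (Fin d) ℂ) = 1 := by
  rw [site_eq_tens, ← tens_one]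
  congr 1
  exact Function.update_eq_self j 1

theorem site_mul {d L : ℕ} (j : Fin L) (A B : Matrix (Fin d) (Fin d) ℂ) :
    site j (A * B) = site j A * site j B := by
  rw [site_eq_tens, site_eq_tens, site_eq_tens, tens_mul, ← Function.update_mul, one_mul]

theorem site_add {d L : ℕ} (j : Fin L) (A B : Matrix (Fin d) (Fin d) ℂ) :
    site j (A + B) = site j A + site j B := by
  ext s s'
  simp only [site, Matrix.of_apply, Matrix.add_apply]
  split_ifs <;> simp

theorem site_smul {d L : ℕ} (j : Fin L) (c : ℂ) (A : Matrix (Fin d) (Fin d) ℂ) :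
    site j (c • A) = c • site j A := by
  ext s s'
  simp [site, Matrix.of_apply, Matrix.smul_apply]

theorem site_commute {d L : ℕ} {j k : Fin L} (h : j ≠ k) (A B : Matrix (Fin d) (Fin d) ℂ) :
    Commute (site j A) (site k B) := by
  rw [Commute, SemiconjBy, site_eq_tens, site_eq_tens, tens_mul, tens_mul]
  congr 1
  funext i
  by_cases hj : i = j
  · subst hj; simp [Function.update_of_ne h]
  · by_cases hk : i = k
    · subst hk; simp [Function.update_of_ne hj]
    · simp [Function.update_of_ne hj, Function.update_of_ne hk]

/-- `A ↦ A_j` as a homomorphism of algebras. -/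
def siteHom {d L : ℕ} (j : Fin L) : Matrix (Fin d) (Fin d) ℂ →ₐ[ℂ] Op d L :=
  AlgHom.ofLinearMap ⟨⟨site j, site_add j⟩, site_smul j⟩ (site_one j) (site_mul j)

theorem siteHom_apply {d L : ℕ} (j : Fin L) (A : Matrix (Fin d) (Fin d) ℂ) :
    siteHom j A = site j A := rfl

theorem exp_site {d L : ℕ} (j : Fin L) (A : Matrix (Fin d) (Fin d) ℂ) :
    NormedSpace.exp (site j A) = site j (NormedSpace.exp A) := by
  have hc : Continuous (siteHom (d := d) j) :=
    (siteHom (d := d) j).toLinearMap.continuous_of_finiteDimensional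
  open scoped Matrix.Norms.Operator in
  exact (NormedSpace.map_exp (siteHom j) hc A).symm

/-- Charges at different sites commute, so the exponential factorizes. From here on every $U(1)$
rotation is a product operator. -/
theorem exp_smul_totalCharge {d L : ℕ} (phi : Matrix (Fin d) (Fin d) ℂ) (a : ℂ) :
    NormedSpace.exp (a • totalCharge L phi) = tens fun _ => theta phi a := by
  have key : ∀ S : Finset (Fin L), NormedSpace.exp (∑ j ∈ S, site j (a • phi)) =
      tens fun j => if j ∈ S then theta phi a else 1 := by
    intro S
    induction S using Finset.induction_on with
    | empty => simp only [Finset.sum_empty, NormedSpace.exp_zero, Finset.notMem_empty, if_false]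
               exact tens_one.symm
    | insert j S hj ih =>
      rw [Finset.sum_insert hj, Matrix.exp_add_of_commute, ih, exp_site, site_eq_tens, tens_mul]
      · congr 1
        funext k
        by_cases hk : k = j
        · subst hk; simp [hj, theta]
        · simp [hk]
      · exact Commute.sum_right _ _ _ fun k hk =>
          site_commute (by rintro rfl; exact hj hk) _ _
  rw [totalCharge, Finset.smul_sum]
  simpa [site_smul] using key Finset.univ

/-- The factors of `localOp L off z`. -/
def localFactor {d q : ℕ} (off : ℕ) (z : Fin q → Matrix (Fin d) (Fin d) ℂ) (j : ℕ) :
    Matrix (Fin d) (Fin d) ℂ :=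
  if hj : off ≤ j ∧ j - off < q then z ⟨j - off, hj.2⟩ else 1

theorem localOp_eq_tens {d q L : ℕ} (off : ℕ) (z : Fin q → Matrix (Fin d) (Fin d) ℂ) :
    localOp L off z = tens fun j => localFactor off z j := by
  induction q with
  | zero =>
    rw [localOp, List.ofFn_zero, List.prod_nil, ← tens_one]
    congr 1
    funext j
    simp [localFactor]
  | succ q ih =>
    rw [localOp, List.ofFn_succ', List.concat_eq_append, List.prod_append, List.prod_singleton]
    have := ih (fun k => z k.castSucc)
    rw [localOp] at this
    simp only [Fin.val_castSucc, Fin.val_last]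
    rw [this]
    have hl : (if hk : off + q < L then site ⟨off + q, hk⟩ (z (Fin.last q)) else 1) =
        tens (L := L) fun j => if (j : ℕ) = off + q then z (Fin.last q) else 1 := by
      split_ifs with h
      · rw [site_eq_tens]
        congr 1
        funext j
        by_cases hj : j = ⟨off + q, h⟩
        · subst hj; simp
        · have : (j : ℕ) ≠ off + q := fun e => hj (Fin.ext e)
          simp [Function.update_of_ne hj, this]
      · rw [← tens_one]
        congr 1
        funext j
        have : (j : ℕ) ≠ off + q := by omega
        simp [this]
    rw [hl, tens_mul]
    congr 1
    funext j
    simp only [Pi.mul_apply, localFactor]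
    by_cases h1 : (j : ℕ) = off + q
    · have e1 : ¬ (off ≤ (j : ℕ) ∧ (j : ℕ) - off < q) := by omega
      have e2 : (off ≤ (j : ℕ) ∧ (j : ℕ) - off < q + 1) := by omega
      rw [dif_neg e1, dif_pos e2, if_pos h1, one_mul]
      congr 1
      ext
      simp [h1]
    · by_cases e1 : (off ≤ (j : ℕ) ∧ (j : ℕ) - off < q)
      · have e2 : (off ≤ (j : ℕ) ∧ (j : ℕ) - off < q + 1) := by omega
        rw [dif_pos e1, dif_pos e2, if_neg h1, mul_one]
        rfl
      · have e2 : ¬ (off ≤ (j : ℕ) ∧ (j : ℕ) - off < q + 1) := by omega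
        rw [dif_neg e1, dif_neg e2, if_neg h1, mul_one]

theorem normedExp_mul_of_mul_eq {A : Type*} [NormedRing A] [NormedAlgebra ℂ A] [CompleteSpace A]
    {a b x : A} (h : a * x = x * b) : NormedSpace.exp a * x = x * NormedSpace.exp b := by
  let _ : NormedAlgebra ℚ A := NormedAlgebra.restrictScalars ℚ ℂ A
  simp only [NormedSpace.exp_eq_tsum ℂ]
  rw [← (NormedSpace.expSeries_summable' (𝕂 := ℂ) a).tsum_mul_right,
    ← (NormedSpace.expSeries_summable' (𝕂 := ℂ) b).tsum_mul_left]
  refine tsum_congr fun n => ?_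
  have : a ^ n * x = x * b ^ n := (SemiconjBy.pow_right (show SemiconjBy x b a from h.symm) n).symm
  rw [smul_mul_assoc, mul_smul_comm, this]

theorem exp_mul_of_mul_eq {I : Type*} [Fintype I] [DecidableEq I] {A B X : Matrix I I ℂ}
    (h : A * X = X * B) : NormedSpace.exp A * X = X * NormedSpace.exp B := by
  open scoped Matrix.Norms.Operator in
  exact normedExp_mul_of_mul_eq h

/-- The hypothesis says $AX=X(A+s)$, and the scalar shift $s$ exponentiates to a scalar factor. -/
theorem exp_smul_mul_of_commutator {I : Type*} [Fintype I] [DecidableEq I] {A X : Matrix I I ℂ}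
    {s : ℂ} (h : A * X - X * A = s • X) (a : ℂ) :
    NormedSpace.exp (a • A) * X = Complex.exp (a * s) • (X * NormedSpace.exp (a • A)) := by
  have h1 : (a • A) * X = X * (a • A + (a * s) • 1) := by
    have : A * X = X * A + s • X := by rw [← h]; abel
    rw [smul_mul_assoc, this, mul_add, smul_add, mul_smul_comm, mul_smul_comm, mul_one, smul_smul]
  rw [exp_mul_of_mul_eq h1, Matrix.exp_add_of_commute]
  · have : NormedSpace.exp ((a * s) • (1 : Matrix I I ℂ)) = Complex.exp (a * s) • 1 := by
      rw [Matrix.smul_one_eq_diagonal, Matrix.exp_diagonal, Matrix.smul_one_eq_diagonal]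
      congr 1
      funext i
      rw [Pi.coe_exp, Complex.exp_eq_exp_ℂ]
    rw [this, mul_smul_comm, mul_smul_comm, mul_one]
  · exact (Commute.one_right _).smul_right _

/-- A local operator of charge `s` has charge `s` on the whole chain. -/
theorem HasCharge.theta_mul {d q L off : ℕ} {phi : Matrix (Fin d) (Fin d) ℂ}
    {z : Fin q → Matrix (Fin d) (Fin d) ℂ} {s : ℂ} (h : HasCharge phi z s) (hL : off + q ≤ L)
    (a : ℂ) :
    (tens fun _ => theta phi a) * localOp L off z =
      Complex.exp (a * s) • (localOp L off z * tens fun _ => theta phi a) := by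
  have h1 := exp_smul_mul_of_commutator h a
  rw [exp_smul_totalCharge, localOp_eq_tens, tens_mul, tens_mul] at h1
  rw [localOp_eq_tens, tens_mul, tens_mul]
  -- The charge is known only on the `q` sites of the support. On that block the claim is the
  -- exponentiated hypothesis; outside it both sides carry the same factor `theta phi a`.
  have split : ∀ (F : ℕ → ℂ), ∏ j : Fin L, F j = (∏ j : Fin q, F (off + j)) *
      ∏ j ∈ (Finset.range L).filter (fun j => ¬ (off ≤ j ∧ j < off + q)), F j := by
    intro F
    rw [Fin.prod_univ_eq_prod_range, Fin.prod_univ_eq_prod_range (fun j => F (off + j)),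
      ← Finset.prod_filter_mul_prod_filter_not (Finset.range L) (fun j => off ≤ j ∧ j < off + q)]
    congr 1
    have : (Finset.range L).filter (fun j => off ≤ j ∧ j < off + q) = Finset.Ico off (off + q) := by
      ext j; simp; omega
    rw [this, Finset.prod_Ico_eq_prod_range]
    simp
  ext s s'
  -- Extending configurations to all of `ℕ` needs a default basis label, which does not exist for `d
  -- = 0`.
  rcases Nat.eq_zero_or_pos d with rfl | hd
  · rcases Nat.eq_zero_or_pos L with rfl | hLp
    · obtain rfl : q = 0 := by omega
      have := congrFun (congrFun h1 Fin.elim0) Fin.elim0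
      simpa [tens] using this
    · exact (s ⟨0, hLp⟩).elim0
  set g : ℕ → Fin d := fun j => if hj : j < L then s ⟨j, hj⟩ else ⟨0, hd⟩ with hg
  set g' : ℕ → Fin d := fun j => if hj : j < L then s' ⟨j, hj⟩ else ⟨0, hd⟩ with hg'
  have h2 := congrFun (congrFun h1 fun j => g (off + j)) fun j => g' (off + j)
  simp only [tens, Matrix.of_apply, Matrix.smul_apply, Pi.mul_apply, smul_eq_mul] at h2 ⊢
  have e1 := split fun j => (theta phi a * localFactor off z j) (g j) (g' j)
  have e2 := split fun j => (localFactor off z j * theta phi a) (g j) (g' j)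
  have gs : ∀ j : Fin L, g j = s j := fun j => by simp [hg]
  have gs' : ∀ j : Fin L, g' j = s' j := fun j => by simp [hg']
  simp only [gs, gs'] at e1 e2
  have f1 : ∀ j : Fin q, localFactor off z (off + j) = localFactor 0 z j := by
    intro j; simp [localFactor]
  rw [e1, e2]
  simp only [f1]
  rw [h2, mul_assoc]
  congr 2
  refine Finset.prod_congr rfl fun j hj => ?_
  have : ¬ (off ≤ j ∧ j - off < q) := by
    have := (Finset.mem_filter.1 hj).2; omega
  simp [localFactor, this]


/-! ### Traces of ordered products as sums over closed paths -/

/-- Here `Fin.cons a p` lists all the points of a path from `a`. Keeping the endpoint as a summation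
variable pinned by an indicator makes closing the path immediate. -/
theorem prod_ofFn_apply {I : Type*} [Fintype I] [DecidableEq I] {n : ℕ}
    (A : Fin n → Matrix I I ℂ) (a b : I) :
    (List.ofFn A).prod a b = ∑ p : Fin n → I,
      (∏ i, A i ((Fin.cons a p : Fin (n + 1) → I) i.castSucc) (p i)) *
        if (Fin.cons a p : Fin (n + 1) → I) (Fin.last n) = b then 1 else 0 := by
  induction n generalizing a with
  | zero => simp [Matrix.one_apply]
  | succ n ih =>
    rw [List.ofFn_succ, List.prod_cons, Matrix.mul_apply,
      ← (Fin.consEquiv fun _ : Fin (n + 1) => I).sum_comp, Fintype.sum_prod_type]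
    refine Finset.sum_congr rfl fun c _ => ?_
    rw [ih, Finset.mul_sum]
    refine Finset.sum_congr rfl fun p _ => ?_
    rw [Fin.prod_univ_succ, ← mul_assoc]
    simp [Fin.consEquiv, ← Fin.succ_last]

/-- On a closed path the starting point is the last point, which is the predecessor of index `0` for
the cyclic subtraction of `Fin n`. -/
theorem trace_prod_ofFn {I : Type*} [Fintype I] [DecidableEq I] {n : ℕ} [NeZero n]
    (A : Fin n → Matrix I I ℂ) :
    ((List.ofFn A).prod).trace = ∑ p : Fin n → I, ∏ i, A i (p (i - 1)) (p i) := by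
  obtain ⟨k, rfl⟩ := Nat.exists_eq_succ_of_ne_zero (NeZero.ne n)
  simp only [Matrix.trace, Matrix.diag_apply, prod_ofFn_apply]
  rw [Finset.sum_comm]
  refine Finset.sum_congr rfl fun p _ => ?_
  rw [← Fin.succ_last]
  simp only [Fin.cons_succ, mul_ite, mul_one, mul_zero, Finset.sum_ite_eq, Finset.mem_univ,
    if_true]
  refine Finset.prod_congr rfl fun i _ => ?_
  congr 1
  refine Fin.cases ?_ (fun j => ?_) i
  · simp only [Fin.castSucc_zero, Fin.cons_zero, zero_sub]
    congr 1
    ext; simp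
  · have : (j.succ - 1 : Fin (k + 1)) = j.castSucc := by
      rw [sub_eq_iff_eq_add, Fin.coeSucc_eq_succ]
    rw [this]
    simp only [← Fin.succ_castSucc, Fin.cons_succ]

theorem trace_reverse_prod_ofFn {I : Type*} [Fintype I] [DecidableEq I] {n : ℕ}
    (A : Fin n → Matrix I I ℂ) :
    ((List.ofFn A).reverse.prod).trace = ((List.ofFn fun i => (A i)ᵀ).prod).trace := by
  rw [← Matrix.trace_transpose, Matrix.transpose_list_prod, List.map_reverse, List.reverse_reverse,
    List.map_ofFn]
  rfl

/-- The operator `∑_h ∏_j V_j(s_j, s'_j)_{h_{j-1}, h_j}` built from one row of vertices. -/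
def rowOp {d e L : ℕ} (V : Fin L → Fin d → Fin d → Matrix (Fin e) (Fin e) ℂ) : Op d L :=
  Matrix.of fun s s' => ((List.ofFn fun j => V j (s j) (s' j)).prod).trace

/-- The operator built from one column of vertices. -/
def colOp {d e M : ℕ} (V : Fin M → Fin d → Fin d → Matrix (Fin e) (Fin e) ℂ) : Op e M :=
  Matrix.of fun p p' =>
    ((List.ofFn fun i => Matrix.of fun c c' => V i c c' (p i) (p' i)).reverse.prod).trace

/-- The partition function of an inhomogeneous lattice with periodic boundary conditions can be
computed row by row or column by column. -/
theorem trace_rows_eq_trace_cols {d e L M : ℕ} [NeZero L] [NeZero M]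
    (V : Fin M → Fin L → Fin d → Fin d → Matrix (Fin e) (Fin e) ℂ) :
    ((List.ofFn fun i => rowOp (V i)).reverse.prod).trace =
      ((List.ofFn fun j => colOp fun i => V i j).prod).trace := by
  rw [trace_reverse_prod_ofFn, trace_prod_ofFn, trace_prod_ofFn]
  simp only [rowOp, colOp, Matrix.of_apply, Matrix.transpose_apply, trace_reverse_prod_ofFn]
  simp only [trace_prod_ofFn, Matrix.of_apply, Matrix.transpose_apply]
  -- Both traces are now sums over all labels of the horizontal and vertical edges of an $M\times L$
  -- torus with the same weights; only the order of the two lattice indices differs.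
  simp only [Finset.prod_univ_sum, Fintype.piFinset_univ]
  rw [Finset.sum_comm, ← (Equiv.piComm fun (_ : Fin M) (_ : Fin L) => Fin e).sum_comp]
  refine Finset.sum_congr rfl fun H _ => ?_
  rw [← (Equiv.piComm fun (_ : Fin M) (_ : Fin L) => Fin d).sum_comp]
  refine Finset.sum_congr rfl fun S _ => ?_
  rw [Finset.prod_comm]
  rfl

/-- This absorbs local operators and twists into the vertices of a row, so that they take part in
the change from rows to columns. -/
theorem tens_mul_rowOp {d e L : ℕ} (D : Fin L → Matrix (Fin d) (Fin d) ℂ)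
    (V : Fin L → Fin d → Fin d → Matrix (Fin e) (Fin e) ℂ) :
    tens D * rowOp V = rowOp fun j s s' => ∑ q, D j s q • V j q s' := by
  rcases Nat.eq_zero_or_pos L with rfl | hL
  · ext s s'
    simp [tens, rowOp, Matrix.mul_apply]
  have : NeZero L := ⟨hL.ne'⟩
  ext s s'
  simp only [rowOp, tens, Matrix.mul_apply, Matrix.of_apply, trace_prod_ofFn, Matrix.sum_apply,
    Matrix.smul_apply, smul_eq_mul, Finset.prod_univ_sum, Fintype.piFinset_univ,
    Finset.prod_mul_distrib, Finset.mul_sum]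
  rw [Finset.sum_comm]

theorem rowOp_mul_tens {d e L : ℕ} (D : Fin L → Matrix (Fin d) (Fin d) ℂ)
    (V : Fin L → Fin d → Fin d → Matrix (Fin e) (Fin e) ℂ) :
    rowOp V * tens D = rowOp fun j s s' => ∑ q, D j q s' • V j s q := by
  rcases Nat.eq_zero_or_pos L with rfl | hL
  · ext s s'
    simp [tens, rowOp, Matrix.mul_apply]
  have : NeZero L := ⟨hL.ne'⟩
  ext s s'
  simp only [rowOp, tens, Matrix.mul_apply, Matrix.of_apply, trace_prod_ofFn, Matrix.sum_apply,
    Matrix.smul_apply, smul_eq_mul, Finset.prod_univ_sum, Fintype.piFinset_univ,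
    Finset.prod_mul_distrib, Finset.sum_mul]
  rw [Finset.sum_comm]
  refine Finset.sum_congr rfl fun H _ => Finset.sum_congr rfl fun S _ => mul_comm _ _

/-- A gauge transformation of the auxiliary space does not change the row operator. -/
theorem rowOp_conj {d e L : ℕ} {G G' : Matrix (Fin e) (Fin e) ℂ} (hG : G' * G = 1)
    {V W : Fin L → Fin d → Fin d → Matrix (Fin e) (Fin e) ℂ}
    (h : ∀ j s s', G * V j s s' = W j s s' * G) : rowOp V = rowOp W := by
  have hG' : G * G' = 1 := mul_eq_one_comm.1 hG
  have key : ∀ l : List (Matrix (Fin e) (Fin e) ℂ × Matrix (Fin e) (Fin e) ℂ),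
      (∀ x ∈ l, G * x.1 = x.2 * G) →
      G * (l.map Prod.fst).prod = (l.map Prod.snd).prod * G := by
    intro l
    induction l with
    | nil => simp
    | cons x l ih =>
      intro hl
      simp only [List.map_cons, List.prod_cons]
      rw [← mul_assoc, hl x (by simp), mul_assoc, ih fun y hy => hl y (by simp [hy]), mul_assoc]
  ext s s'
  have := key (List.ofFn fun j => (V j (s j) (s' j), W j (s j) (s' j))) (by
    intro x hx
    obtain ⟨j, rfl⟩ := List.mem_ofFn.1 hx
    exact h _ _ _)
  rw [List.map_ofFn, List.map_ofFn] at this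
  simp only [rowOp, Matrix.of_apply]
  change G * (List.ofFn fun j => V j (s j) (s' j)).prod =
    (List.ofFn fun j => W j (s j) (s' j)).prod * G at this
  calc _ = (G' * (G * (List.ofFn fun j => V j (s j) (s' j)).prod)).trace := by
        rw [← mul_assoc, hG, one_mul]
    _ = _ := by rw [this, Matrix.trace_mul_comm, mul_assoc, hG', mul_one]

/-! ### Operators supported on a set of sites -/

/-- The matrix in the auxiliary space between two configurations of the chain. -/
def slice {d L : ℕ} (X : AuxOp d L) (s s' : Fin L → Fin d) : Matrix (Fin d) (Fin d) ℂ :=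
  Matrix.of fun a b => X a b s s'

/-- The matrix in the first tensor factor between two basis vectors of the second. -/
def vertex {d : ℕ} (A : Matrix (Fin d × Fin d) (Fin d × Fin d) ℂ) (u v : Fin d) :
    Matrix (Fin d) (Fin d) ℂ :=
  Matrix.of fun a b => A (a, u) (b, v)

theorem slice_mul {d L : ℕ} (X Y : AuxOp d L) (s s' : Fin L → Fin d) :
    slice (X * Y) s s' = ∑ q, slice X s q * slice Y q s' := by
  ext a b
  simp only [slice, Matrix.of_apply, Matrix.mul_apply, Matrix.sum_apply]
  rw [Finset.sum_comm]

theorem trace_slice {d L : ℕ} (X : AuxOp d L) (s s' : Fin L → Fin d) :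
    (slice X s s').trace = X.trace s s' := by
  simp [Matrix.trace, slice, Matrix.sum_apply]

/-- `X` acts nontrivially only on the sites in `S`, where its slices are given by `F`. -/
structure SupportedOn {d L : ℕ} (S : Finset (Fin L)) (X : AuxOp d L)
    (F : (Fin L → Fin d) → (Fin L → Fin d) → Matrix (Fin d) (Fin d) ℂ) : Prop where
  slice_eq : ∀ s s', slice X s s' = if ∀ k ∉ S, s k = s' k then F s s' else 0
  congr : ∀ s s' q q', (∀ k ∈ S, s k = q k) → (∀ k ∈ S, s' k = q' k) → F s s' = F q q'

/-- For disjoint supports a single intermediate configuration contributes to `slice_mul`: the one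
equal to `s'` on `S` and to `s` elsewhere. This reduces operator products over distinct sites to
products of $d\times d$ matrices. -/
theorem SupportedOn.mul {d L : ℕ} {S S' : Finset (Fin L)} {X X' : AuxOp d L}
    {F F' : (Fin L → Fin d) → (Fin L → Fin d) → Matrix (Fin d) (Fin d) ℂ}
    (h : SupportedOn S X F) (h' : SupportedOn S' X' F') (hd : Disjoint S S') :
    SupportedOn (S ∪ S') (X * X') fun s s' => F s s' * F' s s' where
  slice_eq s s' := by
    rw [slice_mul, Finset.sum_eq_single (fun k => if k ∈ S then s' k else s k)]
    · rw [h.slice_eq, if_pos (fun k hk => by simp [hk]), h'.slice_eq,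
        h.congr s (fun k => if k ∈ S then s' k else s k) s s' (fun _ _ => rfl)
          (fun k hk => by simp [hk]),
        h'.congr (fun k => if k ∈ S then s' k else s k) s' s s' (fun k hk => by
          simp [Finset.disjoint_right.1 hd hk]) (fun _ _ => rfl), mul_ite, mul_zero]
      refine if_congr ⟨fun hk k hkS => ?_, fun hk k hkS => ?_⟩ rfl rfl
      · rw [Finset.mem_union, not_or] at hkS
        simpa [hkS.1] using hk k hkS.2
      · by_cases hkS' : k ∈ S
        · simp [hkS']
        · simpa [hkS'] using hk k (by simp [hkS, hkS'])
    · intro q _ hq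
      rw [h.slice_eq, h'.slice_eq]
      split_ifs with h1 h2
      · refine absurd ?_ hq
        funext k
        split_ifs with hk
        · exact h2 k (Finset.disjoint_left.1 hd hk)
        · exact (h1 k hk).symm
      all_goals simp
    · simp
  congr s s' q q' hs hs' := by
    rw [h.congr s s' q q' (fun k hk => hs k (Finset.mem_union_left _ hk))
        (fun k hk => hs' k (Finset.mem_union_left _ hk)),
      h'.congr s s' q q' (fun k hk => hs k (Finset.mem_union_right _ hk))
        (fun k hk => hs' k (Finset.mem_union_right _ hk))]

theorem supportedOn_aux {d L : ℕ} (x : Matrix (Fin d) (Fin d) ℂ) :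
    SupportedOn ∅ (aux L x) fun _ _ => x where
  slice_eq s s' := by
    ext a b
    simp only [slice, aux, Matrix.of_apply, Matrix.smul_apply, Matrix.one_apply, funext_iff,
      Finset.notMem_empty, not_false_eq_true, true_implies]
    split_ifs <;> simp
  congr _ _ _ _ _ _ := rfl

theorem supportedOn_auxSite {d L : ℕ} (j : Fin L)
    (A : Matrix (Fin d × Fin d) (Fin d × Fin d) ℂ) :
    SupportedOn {j} (auxSite j A) fun s s' => vertex A (s j) (s' j) where
  slice_eq s s' := by
    ext a b
    simp only [slice, auxSite, site, Matrix.of_apply, Finset.mem_singleton, vertex, ← ne_eq]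
    by_cases hk : ∀ k, k ≠ j → s k = s' k
    · rw [if_pos hk, if_pos hk, Matrix.of_apply]
    · rw [if_neg hk, if_neg hk, Matrix.zero_apply]
  congr s s' q q' h h' := by
    rw [h j (Finset.mem_singleton_self j), h' j (Finset.mem_singleton_self j)]

theorem supportedOn_list {d L : ℕ} (A : Fin L → Matrix (Fin d × Fin d) (Fin d × Fin d) ℂ)
    (l : List (Fin L)) (hl : l.Nodup) :
    SupportedOn l.toFinset (l.map fun j => auxSite j (A j)).prod
      fun s s' => (l.map fun j => vertex (A j) (s j) (s' j)).prod := by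
  induction l with
  | nil =>
    have := supportedOn_aux (L := L) (1 : Matrix (Fin d) (Fin d) ℂ)
    have h1 : aux L (1 : Matrix (Fin d) (Fin d) ℂ) = 1 := by
      ext a b : 2
      simp only [aux, Matrix.of_apply, Matrix.one_apply]
      split_ifs <;> simp
    rw [h1] at this
    simpa using this
  | cons j l ih =>
    rw [List.nodup_cons] at hl
    have := (supportedOn_auxSite j (A j)).mul (ih hl.2) (by simpa using hl.1)
    rw [List.toFinset_cons, Finset.insert_eq]
    exact this

theorem SupportedOn.trace_apply {d L : ℕ} {S : Finset (Fin L)} {X : AuxOp d L}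
    {F : (Fin L → Fin d) → (Fin L → Fin d) → Matrix (Fin d) (Fin d) ℂ}
    (h : SupportedOn S X F) (hS : ∀ k, k ∈ S) (s s' : Fin L → Fin d) :
    X.trace s s' = (F s s').trace := by
  rw [← trace_slice, h.slice_eq, if_pos fun k hk => absurd (hS k) hk]

/-- The monodromy matrix is a descending product while `rowOp` is ascending; transposing the
vertices inside the trace reverses the order. -/
theorem rowTransfer_eq_rowOp {d L : ℕ} (R : ℂ → ℂ → Matrix (Fin d × Fin d) (Fin d × Fin d) ℂ)
    (lam : ℂ) : rowTransfer R L lam = rowOp fun _ u v => (vertex (R lam 0) u v)ᵀ := by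
  ext s s'
  have h := supportedOn_list (L := L) (fun _ => R lam 0) (List.finRange L).reverse
    (List.nodup_reverse.2 (List.nodup_finRange L))
  rw [rowTransfer, List.ofFn_eq_map, ← List.map_reverse, h.trace_apply (by simp), rowOp,
    Matrix.of_apply, List.map_reverse, ← List.ofFn_eq_map, trace_reverse_prod_ofFn]

theorem rowTransferBar_eq_rowOp {d L : ℕ} (R : ℂ → ℂ → Matrix (Fin d × Fin d) (Fin d × Fin d) ℂ)
    (lam : ℂ) : rowTransferBar R L lam = rowOp fun _ u v => vertex (flip (R 0 lam)) u v := by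
  ext s s'
  have h := supportedOn_list (L := L) (fun _ => flip (R 0 lam)) (List.finRange L)
    (List.nodup_finRange L)
  rw [rowTransferBar, List.ofFn_eq_map]
  change ((List.finRange L).map fun j => auxSite j (flip (R 0 lam))).prod.trace s s' = _
  rw [h.trace_apply (by simp), rowOp, Matrix.of_apply, List.ofFn_eq_map]


/-! ### Powers near the identity -/

/-- Telescoping. The bound `‖1‖ ≤ 1` replaces `‖1‖ = 1` so that the zero ring is included. -/
theorem norm_pow_sub_pow_le {A : Type*} [NormedRing A] (h1 : ‖(1 : A)‖ ≤ 1) {a b : A} {M : ℝ}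
    (hM : 1 ≤ M) (ha : ‖a‖ ≤ M) (hb : ‖b‖ ≤ M) (n : ℕ) :
    ‖a ^ n - b ^ n‖ ≤ n * ‖a - b‖ * M ^ n := by
  have hp : ∀ n : ℕ, ‖a ^ n‖ ≤ M ^ n := by
    intro n
    induction n with
    | zero => simpa using h1
    | succ n ih =>
      rw [pow_succ, pow_succ]
      exact (norm_mul_le _ _).trans (by gcongr)
  induction n with
  | zero => simp
  | succ n ih =>
    have e : a ^ (n + 1) - b ^ (n + 1) = a ^ n * (a - b) + (a ^ n - b ^ n) * b := by
      rw [pow_succ, pow_succ]; noncomm_ring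
    have hMn : 0 ≤ M ^ n := by positivity
    calc ‖a ^ (n + 1) - b ^ (n + 1)‖ ≤ ‖a ^ n‖ * ‖a - b‖ + ‖a ^ n - b ^ n‖ * ‖b‖ := by
          rw [e]
          exact (norm_add_le _ _).trans (add_le_add (norm_mul_le _ _) (norm_mul_le _ _))
      _ ≤ M ^ n * ‖a - b‖ * M + (n * ‖a - b‖ * M ^ n) * M := by
          refine add_le_add ?_ (by gcongr)
          calc ‖a ^ n‖ * ‖a - b‖ ≤ M ^ n * ‖a - b‖ := by gcongr; exact hp n
            _ ≤ M ^ n * ‖a - b‖ * M := le_mul_of_one_le_right (by positivity) hM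
      _ = _ := by push_cast; ring

/-- Functions with the same value and derivative differ by $o(1/n)$ at $c/n$. Their norms are at
most $1+O(1/n)$, so $n$-th powers stay bounded and the telescoping estimate gives $n\cdot
o(1/n)\to0$. -/
theorem tendsto_pow_sub_pow_of_hasDerivAt {A : Type*} [NormedRing A] [NormedAlgebra ℂ A]
    (h1 : ‖(1 : A)‖ ≤ 1) {f g : ℂ → A} {f' : A} (hf : HasDerivAt f f' 0) (hg : HasDerivAt g f' 0)
    (hf0 : f 0 = 1) (hg0 : g 0 = 1) (c : ℂ) :
    Filter.Tendsto (fun n : ℕ => f (c / n) ^ n - g (c / n) ^ n) Filter.atTop (𝓝 0) := by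
  have hz : Filter.Tendsto (fun n : ℕ => c / (n : ℂ)) Filter.atTop (𝓝 0) :=
    tendsto_const_div_atTop_nhds_zero_nat c
  obtain ⟨C, hC⟩ := hf.isBigO_sub.bound
  obtain ⟨C', hC'⟩ := hg.isBigO_sub.bound
  set D := max (max C C') 0 with hD
  have ho : (fun z => f z - g z) =o[𝓝 0] fun z : ℂ => z := by
    have := (hasDerivAt_iff_isLittleO.1 hf).sub (hasDerivAt_iff_isLittleO.1 hg)
    simpa [hf0, hg0] using this
  rw [Metric.tendsto_atTop]
  intro ε hε
  -- The summand `1` keeps `E` positive when `c = 0`, since `E` is used as a denominator.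
  set E := (‖c‖ + 1) * Real.exp (D * ‖c‖) with hE
  have hEpos : 0 < E := by positivity
  have hb := ho.bound (show 0 < ε / (2 * E) by positivity)
  have hev := hz.eventually (hC.and (hC'.and hb))
  obtain ⟨n₀, hn₀⟩ := Filter.eventually_atTop.1 hev
  refine ⟨n₀ + 1, fun n hn => ?_⟩
  obtain ⟨b1, b2, b3⟩ := hn₀ n (by omega)
  have hn0 : (0 : ℝ) < n := by exact_mod_cast (by omega : 0 < n)
  have hcn : ‖c / (n : ℂ)‖ = ‖c‖ / n := by simp
  rw [hf0, sub_zero, hcn] at b1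
  rw [hg0, sub_zero, hcn] at b2
  rw [hcn] at b3
  have hle : ∀ {a : A} {C₁ : ℝ}, C₁ ≤ D → ‖a - 1‖ ≤ C₁ * (‖c‖ / n) → ‖a‖ ≤ 1 + D * (‖c‖ / n) := by
    intro a C₁ hC₁ ha
    calc ‖a‖ = ‖1 + (a - 1)‖ := by rw [add_sub_cancel]
      _ ≤ ‖(1 : A)‖ + ‖a - 1‖ := norm_add_le _ _
      _ ≤ 1 + D * (‖c‖ / n) := add_le_add h1 (ha.trans (by gcongr))
  have hfa := hle ((le_max_left C C').trans (le_max_left _ _)) b1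
  have hga := hle ((le_max_right C C').trans (le_max_left _ _)) b2
  have hDn : 0 ≤ D * (‖c‖ / n) := mul_nonneg (le_max_right _ _) (by positivity)
  have key := norm_pow_sub_pow_le h1 (by linarith) hfa hga n
  have hexp : (1 + D * (‖c‖ / n)) ^ n ≤ Real.exp (D * ‖c‖) := by
    calc (1 + D * (‖c‖ / n)) ^ n ≤ Real.exp (D * (‖c‖ / n)) ^ n := by
          gcongr; rw [add_comm]; exact Real.add_one_le_exp _
      _ = Real.exp (D * ‖c‖) := by
          rw [← Real.exp_nat_mul]; congr 1; field_simp
  rw [dist_zero_right]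
  calc ‖f (c / n) ^ n - g (c / n) ^ n‖
      ≤ n * (ε / (2 * E) * (‖c‖ / n)) * Real.exp (D * ‖c‖) := key.trans (by gcongr)
    _ = ε / (2 * E) * (‖c‖ * Real.exp (D * ‖c‖)) := by field_simp
    _ ≤ ε / (2 * E) * E := by rw [hE]; gcongr; linarith
    _ = ε / 2 := by field_simp
    _ < ε := by linarith

/-- Compare `f` with $z\mapsto e^{zf'}$, whose $n$-th power at $c/n$ does not depend on $n$. -/
theorem tendsto_pow_exp_of_hasDerivAt {A : Type*} [NormedRing A] [NormedAlgebra ℂ A]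
    [CompleteSpace A] (h1 : ‖(1 : A)‖ ≤ 1) {f : ℂ → A} {f' : A} (hf : HasDerivAt f f' 0)
    (hf0 : f 0 = 1) (c : ℂ) :
    Filter.Tendsto (fun n : ℕ => f (c / n) ^ n) Filter.atTop (𝓝 (NormedSpace.exp (c • f'))) := by
  let _ : NormedAlgebra ℚ A := NormedAlgebra.restrictScalars ℚ ℂ A
  have hg : HasDerivAt (fun z : ℂ => NormedSpace.exp (z • f')) f' 0 := by
    simpa using hasDerivAt_exp_smul_const f' (0 : ℂ)
  have := tendsto_pow_sub_pow_of_hasDerivAt h1 hf hg hf0 (by simp) c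
  have h2 := this.add (tendsto_const_nhds (x := NormedSpace.exp (c • f')))
  rw [zero_add] at h2
  refine h2.congr' ?_
  filter_upwards [Filter.eventually_gt_atTop 0] with n hn
  have : NormedSpace.exp ((c / n) • f') ^ n = NormedSpace.exp (c • f') := by
    rw [← NormedSpace.exp_nsmul, ← Nat.cast_smul_eq_nsmul ℂ, smul_smul, mul_div_cancel₀]
    exact_mod_cast hn.ne'
  rw [this, sub_add_cancel]

theorem matrix_tendsto_pow_exp {I : Type*} [Fintype I] [DecidableEq I] {f : ℂ → Matrix I I ℂ}
    {f' : Matrix I I ℂ} (hf : ∀ i j, HasDerivAt (fun z => f z i j) (f' i j) 0) (hf0 : f 0 = 1)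
    (c : ℂ) :
    Filter.Tendsto (fun n : ℕ => f (c / n) ^ n) Filter.atTop (𝓝 (NormedSpace.exp (c • f'))) := by
  open scoped Matrix.Norms.Operator in
  refine tendsto_pow_exp_of_hasDerivAt ?_ ?_ hf0 c
  -- An empty index type makes the matrix ring trivial, with `‖1‖ = 0`.
  · rcases isEmpty_or_nonempty I with h | h
    · have : (1 : Matrix I I ℂ) = 0 := Subsingleton.elim _ _
      rw [this, norm_zero]; exact zero_le_one
    · exact norm_one.le
  · have := HasDerivAt.fun_sum (u := Finset.univ) fun i _ =>
      HasDerivAt.fun_sum (u := Finset.univ) fun j _ =>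
        (hf i j).smul_const (Matrix.single i j (1 : ℂ))
    simpa [Matrix.smul_single, ← Matrix.matrix_eq_sum_single] using this


/-! ### Homogeneous row transfer matrices -/

/-- The row transfer matrix `tr_0 {A_{0,L} ⋯ A_{0,1}}`. -/
def homRow {d : ℕ} (L : ℕ) (A : Matrix (Fin d × Fin d) (Fin d × Fin d) ℂ) : Op d L :=
  rowOp fun _ u v => (vertex A u v)ᵀ

theorem homRow_apply {d L : ℕ} [NeZero L] (A : Matrix (Fin d × Fin d) (Fin d × Fin d) ℂ)
    (s s' : Fin L → Fin d) :
    homRow L A s s' = ∑ p : Fin L → Fin d, ∏ i, A (p i, s i) (p (i - 1), s' i) := by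
  simp [homRow, rowOp, trace_prod_ofFn, vertex]

theorem rowTransfer_eq_homRow {d : ℕ} (R : ℂ → ℂ → Matrix (Fin d × Fin d) (Fin d × Fin d) ℂ)
    (L : ℕ) (lam : ℂ) : rowTransfer R L lam = homRow L (R lam 0) :=
  rowTransfer_eq_rowOp R lam

/-- Symmetry of `R` turns the ascending row into the transpose of a descending one, so a single
derivative formula serves both transfer matrices. -/
theorem rowTransferBar_eq_homRow {d : ℕ} {R : ℂ → ℂ → Matrix (Fin d × Fin d) (Fin d × Fin d) ℂ}
    (L : ℕ) {lam : ℂ} (h : (R 0 lam)ᵀ = R 0 lam) :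
    rowTransferBar R L lam = (homRow L (flip (R 0 lam)))ᵀ := by
  rw [rowTransferBar_eq_rowOp]
  ext s s'
  simp only [homRow, rowOp, Matrix.of_apply, Matrix.transpose_apply]
  congr 3
  funext j
  ext a b
  exact congrFun (congrFun h (s' j, b)) (s j, a)

theorem theta_neg_mul {d : ℕ} (phi : Matrix (Fin d) (Fin d) ℂ) (a : ℂ) :
    theta phi (-a) * theta phi a = 1 := by
  rw [theta, theta, ← Matrix.exp_add_of_commute _ _ ((Commute.refl phi).smul_left _ |>.smul_right _),
    ← add_smul, neg_add_cancel, zero_smul, NormedSpace.exp_zero]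

/-- The $U(1)$ symmetry, read at one vertex: moving `g` across the vertex on the quantum line
amounts to conjugation by `g` on the auxiliary line. Along a closed row these conjugations cancel
(`rowOp_conj`). -/
theorem theta_mul_vertex {d : ℕ} {A : Matrix (Fin d × Fin d) (Fin d × Fin d) ℂ}
    {g : Matrix (Fin d) (Fin d) ℂ} (h : A * (g ⊗ₖ g) = (g ⊗ₖ g) * A) (s s' : Fin d) :
    g * (∑ q, g s q • vertex A q s') = (∑ q, g q s' • vertex A s q) * g := by
  ext a b
  have := congrFun (congrFun h (a, s)) (b, s')
  simp only [Matrix.mul_apply, Fintype.sum_prod_type, Matrix.kroneckerMap_apply] at this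
  simp only [Matrix.mul_apply, Matrix.sum_apply, Matrix.smul_apply, vertex, Matrix.of_apply,
    smul_eq_mul, Finset.mul_sum, Finset.sum_mul]
  refine Eq.trans ?_ (this.symm.trans ?_) <;>
    exact Finset.sum_congr rfl fun c _ => Finset.sum_congr rfl fun q _ => by ring

theorem tens_commute_homRow {d L : ℕ} {A : Matrix (Fin d × Fin d) (Fin d × Fin d) ℂ}
    {g g' : Matrix (Fin d) (Fin d) ℂ} (hg : g' * g = 1) (h : A * (g ⊗ₖ g) = (g ⊗ₖ g) * A) :
    Commute (tens fun _ : Fin L => g) (homRow L A) := by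
  rw [Commute, SemiconjBy, homRow, tens_mul_rowOp, rowOp_mul_tens]
  refine (rowOp_conj (G := gᵀ) (G' := g'ᵀ) ?_ fun j s s' => ?_).symm
  · rw [← Matrix.transpose_mul, mul_eq_one_comm.1 hg, Matrix.transpose_one]
  · have := congrArg Matrix.transpose (theta_mul_vertex h s s')
    simpa only [Matrix.transpose_mul, Matrix.transpose_sum, Matrix.transpose_smul] using this.symm

theorem tens_commute_rowTransferBar {d L : ℕ}
    {R : ℂ → ℂ → Matrix (Fin d × Fin d) (Fin d × Fin d) ℂ} {lam : ℂ}
    {g g' : Matrix (Fin d) (Fin d) ℂ} (hg : g' * g = 1)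
    (h : R 0 lam * (g ⊗ₖ g) = (g ⊗ₖ g) * R 0 lam) :
    Commute (tens fun _ : Fin L => g) (rowTransferBar R L lam) := by
  rw [Commute, SemiconjBy, rowTransferBar_eq_rowOp, tens_mul_rowOp, rowOp_mul_tens]
  refine rowOp_conj (G := g) (G' := g') hg fun j s s' => theta_mul_vertex ?_ s s'
  ext a b
  have := congrFun (congrFun h a.swap) b.swap
  simp only [Matrix.mul_apply, Matrix.kroneckerMap_apply] at this
  rw [← (Equiv.prodComm (Fin d) (Fin d)).sum_comp] at this
  conv_rhs at this => rw [← (Equiv.prodComm (Fin d) (Fin d)).sum_comp]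
  simp only [Matrix.mul_apply, Matrix.kroneckerMap_apply, flip, Matrix.of_apply]
  refine Eq.trans ?_ (this.trans ?_) <;>
    refine Finset.sum_congr rfl fun c _ => ?_ <;> simp [mul_comm]

/-! ### The shift operator and first-order deformations of it. -/

/-- The cyclic shift of the chain. -/
def shift (d L : ℕ) [NeZero L] : Op d L :=
  Matrix.of fun s s' => if s = fun i => s' (i - 1) then 1 else 0

theorem mul_shift_apply {d L : ℕ} [NeZero L] (M : Op d L) (s s' : Fin L → Fin d) :
    (M * shift d L) s s' = M s fun i => s' (i - 1) := by
  simp [Matrix.mul_apply, shift]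

theorem shift_mul_apply {d L : ℕ} [NeZero L] (M : Op d L) (s s' : Fin L → Fin d) :
    (shift d L * M) s s' = M (fun i => s (i + 1)) s' := by
  have : ∀ q : Fin L → Fin d, (s = fun i => q (i - 1)) ↔ q = fun i => s (i + 1) := by
    intro q
    constructor
    · rintro rfl; funext i; simp
    · rintro rfl; funext i; simp
  simp [Matrix.mul_apply, shift, this]

theorem shift_transpose_mul {d L : ℕ} [NeZero L] : (shift d L)ᵀ * shift d L = 1 := by
  ext s s'
  rw [mul_shift_apply, Matrix.transpose_apply, shift, Matrix.of_apply, Matrix.one_apply]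
  refine if_congr ⟨fun h => ?_, fun h => ?_⟩ rfl rfl
  · funext i
    simpa using (congrFun h (i + 1)).symm
  · rw [h]

/-- Each permutation vertex forces its auxiliary edge to carry the label `s' i` of its own site, so
only the path `s'` survives. -/
theorem homRow_perm {d L : ℕ} [NeZero L] : homRow L (perm d) = shift d L := by
  ext s s'
  rw [homRow_apply, Finset.sum_eq_single s']
  · simp [perm, shift, Finset.prod_ite_zero, funext_iff]
  · intro p _ hp
    obtain ⟨i, hi⟩ := Function.ne_iff.1 hp
    exact Finset.prod_eq_zero (Finset.mem_univ i) (by simp [perm, hi])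
  · simp

/-- The derivative of `homRow` at the permutation matrix in the direction `A`. -/
def homRowDeriv {d : ℕ} (L : ℕ) [NeZero L] (A : Matrix (Fin d × Fin d) (Fin d × Fin d) ℂ) :
    Op d L :=
  Matrix.of fun s s' => ∑ p : Fin L → Fin d, ∑ j,
    (∏ i ∈ Finset.univ.erase j, perm d (p i, s i) (p (i - 1), s' i)) *
      A (p j, s j) (p (j - 1), s' j)

theorem hasDerivAt_homRow {d L : ℕ} [NeZero L]
    {A : ℂ → Matrix (Fin d × Fin d) (Fin d × Fin d) ℂ}
    {A' : Matrix (Fin d × Fin d) (Fin d × Fin d) ℂ} (h0 : A 0 = perm d)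
    (hA : ∀ a b, HasDerivAt (fun z => A z a b) (A' a b) 0) (s s' : Fin L → Fin d) :
    HasDerivAt (fun z => homRow L (A z) s s') (homRowDeriv L A' s s') 0 := by
  simp only [homRow_apply, homRowDeriv, Matrix.of_apply, ← h0]
  refine HasDerivAt.fun_sum fun p _ => ?_
  have := HasDerivAt.fun_finsetProd (u := Finset.univ) fun i (_ : i ∈ Finset.univ) =>
    hA (p i, s i) (p (i - 1), s' i)
  simpa only [smul_eq_mul] using this

/-- The permutations at all sites except `j` fix every auxiliary edge except the one after `j`, and
the permutation at `j + 1` fixes that one to be `s (j + 1)`. Then the constraint at `j + 1` holds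
automatically, whence the disjunction in the indicator. -/
theorem homRowDeriv_apply {d L : ℕ} [NeZero L] (hL : 2 ≤ L)
    (A : Matrix (Fin d × Fin d) (Fin d × Fin d) ℂ) (s s' : Fin L → Fin d) :
    homRowDeriv L A s s' = ∑ j, (∏ i ∈ Finset.univ.erase j,
      if i = j + 1 ∨ s i = s' (i - 1) then 1 else 0) * A (s (j + 1), s j) (s' (j - 1), s' j) := by
  have : Fact (1 < L) := ⟨hL⟩
  -- For `L = 1` the sites `j` and `j + 1` coincide and the remaining edge would stay free.
  have h1 : (1 : Fin L) ≠ 0 := by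
    intro h
    have := congrArg Fin.val h
    rw [Fin.val_one', Fin.val_zero, Nat.mod_eq_of_lt hL] at this
    omega
  rw [homRowDeriv, Matrix.of_apply, Finset.sum_comm]
  refine Finset.sum_congr rfl fun j _ => ?_
  rw [Finset.sum_eq_single (Function.update s' j (s (j + 1)))]
  · have hj1 : j - 1 ≠ j := by simpa [sub_eq_self] using h1
    rw [Function.update_self, Function.update_of_ne hj1]
    congr 1
    refine Finset.prod_congr rfl fun i hi => ?_
    have hij := Finset.ne_of_mem_erase hi
    simp only [perm, Matrix.of_apply, Function.update_of_ne hij, true_and]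
    by_cases hij' : i = j + 1
    · subst hij'; simp
    · have : i - 1 ≠ j := fun h => hij' (sub_eq_iff_eq_add.1 h)
      simp [hij', Function.update_of_ne this]
  · intro p _ hp
    obtain ⟨i, hi⟩ := Function.ne_iff.1 hp
    by_cases hij : i = j
    · subst hij
      rw [Function.update_self] at hi
      have hm : i + 1 ∈ Finset.univ.erase i := by simpa using h1
      rw [Finset.prod_eq_zero hm, zero_mul]
      simp [perm, Ne.symm hi]
    · rw [Function.update_of_ne hij] at hi
      have hm : i ∈ Finset.univ.erase j := by simpa using hij
      rw [Finset.prod_eq_zero hm, zero_mul]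
      simp [perm, hi]
  · simp

/-- This is the rule $(t^{-1})'=-t^{-1}t't^{-1}$ at the shift: to first order, the barred transfer
matrix is the inverse of the unbarred one. -/
theorem shift_mul_homRowDeriv_mul_shift {d L : ℕ} [NeZero L] (hL : 2 ≤ L)
    {A B : Matrix (Fin d × Fin d) (Fin d × Fin d) ℂ}
    (h : ∀ a b, B a b = -A b.swap a.swap) :
    shift d L * (homRowDeriv L B)ᵀ * shift d L = -homRowDeriv L A := by
  ext s s'
  rw [mul_shift_apply, shift_mul_apply, Matrix.transpose_apply, Matrix.neg_apply,
    homRowDeriv_apply hL, homRowDeriv_apply hL, ← Finset.sum_neg_distrib]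
  refine Finset.sum_congr rfl fun j _ => ?_
  rw [h, ← mul_neg]
  simp only [Prod.swap_prod_mk, add_sub_cancel_right, sub_add_cancel]
  congr 1
  refine Finset.prod_congr rfl fun i _ => if_congr ?_ rfl rfl
  rw [eq_comm (a := s i)]


/-! ### The Trotter limit -/

theorem hasDerivAt_matrix_mul {I J K : Type*} [Fintype J] {A : ℂ → Matrix I J ℂ}
    {B : ℂ → Matrix J K ℂ} {A' : Matrix I J ℂ} {B' : Matrix J K ℂ} {z : ℂ}
    (hA : ∀ i j, HasDerivAt (fun w => A w i j) (A' i j) z)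
    (hB : ∀ i j, HasDerivAt (fun w => B w i j) (B' i j) z) (i : I) (k : K) :
    HasDerivAt (fun w => (A w * B w) i k) ((A' * B z + A z * B') i k) z := by
  simp only [Matrix.mul_apply, Matrix.add_apply, ← Finset.sum_add_distrib]
  exact HasDerivAt.fun_sum fun j _ => (hA i j).mul (hB j k)

theorem hasDerivAt_matrix_of_mul_eq_one {I : Type*} [Fintype I] [DecidableEq I]
    {A B : ℂ → Matrix I I ℂ} {A' : Matrix I I ℂ} {z : ℂ}
    (hA : ∀ i j, HasDerivAt (fun w => A w i j) (A' i j) z) (hAB : ∀ᶠ w in 𝓝 z, A w * B w = 1)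
    (i j : I) : HasDerivAt (fun w => B w i j) (-(B z * A' * B z) i j) z := by
  open scoped Matrix.Norms.Operator in
  have h1 : HasDerivAt A A' z := by
    have := HasDerivAt.fun_sum (u := Finset.univ) fun i _ =>
      HasDerivAt.fun_sum (u := Finset.univ) fun j _ =>
        (hA i j).smul_const (Matrix.single i j (1 : ℂ))
    simp only [Matrix.smul_single, smul_eq_mul, mul_one, ← Matrix.matrix_eq_sum_single] at this
    exact this
  have hz := hAB.self_of_nhds
  let u : (Matrix I I ℂ)ˣ := ⟨A z, B z, hz, mul_eq_one_comm.1 hz⟩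
  open scoped Matrix.Norms.Operator in
  have h2 : HasFDerivAt Ring.inverse (-ContinuousLinearMap.mulLeftRight ℂ _ (B z) (B z)) (A z) :=
    hasFDerivAt_ringInverse (𝕜 := ℂ) u
  open scoped Matrix.Norms.Operator in
  have h3 := h2.comp_hasDerivAt z h1
  open scoped Matrix.Norms.Operator in
  have h4 : HasDerivAt B (-(B z * A' * B z)) z := by
    refine HasDerivAt.congr_of_eventuallyEq (by simpa using h3) ?_
    filter_upwards [hAB] with w hw
    exact (Ring.inverse_unit ⟨A w, B w, hw, mul_eq_one_comm.1 hw⟩).symm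
  open scoped Matrix.Norms.Operator in
  exact ((Matrix.entryLinearMap ℂ ℂ i j).toContinuousLinearMap.hasFDerivAt.comp_hasDerivAt z h4)

section Trotter

variable {d : ℕ} {R : ℂ → ℂ → Matrix (Fin d × Fin d) (Fin d × Fin d) ℂ} {U : Set ℂ}

/-- The derivative of `λ ↦ R(λ, 0)` at `0`. -/
def derivR (R : ℂ → ℂ → Matrix (Fin d × Fin d) (Fin d × Fin d) ℂ) :
    Matrix (Fin d × Fin d) (Fin d × Fin d) ℂ :=
  Matrix.of fun a b => deriv (fun lam => R lam 0 a b) 0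

theorem IsFundamental.hasDerivAt (hR : IsFundamental R U) (a b : Fin d × Fin d) :
    HasDerivAt (fun lam => R lam 0 a b) (derivR R a b) 0 :=
  (hR.differentiable a b).hasDerivAt

theorem IsFundamental.derivR_symm (hU : U ∈ 𝓝 (0 : ℂ)) (hR : IsFundamental R U)
    (a b : Fin d × Fin d) : derivR R a b = derivR R b a := by
  refine Filter.EventuallyEq.deriv_eq ?_
  filter_upwards [hU] with z hz
  exact congrFun (congrFun (hR.symmetric z hz 0 (mem_of_mem_nhds hU)) b) a

theorem perm_mul {d : ℕ} (A : Matrix (Fin d × Fin d) (Fin d × Fin d) ℂ) (a b : Fin d × Fin d) :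
    (perm d * A) a b = A a.swap b := by
  rw [Matrix.mul_apply, Finset.sum_eq_single a.swap]
  · simp [perm]
  · intro c _ hc
    have : ¬ (a.1 = c.2 ∧ a.2 = c.1) := fun h => hc (Prod.ext h.2.symm h.1.symm)
    simp [perm, this]
  · simp

theorem mul_perm {d : ℕ} (A : Matrix (Fin d × Fin d) (Fin d × Fin d) ℂ) (a b : Fin d × Fin d) :
    (A * perm d) a b = A a b.swap := by
  rw [Matrix.mul_apply, Finset.sum_eq_single b.swap]
  · simp [perm]
  · intro c _ hc
    have : ¬ (c.1 = b.2 ∧ c.2 = b.1) := fun h => hc (Prod.ext h.1 h.2)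
    simp [perm, this]
  · simp

theorem flip_perm {d : ℕ} : flip (perm d) = perm d := by
  ext a b
  simp [flip, perm, and_comm]

/-- Differentiating unitarity at $0$ gives $-PR'P$. Symmetry of $R'$ then brings the entries to the
form required by `shift_mul_homRowDeriv_mul_shift`. -/
theorem IsFundamental.hasDerivAt_flip (hU : U ∈ 𝓝 (0 : ℂ)) (hR : IsFundamental R U)
    (a b : Fin d × Fin d) :
    HasDerivAt (fun lam => flip (R 0 lam) a b)
      ((Matrix.of fun a b => -derivR R b.swap a.swap :
        Matrix (Fin d × Fin d) (Fin d × Fin d) ℂ) a b) 0 := by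
  have h0 := mem_of_mem_nhds hU
  have := hasDerivAt_matrix_of_mul_eq_one (B := fun lam => flip (R 0 lam)) hR.hasDerivAt
    (by filter_upwards [hU] with z hz using hR.unitary z hz 0 h0) a b
  rw [hR.regular 0 h0, flip_perm, mul_perm, perm_mul, hR.derivR_symm hU] at this
  exact this

theorem IsFundamental.hasDerivAt_rowTransfer {L : ℕ} [NeZero L] (hU : U ∈ 𝓝 (0 : ℂ))
    (hR : IsFundamental R U) (s s' : Fin L → Fin d) :
    HasDerivAt (fun lam => rowTransfer R L lam s s') (homRowDeriv L (derivR R) s s') 0 := by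
  simp only [rowTransfer_eq_homRow]
  exact hasDerivAt_homRow (A := fun z => R z 0) (hR.regular 0 (mem_of_mem_nhds hU)) hR.hasDerivAt s s'

theorem IsFundamental.rowTransfer_zero {L : ℕ} [NeZero L] (hU : U ∈ 𝓝 (0 : ℂ))
    (hR : IsFundamental R U) : rowTransfer R L 0 = shift d L := by
  rw [rowTransfer_eq_homRow, hR.regular 0 (mem_of_mem_nhds hU), homRow_perm]

theorem IsFundamental.rowTransferBar_zero {L : ℕ} [NeZero L] (hU : U ∈ 𝓝 (0 : ℂ))
    (hR : IsFundamental R U) : rowTransferBar R L 0 = (shift d L)ᵀ := by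
  have h0 := mem_of_mem_nhds hU
  rw [rowTransferBar_eq_homRow _ (hR.symmetric 0 h0 0 h0), hR.regular 0 h0, flip_perm, homRow_perm]

theorem IsFundamental.rowTransfer_mul_rowTransferBar_zero {L : ℕ} [NeZero L]
    (hU : U ∈ 𝓝 (0 : ℂ)) (hR : IsFundamental R U) :
    rowTransfer R L 0 * rowTransferBar R L 0 = 1 := by
  rw [hR.rowTransfer_zero hU, hR.rowTransferBar_zero hU]
  exact mul_eq_one_comm.1 shift_transpose_mul

theorem IsFundamental.hamiltonian0_eq {L : ℕ} [NeZero L] (hU : U ∈ 𝓝 (0 : ℂ))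
    (hR : IsFundamental R U) (kappa : ℂ) :
    hamiltonian0 R kappa L = (1 / kappa) • (homRowDeriv L (derivR R) * (shift d L)ᵀ) := by
  have : (Matrix.of fun s s' => deriv (fun lam => rowTransfer R L lam s s') 0) =
      homRowDeriv L (derivR R) := by
    ext s s'
    exact (hR.hasDerivAt_rowTransfer hU s s').deriv
  rw [hamiltonian0, this, hR.rowTransfer_zero hU, Matrix.inv_eq_left_inv shift_transpose_mul]

/-- The function $z\mapsto t_\perp(-z)\overline t_\perp(z)$ is $1$ at $z=0$ with derivative
$-2t_\perp'(0)t_\perp(0)^{-1}$, one half from each factor. -/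
theorem IsFundamental.tendsto_rho {L : ℕ} [NeZero L] (hL : 2 ≤ L) (hU : U ∈ 𝓝 (0 : ℂ))
    (hR : IsFundamental R U) {kappa : ℂ} (beta : ℂ) :
    Filter.Tendsto (fun n => rho R kappa n L beta) Filter.atTop
      (𝓝 (NormedSpace.exp ((-beta) • hamiltonian0 R kappa L))) := by
  have h0 := mem_of_mem_nhds hU
  set D := homRowDeriv L (derivR R) with hD
  set B : Matrix (Fin d × Fin d) (Fin d × Fin d) ℂ :=
    Matrix.of fun a b => -derivR R b.swap a.swap with hB
  have d1 : ∀ s s', HasDerivAt (fun z => rowTransfer R L (-z) s s') ((-D) s s') 0 := by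
    intro s s'
    have h1 : HasDerivAt (fun lam => rowTransfer R L lam s s') (D s s') (-0) := by
      rw [neg_zero]; exact hR.hasDerivAt_rowTransfer hU s s'
    simpa [Function.comp_def] using h1.scomp (0 : ℂ) (hasDerivAt_neg (0 : ℂ))
  have d2 : ∀ s s', HasDerivAt (fun z => rowTransferBar R L z s s')
      ((homRowDeriv L B)ᵀ s s') 0 := by
    intro s s'
    have h1 := hasDerivAt_homRow (L := L) (A := fun z => flip (R 0 z)) (A' := B)
      (by rw [hR.regular 0 h0, flip_perm]) (hR.hasDerivAt_flip hU) s' s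
    refine h1.congr_of_eventuallyEq ?_
    filter_upwards [hU] with z hz
    rw [rowTransferBar_eq_homRow _ (hR.symmetric 0 h0 z hz), Matrix.transpose_apply]
  have d3 := hasDerivAt_matrix_mul d1 d2
  have hS : shift d L * (shift d L)ᵀ = 1 := mul_eq_one_comm.1 shift_transpose_mul
  have key : (-D) * rowTransferBar R L 0 + rowTransfer R L (-0) * (homRowDeriv L B)ᵀ =
      (-2 : ℂ) • (D * (shift d L)ᵀ) := by
    have h1 := shift_mul_homRowDeriv_mul_shift hL (A := derivR R) (B := B) (fun a b => rfl)
    have h2 : shift d L * (homRowDeriv L B)ᵀ = -(D * (shift d L)ᵀ) := by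
      calc _ = shift d L * (homRowDeriv L B)ᵀ * (shift d L * (shift d L)ᵀ) := by rw [hS, mul_one]
        _ = _ := by rw [← mul_assoc, h1, neg_mul]
    rw [neg_zero, hR.rowTransfer_zero hU, hR.rowTransferBar_zero hU, h2, neg_mul, neg_smul,
      two_smul, neg_add]
  -- With $N=2n$ the argument $\beta/(\kappa N)$ is $(\beta/2\kappa)/n$, and the $2$ in the
  -- denominator cancels the $2$ in the derivative.
  have d4 := matrix_tendsto_pow_exp d3
    (by rw [neg_zero, hR.rowTransfer_mul_rowTransferBar_zero hU]) (beta / (2 * kappa))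
  rw [key, smul_smul] at d4
  rw [hR.hamiltonian0_eq hU, smul_smul]
  convert d4 using 2
  · rename_i n
    have : beta / (kappa * (2 * n : ℕ)) = beta / (2 * kappa) / n := by
      rw [div_div]; push_cast; ring_nf
    rw [rho, this]
  · congr 2
    ring

theorem IsFundamental.tens_theta_commute_rho {phi : Matrix (Fin d) (Fin d) ℂ} {n L : ℕ}
    (hU : U ∈ 𝓝 (0 : ℂ))
    (hphi : IsU1Symmetric R U phi) {kappa beta : ℂ} (h1 : -(beta / (kappa * (2 * n : ℕ))) ∈ U)
    (h2 : beta / (kappa * (2 * n : ℕ)) ∈ U) (a : ℂ) :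
    Commute (tens fun _ : Fin L => theta phi a) (rho R kappa n L beta) := by
  have h0 := mem_of_mem_nhds hU
  refine Commute.pow_right (Commute.mul_right ?_ ?_) n
  · rw [rowTransfer_eq_homRow]
    exact tens_commute_homRow (theta_neg_mul phi a) (hphi _ h1 0 h0 a)
  · exact tens_commute_rowTransferBar (theta_neg_mul phi a) (hphi 0 h0 _ h2 a)

theorem commute_of_commute_exp_smul {I : Type*} [Fintype I] [DecidableEq I] {A M : Matrix I I ℂ}
    (h : ∀ a : ℂ, Commute (NormedSpace.exp (a • A)) M) : Commute A M := by
  open scoped Matrix.Norms.Operator in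
  have h1 := hasDerivAt_exp_smul_const A (0 : ℂ)
  open scoped Matrix.Norms.Operator in
  have h2 := (h1.mul_const M).unique ((funext fun a => (h a).eq) ▸ h1.const_mul M)
  rw [Commute, SemiconjBy]
  simpa using h2

/-- Rotations commute with $t_\perp(\lambda)$ for $\lambda$ near $0$, hence with its derivative, and
with the inverse shift $\overline t_\perp(0)$. Differentiating in the rotation angle passes to the
charge. -/
theorem IsFundamental.totalCharge_commute_hamiltonian0 {phi : Matrix (Fin d) (Fin d) ℂ} {L : ℕ}
    [NeZero L] (hU : U ∈ 𝓝 (0 : ℂ)) (hR : IsFundamental R U) (hphi : IsU1Symmetric R U phi)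
    (kappa : ℂ) : Commute (totalCharge L phi) (hamiltonian0 R kappa L) := by
  have h0 := mem_of_mem_nhds hU
  refine commute_of_commute_exp_smul fun a => ?_
  rw [exp_smul_totalCharge, hR.hamiltonian0_eq hU]
  refine Commute.smul_right (Commute.mul_right ?_ ?_) _
  · rw [Commute, SemiconjBy]
    ext s s'
    have e1 := hasDerivAt_matrix_mul (A := fun _ => tens fun _ : Fin L => theta phi a)
      (A' := 0) (fun i j => by simpa using hasDerivAt_const (0 : ℂ) _)
      (hR.hasDerivAt_rowTransfer (L := L) hU) s s'
    have e2 := hasDerivAt_matrix_mul (B := fun _ => tens fun _ : Fin L => theta phi a)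
      (B' := 0) (hR.hasDerivAt_rowTransfer (L := L) hU)
      (fun i j => by simpa using hasDerivAt_const (0 : ℂ) _) s s'
    rw [zero_mul, zero_add] at e1
    rw [mul_zero, add_zero] at e2
    refine e1.unique (e2.congr_of_eventuallyEq ?_)
    filter_upwards [hU] with z hz
    have : Commute (tens fun _ : Fin L => theta phi a) (rowTransfer R L z) := by
      rw [rowTransfer_eq_homRow]
      exact tens_commute_homRow (theta_neg_mul phi a) (hphi _ hz 0 h0 a)
    rw [this.eq]
  · rw [← hR.rowTransferBar_zero hU]
    exact tens_commute_rowTransferBar (theta_neg_mul phi a) (hphi 0 h0 0 h0 a)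

theorem IsFundamental.tendsto_trotterExp {phi : Matrix (Fin d) (Fin d) ℂ} {L : ℕ}
    (hL : 2 ≤ L) (hU : U ∈ 𝓝 (0 : ℂ)) (hR : IsFundamental R U) (hphi : IsU1Symmetric R U phi)
    (kappa : ℂ) (h : ℝ) (beta : ℂ) :
    Filter.Tendsto (fun n => trotterExp R kappa phi h n L beta) Filter.atTop
      (𝓝 (NormedSpace.exp ((-beta) • hamiltonian R kappa phi h L))) := by
  have : NeZero L := ⟨by omega⟩
  have e : (-beta) • hamiltonian R kappa phi h L =
      (beta * h) • totalCharge L phi + (-beta) • hamiltonian0 R kappa L := by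
    rw [hamiltonian, smul_sub, smul_smul, sub_eq_add_neg, add_comm, ← neg_smul]
    congr 2
    ring
  rw [e, Matrix.exp_add_of_commute _ _
    (((hR.totalCharge_commute_hamiltonian0 hU hphi kappa).smul_left _).smul_right _)]
  exact tendsto_const_nhds.mul (hR.tendsto_rho hL hU beta)

theorem IsFundamental.tendsto_trace_trotterExp {phi : Matrix (Fin d) (Fin d) ℂ} {L : ℕ}
    (hL : 2 ≤ L) (hU : U ∈ 𝓝 (0 : ℂ)) (hR : IsFundamental R U) (hphi : IsU1Symmetric R U phi)
    (kappa : ℂ) (h T t : ℝ) :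
    Filter.Tendsto (fun n => (trotterExp R kappa phi h n L (1 / (T : ℂ) - Complex.I * t) *
        trotterExp R kappa phi h n L (Complex.I * t)).trace) Filter.atTop
      (𝓝 (partitionFunction R kappa phi h T L)) := by
  have h1 := (hR.tendsto_trotterExp hL hU hphi kappa h (1 / (T : ℂ) - Complex.I * t)).mul
    (hR.tendsto_trotterExp hL hU hphi kappa h (Complex.I * t))
  have h2 := ((continuous_id (X := Op d L)).matrix_trace.tendsto _).comp h1
  rw [← Matrix.exp_add_of_commute _ _ (((Commute.refl _).smul_left _).smul_right _),
    ← add_smul] at h2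
  have e : -(1 / (T : ℂ) - Complex.I * t) + -(Complex.I * t) = -(1 / (T : ℂ)) := by ring
  rw [e] at h2
  exact h2

theorem IsFundamental.tendsto_trotterTwoPoint {l r : ℕ} {phi : Matrix (Fin d) (Fin d) ℂ} {L : ℕ}
    (hL : 2 ≤ L) (hU : U ∈ 𝓝 (0 : ℂ)) (hR : IsFundamental R U) (hphi : IsU1Symmetric R U phi)
    (kappa : ℂ) (h T t : ℝ) (x : Fin l → Matrix (Fin d) (Fin d) ℂ)
    (y : Fin r → Matrix (Fin d) (Fin d) ℂ) (m : ℕ)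
    (hZ : partitionFunction R kappa phi h T L ≠ 0) :
    Filter.Tendsto (fun n => trotterTwoPoint R kappa phi h T t x y m n L) Filter.atTop
      (𝓝 (twoPoint R kappa phi h T t x y m L)) := by
  refine Filter.Tendsto.div ?_ (hR.tendsto_trace_trotterExp hL hU hphi kappa h T t) hZ
  have h1 := (((hR.tendsto_trotterExp hL hU hphi kappa h (1 / (T : ℂ) - Complex.I * t)).mul
    (tendsto_const_nhds (x := localOp L 0 x))).mul
      (hR.tendsto_trotterExp hL hU hphi kappa h (Complex.I * t))).mul
        (tendsto_const_nhds (x := localOp L m y))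
  rw [neg_sub] at h1
  exact ((continuous_id (X := Op d L)).matrix_trace.tendsto _).comp h1

end Trotter


/-! ### `RTT` relations -/

/-- The relation `r_{1,2} X_1 Y_2 = Y_2 X_1 r_{1,2}` for matrices `X`, `Y` with entries in a
noncommutative algebra. -/
def Intertwines {d : ℕ} {A : Type*} [Ring A] [Algebra ℂ A]
    (r : Matrix (Fin d × Fin d) (Fin d × Fin d) ℂ) (X Y : Matrix (Fin d) (Fin d) A) : Prop :=
  ∀ a b c' e', ∑ c, ∑ e, r (a, b) (c, e) • (X c c' * Y e e') =
    ∑ c, ∑ e, r (c, e) (c', e') • (Y b e * X a c)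

section Algebra

variable {d : ℕ} {A : Type*} [Ring A]

/-- `X_1`. -/
def fstEmb (X : Matrix (Fin d) (Fin d) A) : Matrix (Fin d × Fin d) (Fin d × Fin d) A :=
  Matrix.of fun p q => if p.2 = q.2 then X p.1 q.1 else 0

/-- `Y_2`. -/
def sndEmb (Y : Matrix (Fin d) (Fin d) A) : Matrix (Fin d × Fin d) (Fin d × Fin d) A :=
  Matrix.of fun p q => if p.1 = q.1 then Y p.2 q.2 else 0

theorem fstEmb_mul (X Y : Matrix (Fin d) (Fin d) A) : fstEmb (X * Y) = fstEmb X * fstEmb Y := by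
  ext ⟨a, b⟩ ⟨c, e⟩
  by_cases h : b = e <;>
    simp [fstEmb, Matrix.mul_apply, Fintype.sum_prod_type, h]

theorem sndEmb_mul (X Y : Matrix (Fin d) (Fin d) A) : sndEmb (X * Y) = sndEmb X * sndEmb Y := by
  ext ⟨a, b⟩ ⟨c, e⟩
  by_cases h : a = c <;>
    simp [sndEmb, Matrix.mul_apply, Fintype.sum_prod_type, h]

theorem fstEmb_mul_sndEmb_apply (X Y : Matrix (Fin d) (Fin d) A) (a b c e : Fin d) :
    (fstEmb X * sndEmb Y) (a, b) (c, e) = X a c * Y b e := by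
  simp [fstEmb, sndEmb, Matrix.mul_apply, Fintype.sum_prod_type]

theorem sndEmb_mul_fstEmb_apply (X Y : Matrix (Fin d) (Fin d) A) (a b c e : Fin d) :
    (sndEmb Y * fstEmb X) (a, b) (c, e) = Y b e * X a c := by
  simp [fstEmb, sndEmb, Matrix.mul_apply, Fintype.sum_prod_type]

/-- All entries of `X` commute with all entries of `Y`. -/
def EntriesCommute (X Y : Matrix (Fin d) (Fin d) A) : Prop :=
  ∀ a b c e, Commute (X a b) (Y c e)

theorem EntriesCommute.symm {X Y : Matrix (Fin d) (Fin d) A} (h : EntriesCommute X Y) :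
    EntriesCommute Y X := fun a b c e => (h c e a b).symm

theorem EntriesCommute.mul_left {X X' Y : Matrix (Fin d) (Fin d) A} (h : EntriesCommute X Y)
    (h' : EntriesCommute X' Y) : EntriesCommute (X * X') Y := by
  intro a b c e
  rw [Matrix.mul_apply]
  exact Commute.sum_left _ _ _ fun f _ => (h a f c e).mul_left (h' f b c e)

theorem entriesCommute_one (Y : Matrix (Fin d) (Fin d) A) : EntriesCommute 1 Y := by
  intro a b c e
  rw [Matrix.one_apply]
  split_ifs
  · exact Commute.one_left _
  · exact Commute.zero_left _

theorem EntriesCommute.list_prod_left {Y : Matrix (Fin d) (Fin d) A}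
    {l : List (Matrix (Fin d) (Fin d) A)} (h : ∀ X ∈ l, EntriesCommute X Y) :
    EntriesCommute l.prod Y := by
  induction l with
  | nil => exact entriesCommute_one Y
  | cons X l ih =>
    rw [List.prod_cons]
    exact (h X (by simp)).mul_left (ih fun Z hZ => h Z (by simp [hZ]))

theorem EntriesCommute.trace_mul_comm {X Y : Matrix (Fin d) (Fin d) A}
    (h : EntriesCommute X Y) : (X * Y).trace = (Y * X).trace := by
  simp only [Matrix.trace, Matrix.diag_apply, Matrix.mul_apply]
  rw [Finset.sum_comm]
  exact Finset.sum_congr rfl fun a _ => Finset.sum_congr rfl fun b _ => (h b a a b).eq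

variable [Algebra ℂ A]

theorem intertwines_iff {r : Matrix (Fin d × Fin d) (Fin d × Fin d) ℂ}
    {X Y : Matrix (Fin d) (Fin d) A} :
    Intertwines r X Y ↔ r.map (algebraMap ℂ A) * (fstEmb X * sndEmb Y) =
      sndEmb Y * fstEmb X * r.map (algebraMap ℂ A) := by
  have h1 : ∀ a b c' e', (r.map (algebraMap ℂ A) * (fstEmb X * sndEmb Y)) (a, b) (c', e') =
      ∑ c, ∑ e, r (a, b) (c, e) • (X c c' * Y e e') := by
    intro a b c' e'
    simp only [Matrix.mul_apply (M := r.map _), Fintype.sum_prod_type, Matrix.map_apply,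
      fstEmb_mul_sndEmb_apply, Algebra.smul_def]
  have h2 : ∀ a b c' e', (sndEmb Y * fstEmb X * r.map (algebraMap ℂ A)) (a, b) (c', e') =
      ∑ c, ∑ e, r (c, e) (c', e') • (Y b e * X a c) := by
    intro a b c' e'
    simp only [Matrix.mul_apply (M := sndEmb Y * fstEmb X), Fintype.sum_prod_type,
      Matrix.map_apply, sndEmb_mul_fstEmb_apply, Algebra.smul_def, Algebra.commutes]
  constructor
  · intro h
    ext ⟨a, b⟩ ⟨c, e⟩
    rw [h1, h2, h]
  · intro h a b c e
    rw [← h1, ← h2, h]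

/-- The usual train argument: commuting entries at different sites allow $X_1X'_1Y_2Y'_2$ to be
regrouped as $(X_1Y_2)(X'_1Y'_2)$, and `r` passes through one pair at a time. -/
theorem Intertwines.mul {r : Matrix (Fin d × Fin d) (Fin d × Fin d) ℂ}
    {X X' Y Y' : Matrix (Fin d) (Fin d) A} (h : Intertwines r X Y) (h' : Intertwines r X' Y')
    (h1 : EntriesCommute X' Y) (h2 : EntriesCommute X Y') : Intertwines r (X * X') (Y * Y') := by
  rw [intertwines_iff] at h h' ⊢
  have key : ∀ {X Y : Matrix (Fin d) (Fin d) A}, EntriesCommute X Y →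
      fstEmb X * sndEmb Y = sndEmb Y * fstEmb X := by
    intro X Y h
    ext ⟨a, b⟩ ⟨c, e⟩
    rw [fstEmb_mul_sndEmb_apply, sndEmb_mul_fstEmb_apply, (h a c b e).eq]
  rw [fstEmb_mul, sndEmb_mul]
  calc _ = r.map (algebraMap ℂ A) * (fstEmb X * (fstEmb X' * sndEmb Y) * sndEmb Y') := by
        noncomm_ring
    _ = r.map (algebraMap ℂ A) * (fstEmb X * sndEmb Y) * (fstEmb X' * sndEmb Y') := by
        rw [key h1]; noncomm_ring
    _ = sndEmb Y * fstEmb X * (r.map (algebraMap ℂ A) * (fstEmb X' * sndEmb Y')) := by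
        rw [h]; noncomm_ring
    _ = sndEmb Y * (fstEmb X * sndEmb Y') * fstEmb X' * r.map (algebraMap ℂ A) := by
        rw [h']; noncomm_ring
    _ = _ := by rw [key h2]; noncomm_ring

/-- Allows the relation to be checked on a single vertex, with entries in $\operatorname{End}\mathbb
C^d$, and then transported to any site of the chain. -/
theorem Intertwines.map {B : Type*} [Ring B] [Algebra ℂ B] (f : A →ₐ[ℂ] B)
    {r : Matrix (Fin d × Fin d) (Fin d × Fin d) ℂ} {X Y : Matrix (Fin d) (Fin d) A}
    (h : Intertwines r X Y) : Intertwines r (X.map f) (Y.map f) := by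
  intro a b c' e'
  simpa only [map_sum, map_smul, map_mul, Matrix.map_apply] using congrArg f (h a b c' e')

theorem intertwines_one (r : Matrix (Fin d × Fin d) (Fin d × Fin d) ℂ) :
    Intertwines r (1 : Matrix (Fin d) (Fin d) A) 1 := by
  rw [intertwines_iff]
  have h1 : fstEmb (1 : Matrix (Fin d) (Fin d) A) = 1 := by
    ext ⟨a, b⟩ ⟨c, e⟩
    by_cases h : b = e <;> simp [fstEmb, Matrix.one_apply, h]
  have h2 : sndEmb (1 : Matrix (Fin d) (Fin d) A) = 1 := by
    ext ⟨a, b⟩ ⟨c, e⟩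
    by_cases h : a = c <;> simp [sndEmb, Matrix.one_apply, h]
  rw [h1, h2]
  simp

theorem sum_sum_sum_eq_of_diag {I A : Type*} [Fintype I] [DecidableEq I] [AddCommMonoid A]
    {f : I → I → I → A} {g : I → I → A} (h : ∀ y u v, f u v y = if y = u then g u v else 0) :
    ∑ u, ∑ v, ∑ y, f u v y = ∑ v, ∑ u, g u v := by
  rw [Finset.sum_comm]
  simp [h]

variable {E : Fin d → Fin d → A}

/-- Here `E u v` stands for the matrix units of one site, $\sum Y_{uv}E_{uv}$ for a transfer matrix
whose vertex at that site is a permutation, and `r` for the vertex being moved. After multiplying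
out the matrix units, the coefficient of `E x v` on the two sides is an entry of the relation `h`.
-/
theorem exchange_fst (hE : ∀ u v v' w, E u v * E v' w = if v = v' then E u w else 0)
    {r : Matrix (Fin d × Fin d) (Fin d × Fin d) ℂ} {X Y : Matrix (Fin d) (Fin d) A}
    (h : Intertwines r X Y) (hX : ∀ a b u v, Commute (X a b) (E u v))
    (hY : ∀ a b u v, Commute (Y a b) (E u v)) (a c' : Fin d) :
    (∑ u, ∑ v, Y u v * E u v) * (∑ c, X a c * ∑ u, ∑ v, r (c, u) (c', v) • E u v) =
      (∑ c, (∑ u, ∑ v, r (a, u) (c, v) • E u v) * X c c') * (∑ u, ∑ v, Y u v * E u v) := by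
  have h1 : ∀ c, (∑ u, ∑ v, Y u v * E u v) * (X a c * ∑ u, ∑ v, r (c, u) (c', v) • E u v) =
      ∑ x, ∑ v, (∑ u, r (c, u) (c', v) • (Y x u * X a c)) * E x v := by
    intro c
    rw [Finset.sum_mul]
    refine Finset.sum_congr rfl fun x _ => ?_
    simp only [Finset.sum_mul, Finset.mul_sum]
    have : ∀ y u v, Y x y * E x y * (X a c * r (c, u) (c', v) • E u v) =
        if y = u then r (c, u) (c', v) • (Y x u * X a c) * E x v else 0 := by
      intro y u v
      have : Y x y * E x y * (X a c * r (c, u) (c', v) • E u v) =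
          r (c, u) (c', v) • (Y x y * X a c * (E x y * E u v)) := by
        rw [mul_smul_comm, mul_smul_comm]
        congr 1
        rw [mul_assoc, ← mul_assoc (E x y), ← (hX a c x y).eq, mul_assoc, mul_assoc]
      rw [this, hE]
      split_ifs with hy
      · subst hy; rw [smul_mul_assoc]
      · simp
    exact sum_sum_sum_eq_of_diag this
  have h3 : ∀ c, ((∑ u, ∑ v, r (a, u) (c, v) • E u v) * X c c') * (∑ u, ∑ v, Y u v * E u v) =
      ∑ x, ∑ v, (∑ u, r (a, x) (c, u) • (X c c' * Y u v)) * E x v := by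
    intro c
    rw [Finset.sum_mul, Finset.sum_mul]
    refine Finset.sum_congr rfl fun x _ => ?_
    simp only [Finset.sum_mul, Finset.mul_sum]
    have : ∀ y u v, r (a, x) (c, y) • E x y * X c c' * (Y u v * E u v) =
        if y = u then r (a, x) (c, u) • (X c c' * Y u v) * E x v else 0 := by
      intro y u v
      have : r (a, x) (c, y) • E x y * X c c' * (Y u v * E u v) =
          r (a, x) (c, y) • (X c c' * Y u v * (E x y * E u v)) := by
        rw [smul_mul_assoc, smul_mul_assoc]
        congr 1
        rw [← (hX c c' x y).eq, mul_assoc, ← mul_assoc (E x y), ← (hY u v x y).eq, mul_assoc,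
          mul_assoc]
      rw [this, hE]
      split_ifs with hy
      · subst hy; rw [smul_mul_assoc]
      · simp
    exact sum_sum_sum_eq_of_diag this
  rw [Finset.mul_sum, Finset.sum_mul]
  simp only [h1, h3]
  rw [Finset.sum_comm]
  conv_rhs => rw [Finset.sum_comm]
  refine Finset.sum_congr rfl fun x _ => ?_
  rw [Finset.sum_comm]
  conv_rhs => rw [Finset.sum_comm]
  refine Finset.sum_congr rfl fun v _ => ?_
  rw [← Finset.sum_mul, ← Finset.sum_mul, h a x c' v]

/-- The counterpart for a partially transposed vertex: its site is the first space of `r`, so `X`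
now belongs to the transfer matrix, `Y` to the monodromy matrix, and the vertex moves in the
opposite direction. -/
theorem exchange_snd (hE : ∀ u v v' w, E u v * E v' w = if v = v' then E u w else 0)
    {r : Matrix (Fin d × Fin d) (Fin d × Fin d) ℂ} {X Y : Matrix (Fin d) (Fin d) A}
    (h : Intertwines r X Y) (hX : ∀ a b u v, Commute (X a b) (E u v))
    (hY : ∀ a b u v, Commute (Y a b) (E u v)) (a c' : Fin d) :
    (∑ y, ∑ x, X x y * E y x) * (∑ c, (∑ u, ∑ v, r (v, a) (u, c) • E u v) * Y c c') =
      (∑ c, Y a c * ∑ u, ∑ v, r (v, c) (u, c') • E u v) * (∑ y, ∑ x, X x y * E y x) := by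
  have h1 : ∀ c, (∑ y, ∑ x, X x y * E y x) *
        ((∑ u, ∑ v, r (v, a) (u, c) • E u v) * Y c c') =
      ∑ y, ∑ v, (∑ x, r (v, a) (x, c) • (X x y * Y c c')) * E y v := by
    intro c
    rw [Finset.sum_mul]
    refine Finset.sum_congr rfl fun y _ => ?_
    simp only [Finset.sum_mul, Finset.mul_sum]
    have : ∀ x u v, X x y * E y x * (r (v, a) (u, c) • E u v * Y c c') =
        if x = u then r (v, a) (u, c) • (X u y * Y c c') * E y v else 0 := by
      intro x u v
      have : X x y * E y x * (r (v, a) (u, c) • E u v * Y c c') =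
          r (v, a) (u, c) • (X x y * Y c c' * (E y x * E u v)) := by
        rw [smul_mul_assoc, mul_smul_comm]
        congr 1
        rw [← (hY c c' u v).eq, mul_assoc, ← mul_assoc (E y x), ← (hY c c' y x).eq, mul_assoc,
          mul_assoc]
      rw [this, hE]
      split_ifs with hx
      · subst hx; rw [smul_mul_assoc]
      · simp
    exact sum_sum_sum_eq_of_diag this
  have h3 : ∀ c, (Y a c * ∑ u, ∑ v, r (v, c) (u, c') • E u v) * (∑ y, ∑ x, X x y * E y x) =
      ∑ y, ∑ v, (∑ x, r (x, c) (y, c') • (Y a c * X v x)) * E y v := by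
    intro c
    rw [mul_assoc, Finset.sum_mul, Finset.mul_sum]
    refine Finset.sum_congr rfl fun y _ => ?_
    simp only [Finset.sum_mul, Finset.mul_sum]
    have : ∀ x u v, Y a c * (r (x, c) (y, c') • E y x * (X v u * E u v)) =
        if x = u then r (u, c) (y, c') • (Y a c * X v u) * E y v else 0 := by
      intro x u v
      have : Y a c * (r (x, c) (y, c') • E y x * (X v u * E u v)) =
          r (x, c) (y, c') • (Y a c * X v u * (E y x * E u v)) := by
        rw [smul_mul_assoc, mul_smul_comm]
        congr 1
        rw [← mul_assoc (E y x), ← (hX v u y x).eq, mul_assoc, mul_assoc]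
      rw [this, hE]
      split_ifs with hx
      · subst hx; rw [smul_mul_assoc]
      · simp
    exact sum_sum_sum_eq_of_diag this
  rw [Finset.mul_sum, Finset.sum_mul]
  simp only [h1, h3]
  rw [Finset.sum_comm]
  conv_rhs => rw [Finset.sum_comm]
  refine Finset.sum_congr rfl fun y _ => ?_
  rw [Finset.sum_comm]
  conv_rhs => rw [Finset.sum_comm]
  refine Finset.sum_congr rfl fun v _ => ?_
  rw [← Finset.sum_mul, ← Finset.sum_mul, Finset.sum_comm, h v a y c', Finset.sum_comm]

end Algebra


/-! ### Local vertices of the quantum transfer matrix -/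

section Vertices

variable {d : ℕ} {R : ℂ → ℂ → Matrix (Fin d × Fin d) (Fin d × Fin d) ℂ} {U : Set ℂ}

theorem sum_fin_three {I A : Type*} [Fintype I] [AddCommMonoid A] (F : (Fin 3 → I) → A) :
    ∑ q, F q = ∑ c, ∑ e, ∑ g, F ![c, e, g] := by
  rw [← (Fin.consEquiv fun _ : Fin 3 => I).sum_comp, Fintype.sum_prod_type]
  refine Finset.sum_congr rfl fun c _ => ?_
  rw [← (Fin.consEquiv fun _ : Fin 2 => I).sum_comp, Fintype.sum_prod_type]
  refine Finset.sum_congr rfl fun e _ => ?_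
  rw [← (Fin.consEquiv fun _ : Fin 1 => I).sum_comp, Fintype.sum_prod_type]
  refine Finset.sum_congr rfl fun e _ => ?_
  rw [Fintype.sum_unique]
  congr 1

theorem sum_rotate {I A : Type*} [Fintype I] [AddCommMonoid A] (F : I → I → I → A) :
    ∑ e, ∑ g, ∑ c, F e g c = ∑ c, ∑ e, ∑ g, F e g c := by
  conv_rhs => rw [Finset.sum_comm]
  exact Finset.sum_congr rfl fun e _ => Finset.sum_comm

theorem twoSite_zero_one_apply (A : Matrix (Fin d × Fin d) (Fin d × Fin d) ℂ)
    (a b c a' b' c' : Fin d) : (twoSite 0 1 A : Op d 3) ![a, b, c] ![a', b', c'] =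
      if c = c' then A (a, b) (a', b') else 0 := by
  simp only [twoSite, Fin.forall_fin_succ, Matrix.of_apply]
  simp

theorem twoSite_zero_two_apply (A : Matrix (Fin d × Fin d) (Fin d × Fin d) ℂ)
    (a b c a' b' c' : Fin d) : (twoSite 0 2 A : Op d 3) ![a, b, c] ![a', b', c'] =
      if b = b' then A (a, c) (a', c') else 0 := by
  simp only [twoSite, Fin.forall_fin_succ, Matrix.of_apply]
  simp

theorem twoSite_one_two_apply (A : Matrix (Fin d × Fin d) (Fin d × Fin d) ℂ)
    (a b c a' b' c' : Fin d) : (twoSite 1 2 A : Op d 3) ![a, b, c] ![a', b', c'] =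
      if a = a' then A (b, c) (b', c') else 0 := by
  simp only [twoSite, Fin.forall_fin_succ, Matrix.of_apply]
  simp

theorem yangBaxter_apply {A B C : Matrix (Fin d × Fin d) (Fin d × Fin d) ℂ}
    (h : (twoSite 0 1 A : Op d 3) * twoSite 0 2 B * twoSite 1 2 C =
      twoSite 1 2 C * twoSite 0 2 B * twoSite 0 1 A) (a b u a' b' u' : Fin d) :
    ∑ c, ∑ e, ∑ g, A (a, b) (c, e) * (B (c, u) (a', g) * C (e, g) (b', u')) =
      ∑ e, ∑ g, ∑ c, C (b, u) (e, g) * (B (a, g) (c, u') * A (c, e) (a', b')) := by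
  have h1 := congrFun (congrFun h ![a, b, u]) ![a', b', u']
  rw [mul_assoc, mul_assoc] at h1
  simpa only [Matrix.mul_apply, sum_fin_three, twoSite_zero_one_apply, twoSite_zero_two_apply,
    twoSite_one_two_apply, ite_mul, zero_mul, mul_ite, mul_zero, Finset.sum_ite_eq,
    Finset.sum_ite_eq', Finset.mem_univ, if_true, Finset.sum_const_zero, Finset.mul_sum,
    Finset.sum_ite_irrel] using h1

/-- The weights of a vertex of the quantum transfer matrix: `stagR R j σ λ ν` is
`auxSite j (stagVertex R σ λ ν)`. -/
def stagVertex (R : ℂ → ℂ → Matrix (Fin d × Fin d) (Fin d × Fin d) ℂ) (sg : ℤˣ) (lam nu : ℂ) :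
    Matrix (Fin d × Fin d) (Fin d × Fin d) ℂ :=
  if sg = 1 then R lam nu else flip (transposeFst (R nu lam))

theorem stagR_eq {M : ℕ} (R : ℂ → ℂ → Matrix (Fin d × Fin d) (Fin d × Fin d) ℂ) (j : Fin M)
    (sg : ℤˣ) (lam nu : ℂ) : stagR R j sg lam nu = auxSite j (stagVertex R sg lam nu) := by
  rw [stagR, stagVertex]
  split_ifs <;> rfl

/-- The vertex weights as a matrix in the auxiliary space. -/
def vertexMatrix (A : Matrix (Fin d × Fin d) (Fin d × Fin d) ℂ) :
    Matrix (Fin d) (Fin d) (Matrix (Fin d) (Fin d) ℂ) :=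
  Matrix.of fun a b => Matrix.of fun u v => A (a, u) (b, v)

theorem auxSite_eq_map {M : ℕ} (j : Fin M) (A : Matrix (Fin d × Fin d) (Fin d × Fin d) ℂ) :
    auxSite j A = (vertexMatrix A).map (siteHom j) := rfl

/-- For `sg = 1` this is the Yang-Baxter equation with the site as third space. For `sg = -1` the
site is the first space of the equation for $(\nu,\lambda,\mu)$; transposing there reverses the
order of the products on the site and exchanges the two sides. -/
theorem IsFundamental.intertwines_stagVertex (hR : IsFundamental R U) {lam mu nu : ℂ}
    (hl : lam ∈ U) (hm : mu ∈ U) (hn : nu ∈ U) (sg : ℤˣ) :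
    Intertwines (R lam mu) (vertexMatrix (stagVertex R sg lam nu))
      (vertexMatrix (stagVertex R sg mu nu)) := by
  intro a b c' e'
  ext u v
  by_cases h : sg = 1
  · have := yangBaxter_apply (hR.yangBaxter lam hl mu hm nu hn) a b u c' e' v
    simp only [stagVertex, if_pos h, vertexMatrix, Matrix.sum_apply, Matrix.smul_apply,
      Matrix.mul_apply, Matrix.of_apply, smul_eq_mul, Finset.mul_sum]
    refine this.trans ((sum_rotate _).trans ?_)
    exact Finset.sum_congr rfl fun c _ => Finset.sum_congr rfl fun e _ =>
      Finset.sum_congr rfl fun g _ => by ring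
  · have := yangBaxter_apply (hR.yangBaxter nu hn lam hl mu hm) v a b u c' e'
    simp only [stagVertex, if_neg h, vertexMatrix, Matrix.sum_apply, Matrix.smul_apply,
      Matrix.mul_apply, Matrix.of_apply, smul_eq_mul, Finset.mul_sum, flip, transposeFst,
      Prod.swap_prod_mk]
    refine Eq.trans ?_ (this.symm.trans ((sum_rotate _).symm.trans ?_)) <;>
      exact Finset.sum_congr rfl fun c _ => Finset.sum_congr rfl fun e _ =>
        Finset.sum_congr rfl fun g _ => by ring

theorem entriesCommute_auxSite {M : ℕ} {j k : Fin M} (h : j ≠ k)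
    (A B : Matrix (Fin d × Fin d) (Fin d × Fin d) ℂ) :
    EntriesCommute (auxSite j A) (auxSite k B) :=
  fun _ _ _ _ => site_commute h _ _

theorem entriesCommute_aux {M : ℕ} (g : Matrix (Fin d) (Fin d) ℂ) (X : AuxOp d M) :
    EntriesCommute (aux M g) X := by
  intro a b c e
  rw [aux, Matrix.of_apply]
  exact (Commute.one_left _).smul_left _

theorem IsFundamental.intertwines_stagR {M : ℕ} (hR : IsFundamental R U) {lam mu nu : ℂ}
    (hl : lam ∈ U) (hm : mu ∈ U) (hn : nu ∈ U) (j : Fin M) (sg : ℤˣ) :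
    Intertwines (R lam mu) (stagR R j sg lam nu) (stagR R j sg mu nu) := by
  rw [stagR_eq, stagR_eq, auxSite_eq_map, auxSite_eq_map]
  exact (hR.intertwines_stagVertex hl hm hn sg).map (siteHom j)

theorem intertwines_aux {M : ℕ} {r : Matrix (Fin d × Fin d) (Fin d × Fin d) ℂ}
    {g : Matrix (Fin d) (Fin d) ℂ} (h : r * (g ⊗ₖ g) = (g ⊗ₖ g) * r) :
    Intertwines r (aux M g) (aux M g) := by
  have h1 : Intertwines r g g := by
    intro a b c' e'
    have := congrFun (congrFun h (a, b)) (c', e')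
    simp only [Matrix.mul_apply, Fintype.sum_prod_type, Matrix.kroneckerMap_apply] at this
    simp only [smul_eq_mul]
    refine this.trans ?_
    exact Finset.sum_congr rfl fun c _ => Finset.sum_congr rfl fun e _ => by ring
  have h2 : aux M g = g.map (Algebra.ofId ℂ (Op d M)) := by
    ext a b : 2
    simp [aux, Algebra.ofId_apply, Algebra.algebraMap_eq_smul_one]
  rw [h2]
  exact h1.map _

end Vertices

/-! ### Rotated monodromy matrices -/

section Rotation

variable {d M : ℕ} {R : ℂ → ℂ → Matrix (Fin d × Fin d) (Fin d × Fin d) ℂ} {U : Set ℂ}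

/-- The product of the vertices at the sites in the list `l`. -/
def word (R : ℂ → ℂ → Matrix (Fin d × Fin d) (Fin d × Fin d) ℂ) (sg : Fin M → ℤˣ)
    (nu : Fin M → ℂ) (lam : ℂ) (l : List (Fin M)) : AuxOp d M :=
  (l.map fun j => stagR R j (sg j) lam (nu j)).prod

/-- A monodromy matrix in which the twist `g` stands between the sites in `l` and those in `l'`. -/
def twistedWord (R : ℂ → ℂ → Matrix (Fin d × Fin d) (Fin d × Fin d) ℂ)
    (g : Matrix (Fin d) (Fin d) ℂ) (sg : Fin M → ℤˣ) (nu : Fin M → ℂ) (lam : ℂ)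
    (l l' : List (Fin M)) : AuxOp d M :=
  word R sg nu lam l * aux M g * word R sg nu lam l'

variable {sg : Fin M → ℤˣ} {nu : Fin M → ℂ} {g : Matrix (Fin d) (Fin d) ℂ}

theorem word_cons (lam : ℂ) (k : Fin M) (l : List (Fin M)) :
    word R sg nu lam (k :: l) = stagR R k (sg k) lam (nu k) * word R sg nu lam l := by
  simp [word]

theorem word_append (lam : ℂ) (l l' : List (Fin M)) :
    word R sg nu lam (l ++ l') = word R sg nu lam l * word R sg nu lam l' := by
  simp [word]

theorem entriesCommute_word {k : Fin M} {l : List (Fin M)} (hk : k ∉ l) (lam : ℂ)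
    (B : Matrix (Fin d × Fin d) (Fin d × Fin d) ℂ) :
    EntriesCommute (word R sg nu lam l) (auxSite k B) := by
  refine EntriesCommute.list_prod_left fun X hX => ?_
  obtain ⟨j, hj, rfl⟩ := List.mem_map.1 hX
  rw [stagR_eq]
  exact entriesCommute_auxSite (by rintro rfl; exact hk hj) _ _

theorem entriesCommute_word_word {l l' : List (Fin M)} (h : List.Disjoint l l') (lam mu : ℂ) :
    EntriesCommute (word R sg nu lam l) (word R sg nu mu l') := by
  refine EntriesCommute.symm (EntriesCommute.list_prod_left fun X hX => ?_)
  obtain ⟨j, hj, rfl⟩ := List.mem_map.1 hX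
  rw [stagR_eq]
  exact (entriesCommute_word (fun hj' => h hj' hj) _ _).symm

theorem entriesCommute_twistedWord {k : Fin M} {l l' : List (Fin M)} (hk : k ∉ l) (hk' : k ∉ l')
    (lam : ℂ) (B : Matrix (Fin d × Fin d) (Fin d × Fin d) ℂ) :
    EntriesCommute (twistedWord R g sg nu lam l l') (auxSite k B) :=
  ((entriesCommute_word hk lam B).mul_left (entriesCommute_aux g _)).mul_left
    (entriesCommute_word hk' lam B)

theorem IsFundamental.intertwines_word (hR : IsFundamental R U) (hnu : ∀ j, nu j ∈ U) {lam mu : ℂ}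
    (hl : lam ∈ U) (hm : mu ∈ U) {l : List (Fin M)} (hnd : l.Nodup) :
    Intertwines (R lam mu) (word R sg nu lam l) (word R sg nu mu l) := by
  induction l with
  | nil => exact intertwines_one _
  | cons k l ih =>
    rw [List.nodup_cons] at hnd
    rw [word_cons, word_cons]
    refine (hR.intertwines_stagR hl hm (hnu k) k (sg k)).mul (ih hnd.2) ?_ ?_
    · rw [stagR_eq]; exact entriesCommute_word hnd.1 _ _
    · rw [stagR_eq]; exact (entriesCommute_word hnd.1 _ _).symm

theorem IsFundamental.intertwines_twistedWord (hR : IsFundamental R U) (hnu : ∀ j, nu j ∈ U)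
    {lam mu : ℂ} (hl : lam ∈ U) (hm : mu ∈ U)
    (hg : R lam mu * (g ⊗ₖ g) = (g ⊗ₖ g) * R lam mu) {l l' : List (Fin M)}
    (hnd : (l ++ l').Nodup) :
    Intertwines (R lam mu) (twistedWord R g sg nu lam l l') (twistedWord R g sg nu mu l l') := by
  rw [List.nodup_append'] at hnd
  refine ((hR.intertwines_word hnu hl hm hnd.1).mul (intertwines_aux hg)
    (entriesCommute_aux _ _) (entriesCommute_aux _ _).symm).mul
    (hR.intertwines_word hnu hl hm hnd.2.1) ?_ ?_
  · exact ((entriesCommute_word_word hnd.2.2 _ _).mul_left (entriesCommute_aux _ _)).symm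
  · exact (entriesCommute_word_word hnd.2.2 _ _).mul_left (entriesCommute_aux _ _)

theorem twistedWord_append_singleton (lam : ℂ) (k : Fin M) (l l' : List (Fin M)) :
    twistedWord R g sg nu lam l (l' ++ [k]) =
      twistedWord R g sg nu lam l l' * auxSite k (stagVertex R (sg k) lam (nu k)) := by
  rw [twistedWord, word_append, twistedWord, ← mul_assoc, ← stagR_eq]
  simp [word]

theorem twistedWord_cons (lam : ℂ) (k : Fin M) (l l' : List (Fin M)) :
    twistedWord R g sg nu lam (k :: l) l' =
      auxSite k (stagVertex R (sg k) lam (nu k)) * twistedWord R g sg nu lam l l' := by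
  rw [twistedWord, word_cons, twistedWord, stagR_eq, mul_assoc, mul_assoc, mul_assoc]

/-- The trace is not cyclic for operator-valued entries in general, but entries belonging to
disjoint sets of sites commute. -/
theorem trace_twistedWord_cons {k : Fin M} {l l' : List (Fin M)} (hk : k ∉ l) (hk' : k ∉ l')
    (lam : ℂ) : (twistedWord R g sg nu lam (k :: l) l').trace =
      (twistedWord R g sg nu lam l (l' ++ [k])).trace := by
  rw [twistedWord_append_singleton, twistedWord_cons]
  exact ((entriesCommute_twistedWord hk hk' lam _).trace_mul_comm).symm

theorem site_single_mul (k : Fin M) (u v v' w : Fin d) :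
    site k (Matrix.single u v (1 : ℂ)) * site k (Matrix.single v' w 1) =
      if v = v' then site k (Matrix.single u w 1) else 0 := by
  rw [← site_mul]
  split_ifs with h
  · subst h; simp
  · rw [Matrix.single_mul_single_of_ne (h := h)]
    exact map_zero (siteHom k)

theorem auxSite_apply_eq_sum (k : Fin M) (A : Matrix (Fin d × Fin d) (Fin d × Fin d) ℂ)
    (a b : Fin d) :
    auxSite k A a b = ∑ u, ∑ v, A (a, u) (b, v) • site k (Matrix.single u v (1 : ℂ)) := by
  have : auxSite k A a b = siteHom k (Matrix.of fun u v => A (a, u) (b, v)) := rfl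
  rw [this, Matrix.matrix_eq_sum_single (Matrix.of fun u v => A (a, u) (b, v))]
  simp only [map_sum, Matrix.of_apply]
  refine Finset.sum_congr rfl fun u _ => Finset.sum_congr rfl fun v _ => ?_
  rw [← siteHom_apply, ← map_smul, Matrix.smul_single, smul_eq_mul, mul_one]

theorem auxSite_perm_apply (k : Fin M) (a b : Fin d) :
    auxSite k (perm d) a b = site k (Matrix.single b a (1 : ℂ)) := by
  change site k _ = _
  congr 1
  ext u v
  simp [perm, Matrix.single_apply, and_comm, eq_comm]

theorem auxSite_flip_transposeFst_perm_apply (k : Fin M) (a b : Fin d) :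
    auxSite k (flip (transposeFst (perm d))) a b = site k (Matrix.single a b (1 : ℂ)) := by
  change site k _ = _
  congr 1
  ext u v
  simp [perm, flip, transposeFst, Matrix.single_apply, and_comm, eq_comm]

/-- At $\lambda=\nu_k$ regularity turns the vertex at `k` into the permutation, whose entries are
matrix units. `exchange_fst` then moves the site from the right end to the left end. -/
theorem IsFundamental.trace_mul_twistedWord (hR : IsFundamental R U) (hnu : ∀ j, nu j ∈ U)
    {lam : ℂ} (hl : lam ∈ U) {k : Fin M} (hk : sg k = 1)
    (hg : ∀ lam ∈ U, ∀ mu ∈ U, R lam mu * (g ⊗ₖ g) = (g ⊗ₖ g) * R lam mu)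
    {l l' : List (Fin M)} (hnd : (k :: (l ++ l')).Nodup) (a b : Fin d) :
    (twistedWord R g sg nu (nu k) l (l' ++ [k])).trace *
        twistedWord R g sg nu lam l (l' ++ [k]) a b =
      twistedWord R g sg nu lam (k :: l) l' a b *
        (twistedWord R g sg nu (nu k) l (l' ++ [k])).trace := by
  rw [List.nodup_cons, List.mem_append, not_or] at hnd
  obtain ⟨⟨hk1, hk2⟩, hnd⟩ := hnd
  have hc : ∀ mu a b u v, Commute (twistedWord R g sg nu mu l l' a b)
      (site k (Matrix.single u v (1 : ℂ))) := by
    intro mu a b u v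
    have := entriesCommute_twistedWord (R := R) (g := g) (sg := sg) (nu := nu) hk1 hk2 mu (perm d)
      a b v u
    rwa [auxSite_perm_apply] at this
  have ht : (twistedWord R g sg nu (nu k) l (l' ++ [k])).trace =
      ∑ u, ∑ v, twistedWord R g sg nu (nu k) l l' u v * site k (Matrix.single u v (1 : ℂ)) := by
    rw [twistedWord_append_singleton, stagVertex, if_pos hk, hR.regular _ (hnu k)]
    simp only [Matrix.trace, Matrix.diag_apply, Matrix.mul_apply, auxSite_perm_apply]
  rw [ht, twistedWord_append_singleton, twistedWord_cons, stagVertex, if_pos hk, Matrix.mul_apply,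
    Matrix.mul_apply]
  simp only [auxSite_apply_eq_sum]
  exact exchange_fst (site_single_mul k)
    (hR.intertwines_twistedWord hnu hl (hnu k) (hg _ hl _ (hnu k)) hnd) (hc lam) (hc (nu k)) a b

/-- The vertex at $\lambda=\nu_k$ is now the partial transpose of the permutation, which transposes
the indices of the matrix units and leads to `exchange_snd`. -/
theorem IsFundamental.trace_mul_twistedWord_cons (hR : IsFundamental R U) (hnu : ∀ j, nu j ∈ U)
    {lam : ℂ} (hl : lam ∈ U) {k : Fin M} (hk : sg k ≠ 1)
    (hg : ∀ lam ∈ U, ∀ mu ∈ U, R lam mu * (g ⊗ₖ g) = (g ⊗ₖ g) * R lam mu)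
    {l l' : List (Fin M)} (hnd : (k :: (l ++ l')).Nodup) (a b : Fin d) :
    (twistedWord R g sg nu (nu k) l (l' ++ [k])).trace *
        twistedWord R g sg nu lam (k :: l) l' a b =
      twistedWord R g sg nu lam l (l' ++ [k]) a b *
        (twistedWord R g sg nu (nu k) l (l' ++ [k])).trace := by
  rw [List.nodup_cons, List.mem_append, not_or] at hnd
  obtain ⟨⟨hk1, hk2⟩, hnd⟩ := hnd
  have hc : ∀ mu a b u v, Commute (twistedWord R g sg nu mu l l' a b)
      (site k (Matrix.single u v (1 : ℂ))) := by
    intro mu a b u v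
    have := entriesCommute_twistedWord (R := R) (g := g) (sg := sg) (nu := nu) hk1 hk2 mu (perm d)
      a b v u
    rwa [auxSite_perm_apply] at this
  have ht : (twistedWord R g sg nu (nu k) l (l' ++ [k])).trace =
      ∑ y, ∑ x, twistedWord R g sg nu (nu k) l l' x y * site k (Matrix.single y x (1 : ℂ)) := by
    rw [twistedWord_append_singleton, stagVertex, if_neg hk, hR.regular _ (hnu k), Finset.sum_comm]
    simp only [Matrix.trace, Matrix.diag_apply, Matrix.mul_apply,
      auxSite_flip_transposeFst_perm_apply]
  rw [ht, twistedWord_append_singleton, twistedWord_cons, stagVertex, if_neg hk, Matrix.mul_apply,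
    Matrix.mul_apply]
  simp only [auxSite_apply_eq_sum, flip, transposeFst, Matrix.of_apply, Prod.swap_prod_mk]
  exact exchange_snd (site_single_mul k)
    (hR.intertwines_twistedWord hnu (hnu k) hl (hg _ (hnu k) _ hl) hnd) (hc (nu k)) (hc lam) a b

end Rotation


/-! ### The lattice partition function in terms of columns -/

/-- The sites before `k`, in descending order. -/
def lowSites (M k : ℕ) : List (Fin M) := ((List.finRange M).take k).reverse

/-- The sites from `k` on, in descending order. -/
def upSites (M k : ℕ) : List (Fin M) := ((List.finRange M).drop k).reverse

theorem lowSites_succ {M k : ℕ} (h : k < M) : lowSites M (k + 1) = ⟨k, h⟩ :: lowSites M k := by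
  rw [lowSites, lowSites, List.take_succ_eq_append_getElem (by simpa using h)]
  simp

theorem upSites_eq {M k : ℕ} (h : k < M) : upSites M k = upSites M (k + 1) ++ [⟨k, h⟩] := by
  rw [upSites, upSites, List.drop_eq_getElem_cons (by simpa using h)]
  simp

theorem upSites_append_lowSites (M k : ℕ) :
    upSites M k ++ lowSites M k = (List.finRange M).reverse := by
  rw [upSites, lowSites, ← List.reverse_append, List.take_append_drop]

theorem lowSites_zero (M : ℕ) : lowSites M 0 = [] := by simp [lowSites]

theorem upSites_zero (M : ℕ) : upSites M 0 = (List.finRange M).reverse := by simp [upSites]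

theorem upSites_self (M : ℕ) : upSites M M = [] := by
  simp [upSites, List.drop_eq_nil_of_le]

theorem nodup_upSites_append_lowSites (M k : ℕ) : (upSites M k ++ lowSites M k).Nodup := by
  rw [upSites_append_lowSites]
  exact List.nodup_reverse.2 (List.nodup_finRange M)

theorem mem_lowSites {M k : ℕ} {i : Fin M} (h : i ∈ lowSites M k) : (i : ℕ) < k := by
  rw [lowSites, List.mem_reverse, List.mem_iff_getElem] at h
  obtain ⟨j, hj, rfl⟩ := h
  rw [List.length_take] at hj
  simp only [List.getElem_take, List.getElem_finRange, Fin.val_cast]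
  omega

theorem nodup_rotation {M k : ℕ} (h : k < M) :
    ((⟨k, h⟩ : Fin M) :: (lowSites M k ++ upSites M (k + 1))).Nodup := by
  have := nodup_upSites_append_lowSites M (k + 1)
  rw [lowSites_succ h, List.nodup_append_comm] at this
  simpa using this

/-- Insertion of extra factors at two sites of a descending product. -/
theorem prod_reverse_finRange_insert {A : Type*} [Monoid A] {M k : ℕ} (hk : 0 < k) (hkM : k < M)
    (D W : Fin M → A) {x y : A} (hx : ∀ i : Fin M, (i : ℕ) + 1 = k → D i = x)
    (hy : ∀ i : Fin M, (i : ℕ) + 1 = M → D i = y)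
    (h1 : ∀ i : Fin M, (i : ℕ) + 1 ≠ k → (i : ℕ) + 1 ≠ M → D i = 1) :
    ((List.finRange M).reverse.map fun i => D i * W i).prod =
      y * ((upSites M k).map W).prod * x * ((lowSites M k).map W).prod := by
  have hlow : ((lowSites M k).map fun i => D i * W i).prod = x * ((lowSites M k).map W).prod := by
    obtain ⟨k, rfl⟩ := Nat.exists_eq_succ_of_ne_zero hk.ne'
    have hk' : k < M := by omega
    have : (lowSites M k).map (fun i => D i * W i) = (lowSites M k).map W := by
      refine List.map_congr_left fun i hi => ?_
      have := mem_lowSites hi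
      rw [h1 i (by omega) (by omega), one_mul]
    rw [lowSites_succ hk', List.map_cons, List.map_cons, List.prod_cons, List.prod_cons, this,
      hx _ rfl, mul_assoc]
  have hup : ∀ p, 0 < p → p + k ≤ M → ((upSites M (M - p)).map fun i => D i * W i).prod =
      y * ((upSites M (M - p)).map W).prod := by
    intro p hp
    induction p, hp using Nat.le_induction with
    | base =>
      intro h
      have hM : M - 1 < M := by omega
      have hM' : M - 1 + 1 = M := by omega
      rw [upSites_eq hM, hM', upSites_self]
      simp [hy ⟨M - 1, hM⟩ hM']
    | succ p hp ih =>
      intro h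
      have hM : M - (p + 1) < M := by omega
      have hM' : M - (p + 1) + 1 = M - p := by omega
      rw [upSites_eq hM, hM', List.map_append, List.map_append, List.prod_append, List.prod_append,
        ih (by omega), mul_assoc]
      have hD : D ⟨M - (p + 1), hM⟩ = 1 := h1 _ (by simp; omega) (by simp; omega)
      simp [hD]
  have := hup (M - k) (by omega) (by omega)
  rw [show M - (M - k) = k by omega] at this
  rw [← upSites_append_lowSites M k, List.map_append, List.prod_append, hlow, this]
  simp only [mul_assoc]

theorem prod_lowSites_pairs {A : Type*} [Monoid A] {M : ℕ} {W : Fin M → A} {a b : A} (p : ℕ)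
    (hp : 2 * p ≤ M) (h0 : ∀ i : Fin M, (i : ℕ) < 2 * p → Even (i : ℕ) → W i = b)
    (h1 : ∀ i : Fin M, (i : ℕ) < 2 * p → ¬ Even (i : ℕ) → W i = a) :
    ((lowSites M (2 * p)).map W).prod = (a * b) ^ p := by
  induction p with
  | zero => simp [lowSites_zero]
  | succ p ih =>
    rw [show 2 * (p + 1) = 2 * p + 1 + 1 by ring, lowSites_succ (by omega),
      lowSites_succ (by omega), List.map_cons, List.map_cons, List.prod_cons, List.prod_cons,
      ih (by omega) (fun i hi => h0 i (by omega)) (fun i hi => h1 i (by omega)),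
      h0 ⟨2 * p, _⟩ (by simp) (by simp), h1 ⟨2 * p + 1, _⟩ (by simp; omega) (by simp), pow_succ',
      mul_assoc]

theorem prod_upSites_pairs {A : Type*} [Monoid A] {M q : ℕ} (hM : M = 2 * q) {W : Fin M → A}
    {a b : A} (p : ℕ) (hp : p ≤ q)
    (h0 : ∀ i : Fin M, 2 * (q - p) ≤ (i : ℕ) → Even (i : ℕ) → W i = b)
    (h1 : ∀ i : Fin M, 2 * (q - p) ≤ (i : ℕ) → ¬ Even (i : ℕ) → W i = a) :
    ((upSites M (2 * (q - p))).map W).prod = (a * b) ^ p := by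
  induction p with
  | zero => simp [← hM, upSites_self]
  | succ p ih =>
    have e : 2 * (q - (p + 1)) + 1 + 1 = 2 * (q - p) := by omega
    have l1 : 2 * (q - (p + 1)) + 1 < M := by omega
    have l2 : 2 * (q - (p + 1)) < M := by omega
    rw [upSites_eq l2, upSites_eq l1, e, List.map_append, List.map_append, List.prod_append,
      List.prod_append, ih (by omega) (fun i hi => h0 i (by omega)) (fun i hi => h1 i (by omega))]
    simp [h0 ⟨_, l2⟩ le_rfl (by simp), h1 ⟨_, l1⟩ (by simp) (by simp), pow_succ, mul_assoc]

section Columns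

variable {d : ℕ} (R : ℂ → ℂ → Matrix (Fin d × Fin d) (Fin d × Fin d) ℂ) (kappa : ℂ)
  (phi : Matrix (Fin d) (Fin d) ℂ) (h T t : ℝ) (n : ℕ)

/-- The vertices of the quantum transfer matrix between two configurations. -/
def qtmVertex (p p' : Fin (qtmLength n) → Fin d) (i : Fin (qtmLength n)) :
    Matrix (Fin d) (Fin d) ℂ :=
  vertex (stagVertex R (qtmSign n i) 0 (qtmInhom kappa T t n i)) (p i) (p' i)

/-- The column transfer matrix with `y` inserted at the top and `x` in the middle of the column. -/
def column (x y : Matrix (Fin d) (Fin d) ℂ) : Op d (qtmLength n) :=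
  Matrix.of fun p p' => (y * theta phi ((h : ℂ) / T) *
    ((upSites (qtmLength n) (2 * n)).map (qtmVertex R kappa T t n p p')).prod * x *
    ((lowSites (qtmLength n) (2 * n)).map (qtmVertex R kappa T t n p p')).prod).trace

theorem qtmSign_eq_one_iff {n : ℕ} (i : Fin (qtmLength n)) : qtmSign n i = 1 ↔ Even (i : ℕ) := by
  rw [qtmSign]
  rcases Nat.even_or_odd (i : ℕ) with h | h
  · simp [h]
  · simp [h.neg_one_pow, Nat.not_even_iff_odd.2 h]

/-- The vertices of a row of the lattice. -/
def rowVertex (i : Fin (qtmLength n)) (u v : Fin d) : Matrix (Fin d) (Fin d) ℂ :=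
  if Even (i : ℕ) then vertex (flip (R 0 (qtmInhom kappa T t n i))) u v
  else (vertex (R (qtmInhom kappa T t n i) 0) u v)ᵀ

/-- Each weight may be read along its row or along its column. Rows of $\overline t_\perp$ and
$t_\perp$ thereby become vertices with $\sigma=1$ and $\sigma=-1$, which explains the staggering. -/
theorem rowVertex_apply (p p' : Fin (qtmLength n) → Fin d) (i : Fin (qtmLength n)) (c c' : Fin d) :
    rowVertex R kappa T t n i c c' (p i) (p' i) = qtmVertex R kappa T t n p p' i c c' := by
  rw [rowVertex, qtmVertex, stagVertex]
  simp only [qtmSign_eq_one_iff]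
  split_ifs <;> rfl

variable {n}

theorem rowOp_rowVertex_even {L : ℕ} {i : Fin (qtmLength n)} (hi : Even (i : ℕ)) :
    (rowOp fun _ : Fin L => rowVertex R kappa T t n i) =
      rowTransferBar R L (qtmInhom kappa T t n i) := by
  rw [rowTransferBar_eq_rowOp]
  congr 1
  funext j u v
  rw [rowVertex, if_pos hi]

theorem rowOp_rowVertex_odd {L : ℕ} {i : Fin (qtmLength n)} (hi : ¬ Even (i : ℕ)) :
    (rowOp fun _ : Fin L => rowVertex R kappa T t n i) =
      rowTransfer R L (qtmInhom kappa T t n i) := by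
  rw [rowTransfer_eq_rowOp]
  congr 1
  funext j u v
  rw [rowVertex, if_neg hi]

theorem qtmInhom_of_lt {kappa : ℂ} {T t : ℝ} {i : Fin (qtmLength n)} (hi : (i : ℕ) < 2 * n) :
    qtmInhom kappa T t n i = (-1) ^ (i : ℕ) * (Complex.I * t / (kappa * (2 * n : ℕ))) := by
  rw [qtmInhom, if_pos hi]

theorem qtmInhom_of_le {kappa : ℂ} {T t : ℝ} {i : Fin (qtmLength n)} (hi : 2 * n ≤ (i : ℕ)) :
    qtmInhom kappa T t n i =
      (-1) ^ (i : ℕ) * ((1 / (T : ℂ) - Complex.I * t) / (kappa * (2 * n : ℕ))) := by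
  rw [qtmInhom, if_neg hi.not_gt]

/-- The first `2 * n` rows form $\rho(it)$, the remaining ones $\rho(1/T-it)$. Within each half a
pair of rows is $t_\perp(-z)\overline t_\perp(z)$, because the inhomogeneities alternate in sign. -/
theorem rho_mul_rho_trace (hn : 0 < n) {L : ℕ} [NeZero L]
    (x y : Fin L → Matrix (Fin d) (Fin d) ℂ) :
    (tens (fun j => y j * theta phi ((h : ℂ) / T)) *
      rho R kappa n L (1 / (T : ℂ) - Complex.I * t) * tens x *
      rho R kappa n L (Complex.I * t)).trace =
    ((List.ofFn fun j => column R kappa phi h T t n (x j) (y j)).prod).trace := by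
  have : NeZero (qtmLength n) := ⟨by simp [qtmLength]; omega⟩
  -- The product operators are attached on the left of the last row of each half, that is, at the
  -- row indices `qtmLength n - 1` and `2 * n - 1`.
  let D : Fin (qtmLength n) → Fin L → Matrix (Fin d) (Fin d) ℂ := fun i =>
    if (i : ℕ) + 1 = qtmLength n then (fun j => y j * theta phi ((h : ℂ) / T))
    else if (i : ℕ) + 1 = 2 * n then x else 1
  have key := trace_rows_eq_trace_cols (L := L) fun i j s s' =>
    ∑ q, D i j s q • rowVertex R kappa T t n i q s'
  have hlt : 2 * n < qtmLength n := by simp only [qtmLength]; omega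
  have hrow : ((List.ofFn fun i => rowOp fun j s s' =>
        ∑ q, D i j s q • rowVertex R kappa T t n i q s').reverse.prod) =
      tens (fun j => y j * theta phi ((h : ℂ) / T)) *
        rho R kappa n L (1 / (T : ℂ) - Complex.I * t) * tens x *
        rho R kappa n L (Complex.I * t) := by
    simp only [← tens_mul_rowOp]
    rw [List.ofFn_eq_map, ← List.map_reverse,
      prod_reverse_finRange_insert (k := 2 * n) (by omega) hlt (fun i => tens (D i)) _ (x := tens x)
        (y := tens fun j => y j * theta phi ((h : ℂ) / T))]
    · congr 1
      · congr 2
        rw [show 2 * n = 2 * (2 * n - n) by omega, rho]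
        refine prod_upSites_pairs rfl n (by omega) (fun i hi he => ?_) (fun i hi he => ?_)
        · rw [rowOp_rowVertex_even _ _ _ _ he, qtmInhom_of_le (by omega), he.neg_one_pow, one_mul]
        · rw [rowOp_rowVertex_odd _ _ _ _ he, qtmInhom_of_le (by omega),
            (Nat.not_even_iff_odd.1 he).neg_one_pow, neg_one_mul]
      · refine prod_lowSites_pairs n hlt.le (fun i hi he => ?_) (fun i hi he => ?_)
        · rw [rowOp_rowVertex_even _ _ _ _ he, qtmInhom_of_lt hi, he.neg_one_pow, one_mul]
        · rw [rowOp_rowVertex_odd _ _ _ _ he, qtmInhom_of_lt hi,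
            (Nat.not_even_iff_odd.1 he).neg_one_pow, neg_one_mul]
    · intro i hi
      simp only [D]
      rw [if_neg (by omega), if_pos hi]
    · intro i hi
      simp only [D]
      rw [if_pos hi]
    · intro i hi hi'
      simp only [D]
      rw [if_neg hi', if_neg hi, tens_one]
  rw [hrow] at key
  rw [key]
  congr 3
  funext j
  ext p p'
  rw [colOp, column, Matrix.of_apply, Matrix.of_apply]
  congr 1
  have hcol : ∀ i, (Matrix.of fun c c' =>
      (∑ q, D i j c q • rowVertex R kappa T t n i q c') (p i) (p' i)) =
      D i j * qtmVertex R kappa T t n p p' i := by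
    intro i
    ext c c'
    simp only [Matrix.of_apply, Matrix.sum_apply, Matrix.smul_apply, smul_eq_mul, Matrix.mul_apply,
      rowVertex_apply]
  simp only [hcol]
  rw [List.ofFn_eq_map, ← List.map_reverse,
    prod_reverse_finRange_insert (k := 2 * n) (by omega) hlt (fun i => D i j) _ (x := x j)
      (y := y j * theta phi ((h : ℂ) / T))]
  · intro i hi
    simp only [D]
    rw [if_neg (by omega), if_pos hi]
  · intro i hi
    simp only [D]
    rw [if_pos hi]
  · intro i hi hi'
    simp only [D]
    rw [if_neg hi', if_neg hi, Pi.one_apply]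

end Columns


/-! ### Columns and insertions into the quantum transfer matrix -/

theorem ofFn_eq_map_range {A : Type*} (F : ℕ → A) (N : ℕ) :
    List.ofFn (fun j : Fin N => F j) = (List.range N).map F :=
  List.ext_getElem (by simp) (by simp)

theorem prod_map_range_add {A : Type*} [Monoid A] (F : ℕ → A) (a b : ℕ) :
    ((List.range (a + b)).map F).prod =
      ((List.range a).map F).prod * ((List.range b).map fun j => F (a + j)).prod := by
  rw [List.range_add, List.map_append, List.prod_append, List.map_map]
  rfl

theorem prod_map_range_const {A : Type*} [Monoid A] {F : ℕ → A} {c : A} {N : ℕ}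
    (h : ∀ j < N, F j = c) : ((List.range N).map F).prod = c ^ N := by
  have : (List.range N).map F = (List.range N).map fun _ => c :=
    List.map_congr_left fun j hj => h j (List.mem_range.1 hj)
  rw [this, List.map_const', List.prod_replicate, List.length_range]

theorem prod_ofFn_blocks {A : Type*} [Monoid A] {F : ℕ → A} {c : A} {l m r q : ℕ} (hlm : l ≤ m)
    (h1 : ∀ j, l ≤ j → j < m → F j = c) (h2 : ∀ j, m + r ≤ j → F j = c) :
    (List.ofFn fun j : Fin (m + r + q) => F j).prod =
      (List.ofFn fun j : Fin l => F j).prod * c ^ (m - l) *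
        (List.ofFn fun j : Fin r => F (m + j)).prod * c ^ q := by
  rw [ofFn_eq_map_range, ofFn_eq_map_range, ofFn_eq_map_range fun j => F (m + j),
    prod_map_range_add, prod_map_range_add]
  congr 1
  · congr 1
    conv_lhs => rw [← Nat.add_sub_cancel' hlm]
    rw [prod_map_range_add]
    congr 1
    exact prod_map_range_const fun j hj => h1 _ (by omega) (by omega)
  · exact prod_map_range_const fun j _ => h2 _ (by omega)

/-- The ascending product `tr_0 {z_1 X} ⋯ tr_0 {z_q X}`. -/
def insertion {d M q : ℕ} (X : AuxOp d M) (z : Fin q → Matrix (Fin d) (Fin d) ℂ) : Op d M :=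
  (List.ofFn fun k => (aux M (z k) * X).trace).prod

theorem trace_aux_mul {d M : ℕ} (z : Matrix (Fin d) (Fin d) ℂ) (X : AuxOp d M) :
    (aux M z * X).trace = ∑ a, ∑ b, z a b • X b a := by
  simp [Matrix.trace, Matrix.mul_apply, aux]

/-- An insertion is a product of linear combinations of the entries of `X`, so a relation for all
entries passes through it factor by factor. -/
theorem mul_insertion_eq {d M q : ℕ} {X X' : AuxOp d M} {tau : Op d M}
    (h : ∀ a b, tau * X a b = X' a b * tau) (z : Fin q → Matrix (Fin d) (Fin d) ℂ) :
    tau * insertion X z = insertion X' z * tau := by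
  have h1 : ∀ z, tau * (aux M z * X).trace = (aux M z * X').trace * tau := by
    intro z
    simp only [trace_aux_mul, Finset.mul_sum, Finset.sum_mul, mul_smul_comm, smul_mul_assoc, h]
  have key : ∀ l : List (Matrix (Fin d) (Fin d) ℂ),
      tau * (l.map fun z => (aux M z * X).trace).prod =
        (l.map fun z => (aux M z * X').trace).prod * tau := by
    intro l
    induction l with
    | nil => simp
    | cons z l ih =>
      rw [List.map_cons, List.prod_cons, ← mul_assoc, h1, mul_assoc, ih, List.map_cons,
        List.prod_cons, mul_assoc]
  have := key (List.ofFn z)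
  rw [List.map_ofFn, List.map_ofFn] at this
  exact this

section Qtm

variable {d : ℕ} (R : ℂ → ℂ → Matrix (Fin d × Fin d) (Fin d × Fin d) ℂ) (kappa : ℂ)
  (phi : Matrix (Fin d) (Fin d) ℂ) (h T t : ℝ) (n : ℕ)

/-- The monodromy matrix of the quantum transfer matrix with its first `k` sites moved past the
twist. -/
def rotated (k : ℕ) (lam : ℂ) : AuxOp d (qtmLength n) :=
  twistedWord R (theta phi ((h : ℂ) / T)) (qtmSign n) (qtmInhom kappa T t n) lam
    (lowSites (qtmLength n) k) (upSites (qtmLength n) k)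

theorem aux_one {d M : ℕ} : aux M (1 : Matrix (Fin d) (Fin d) ℂ) = 1 := by
  ext a b : 2
  simp only [aux, Matrix.of_apply, Matrix.one_apply]
  split_ifs <;> simp

theorem rotated_zero (lam : ℂ) : rotated R kappa phi h T t n 0 lam =
    qtmMonodromy R kappa phi h T t n lam := by
  rw [rotated, lowSites_zero, upSites_zero, twistedWord, qtmMonodromy, stagMonodromy, word, word,
    List.map_nil, List.prod_nil, one_mul, List.map_reverse, ← List.ofFn_eq_map]

theorem supportedOn_word {d M : ℕ} {R : ℂ → ℂ → Matrix (Fin d × Fin d) (Fin d × Fin d) ℂ}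
    {sg : Fin M → ℤˣ} {nu : Fin M → ℂ} (lam : ℂ) {l : List (Fin M)} (hl : l.Nodup) :
    SupportedOn l.toFinset (word R sg nu lam l) fun s s' =>
      (l.map fun j => vertex (stagVertex R (sg j) lam (nu j)) (s j) (s' j)).prod := by
  have := supportedOn_list (fun j => stagVertex R (sg j) lam (nu j)) l hl
  simpa only [word, stagR_eq] using this

theorem trace_aux_mul_rotated_apply (x : Matrix (Fin d) (Fin d) ℂ) (k : ℕ)
    (p p' : Fin (qtmLength n) → Fin d) :
    (aux _ x * rotated R kappa phi h T t n k 0).trace p p' =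
      (x * (((lowSites (qtmLength n) k).map (qtmVertex R kappa T t n p p')).prod *
        theta phi ((h : ℂ) / T) *
        ((upSites (qtmLength n) k).map (qtmVertex R kappa T t n p p')).prod)).trace := by
  have hnd := nodup_upSites_append_lowSites (qtmLength n) k
  have hnd' := List.nodup_append'.1 hnd
  have h1 := ((supportedOn_word (R := R) (sg := qtmSign n) (nu := qtmInhom kappa T t n) 0
    hnd'.2.1).mul (supportedOn_aux (theta phi ((h : ℂ) / T))) (by simp)).mul
    (supportedOn_word (R := R) (sg := qtmSign n) (nu := qtmInhom kappa T t n) 0 hnd'.1) (by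
      rw [Finset.union_empty, List.disjoint_toFinset_iff_disjoint]
      exact hnd'.2.2.symm)
  refine ((supportedOn_aux x).mul h1 (by simp)).trace_apply (fun i => ?_) p p'
  have : i ∈ upSites (qtmLength n) k ++ lowSites (qtmLength n) k := by
    rw [upSites_append_lowSites]; simp
  rw [List.mem_append] at this
  simp only [Finset.empty_union, Finset.union_empty, Finset.mem_union, List.mem_toFinset]
  exact this.symm

theorem column_one_left (y : Matrix (Fin d) (Fin d) ℂ) :
    column R kappa phi h T t n 1 y = (aux _ y * qtmMonodromy R kappa phi h T t n 0).trace := by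
  ext p p'
  rw [← rotated_zero, trace_aux_mul_rotated_apply, lowSites_zero, upSites_zero,
    ← upSites_append_lowSites _ (2 * n), column, Matrix.of_apply]
  simp only [List.map_append, List.prod_append, List.map_nil, List.prod_nil, one_mul, mul_one,
    mul_assoc]

/-- Cyclicity of the trace over the matrices on the vertical line brings `x` to the front and puts
the lower half of the column before the twist. -/
theorem column_one_right (x : Matrix (Fin d) (Fin d) ℂ) :
    column R kappa phi h T t n x 1 =
      (aux _ x * rotated R kappa phi h T t n (2 * n) 0).trace := by
  ext p p'
  rw [trace_aux_mul_rotated_apply, column, Matrix.of_apply, one_mul, mul_assoc,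
    Matrix.trace_mul_comm]
  simp only [mul_assoc]

theorem column_one_one : column R kappa phi h T t n 1 1 = qtm R kappa phi h T t n 0 := by
  rw [column_one_left, aux_one, one_mul, qtm]

variable {R kappa phi h T t n}

/-- Hence all rotated monodromy matrices share one transfer matrix, and one eigensystem serves every
step of the rotation. -/
theorem trace_rotated {k : ℕ} (hk : k ≤ qtmLength n) (lam : ℂ) :
    (rotated R kappa phi h T t n k lam).trace = qtm R kappa phi h T t n lam := by
  induction k with
  | zero => rw [rotated_zero, qtm]
  | succ k ih =>
    have hk' : k < qtmLength n := hk
    have hnd := nodup_rotation hk'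
    rw [List.nodup_cons, List.mem_append, not_or] at hnd
    rw [← ih hk'.le, rotated, rotated, lowSites_succ hk', upSites_eq hk',
      trace_twistedWord_cons hnd.1.1 hnd.1.2]

theorem IsFundamental.qtm_mul_rotated {U : Set ℂ} (hR : IsFundamental R U)
    (hphi : IsU1Symmetric R U phi) (h0 : (0 : ℂ) ∈ U) (hnu : ∀ j, qtmInhom kappa T t n j ∈ U)
    {k : ℕ} (hk : k < qtmLength n) (he : Even k) (a b : Fin d) :
    qtm R kappa phi h T t n (qtmInhom kappa T t n ⟨k, hk⟩) *
        rotated R kappa phi h T t n k 0 a b =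
      rotated R kappa phi h T t n (k + 1) 0 a b *
        qtm R kappa phi h T t n (qtmInhom kappa T t n ⟨k, hk⟩) := by
  rw [← trace_rotated hk.le, rotated, rotated, rotated, lowSites_succ hk, upSites_eq hk]
  exact hR.trace_mul_twistedWord hnu h0 ((qtmSign_eq_one_iff _).2 he)
    (fun lam hl mu hm => hphi lam hl mu hm _) (nodup_rotation hk) a b

theorem IsFundamental.qtm_mul_rotated_succ {U : Set ℂ} (hR : IsFundamental R U)
    (hphi : IsU1Symmetric R U phi) (h0 : (0 : ℂ) ∈ U) (hnu : ∀ j, qtmInhom kappa T t n j ∈ U)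
    {k : ℕ} (hk : k < qtmLength n) (he : ¬ Even k) (a b : Fin d) :
    qtm R kappa phi h T t n (qtmInhom kappa T t n ⟨k, hk⟩) *
        rotated R kappa phi h T t n (k + 1) 0 a b =
      rotated R kappa phi h T t n k 0 a b *
        qtm R kappa phi h T t n (qtmInhom kappa T t n ⟨k, hk⟩) := by
  rw [← trace_rotated hk.le, rotated, rotated, rotated, lowSites_succ hk, upSites_eq hk]
  exact hR.trace_mul_twistedWord_cons hnu h0 (fun h => he ((qtmSign_eq_one_iff _).1 h))
    (fun lam hl mu hm => hphi lam hl mu hm _) (nodup_rotation hk) a b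

/-- If the first inhomogeneity vanishes, then an insertion into the quantum transfer matrix is a
local operator times the quantum transfer matrix. -/
theorem IsFundamental.trace_aux_mul_qtmMonodromy {U : Set ℂ} (hR : IsFundamental R U)
    (h0 : (0 : ℂ) ∈ U) (hn : 0 < qtmLength n) (hnu : qtmInhom kappa T t n ⟨0, hn⟩ = 0)
    (x : Matrix (Fin d) (Fin d) ℂ) :
    (aux _ x * qtmMonodromy R kappa phi h T t n 0).trace =
      site ⟨0, hn⟩ x * qtm R kappa phi h T t n 0 := by
  have hnd := nodup_rotation hn
  rw [List.nodup_cons, List.mem_append, not_or] at hnd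
  have hs : stagVertex R (qtmSign n ⟨0, hn⟩) 0 0 = perm d := by
    rw [stagVertex, if_pos ((qtmSign_eq_one_iff _).2 (by simp)), hR.regular 0 h0]
  rw [qtm, ← rotated_zero, rotated, upSites_eq hn, twistedWord_append_singleton, hnu, hs]
  set C := twistedWord R (theta phi ((h : ℂ) / T)) (qtmSign n) (qtmInhom kappa T t n) 0
    (lowSites (qtmLength n) 0) (upSites (qtmLength n) (0 + 1)) with hC
  have hc : ∀ a b u v, Commute (C a b) (site ⟨0, hn⟩ (Matrix.single u v (1 : ℂ))) := by
    intro a b u v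
    have := entriesCommute_twistedWord (R := R) (g := theta phi ((h : ℂ) / T)) (sg := qtmSign n)
      (nu := qtmInhom kappa T t n) hnd.1.1 hnd.1.2 0 (perm d) a b v u
    rwa [auxSite_perm_apply] at this
  have hx : site ⟨0, hn⟩ x = ∑ a, ∑ b, x a b • site (L := qtmLength n) ⟨0, hn⟩
      (Matrix.single a b (1 : ℂ)) := by
    conv_lhs => rw [← siteHom_apply, Matrix.matrix_eq_sum_single x]
    simp only [map_sum]
    refine Finset.sum_congr rfl fun u _ => Finset.sum_congr rfl fun v _ => ?_
    rw [← siteHom_apply, ← map_smul, Matrix.smul_single, smul_eq_mul, mul_one]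
  rw [trace_aux_mul, hx, Finset.sum_mul]
  refine Finset.sum_congr rfl fun a _ => ?_
  rw [Finset.sum_mul]
  refine Finset.sum_congr rfl fun b _ => ?_
  rw [smul_mul_assoc]
  congr 1
  simp only [Matrix.trace, Matrix.diag_apply, Matrix.mul_apply, auxSite_perm_apply, Finset.mul_sum]
  -- The permutation vertex contributes $e_{uv}$ to the transfer matrix; multiplying by $e_{ab}$
  -- from the left selects $u=b$ and reproduces the entry $T_{ba}$.
  conv_rhs =>
    enter [2, u, 2, v]
    rw [← mul_assoc, ← (hc u v a b).eq, mul_assoc, site_single_mul]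
  simp only [mul_ite, mul_zero]
  refine Eq.symm ((Finset.sum_eq_single b ?_ ?_).trans ?_)
  · intro u _ hu
    simp [Ne.symm hu]
  · simp
  · simp

end Qtm


/-! ### Spectral decomposition -/

namespace IsEigensystem

variable {I : Type} [Fintype I] {t : ℂ → Matrix I I ℂ} {U : Set ℂ} {K : ℕ}
  {ket bra : Fin (K + 1) → I → ℂ} {ev : Fin (K + 1) → ℂ → ℂ}

/-- Applying `t lam` to the left and to the right eigenvector turns an intertwining relation into a
ratio of eigenvalues, without inverting `t lam`. -/
theorem mul_matrixElement (hE : IsEigensystem t U ket bra ev) {lam : ℂ} (hl : lam ∈ U)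
    {A A' : Matrix I I ℂ} (h : t lam * A = A' * t lam) (i j : Fin (K + 1)) :
    ev i lam * (bra i ⬝ᵥ (A *ᵥ ket j)) = (bra i ⬝ᵥ (A' *ᵥ ket j)) * ev j lam := by
  have h1 : bra i ⬝ᵥ ((t lam * A) *ᵥ ket j) = ev i lam * (bra i ⬝ᵥ (A *ᵥ ket j)) := by
    rw [← Matrix.mulVec_mulVec, Matrix.dotProduct_mulVec, hE.left lam hl, smul_dotProduct,
      smul_eq_mul]
  have h2 : bra i ⬝ᵥ ((A' * t lam) *ᵥ ket j) = (bra i ⬝ᵥ (A' *ᵥ ket j)) * ev j lam := by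
    rw [← Matrix.mulVec_mulVec, hE.right lam hl, Matrix.mulVec_smul, dotProduct_smul, smul_eq_mul,
      mul_comm]
  rw [← h1, ← h2, h]

variable [DecidableEq I]

theorem pow_mulVec (hE : IsEigensystem t U ket bra ev) {lam : ℂ} (hl : lam ∈ U) (p : ℕ)
    (j : Fin (K + 1)) : (t lam ^ p) *ᵥ ket j = ev j lam ^ p • ket j := by
  induction p with
  | zero => simp
  | succ p ih =>
    rw [pow_succ, ← Matrix.mulVec_mulVec, hE.right lam hl, Matrix.mulVec_smul, ih, smul_smul,
      pow_succ, mul_comm]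

/-- By biorthogonality the sum fixes each ket, and the kets span. -/
theorem resolution (hE : IsEigensystem t U ket bra ev) :
    ∑ k, (bra k ⬝ᵥ ket k)⁻¹ • Matrix.vecMulVec (ket k) (bra k) = 1 := by
  have h1 : Matrix.toLin' (∑ k, (bra k ⬝ᵥ ket k)⁻¹ • Matrix.vecMulVec (ket k) (bra k)) =
      LinearMap.id := by
    refine LinearMap.ext_on_range hE.complete fun j => ?_
    rw [Matrix.toLin'_apply, Matrix.sum_mulVec, Finset.sum_eq_single j]
    · rw [Matrix.smul_mulVec, Matrix.vecMulVec_mulVec]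
      simp [smul_smul, inv_mul_cancel₀ (hE.normalizable j)]
    · intro k _ hk
      rw [Matrix.smul_mulVec, Matrix.vecMulVec_mulVec, hE.orthogonal k j hk]
      simp
    · simp
  rw [← Matrix.toLin'_one] at h1
  exact Matrix.toLin'.injective h1

theorem trace_eq (hE : IsEigensystem t U ket bra ev) (A : Matrix I I ℂ) :
    A.trace = ∑ k, (bra k ⬝ᵥ (A *ᵥ ket k)) / (bra k ⬝ᵥ ket k) := by
  conv_lhs => rw [← mul_one A, ← hE.resolution]
  rw [Finset.mul_sum, Matrix.trace_sum]
  refine Finset.sum_congr rfl fun k _ => ?_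
  rw [mul_smul_comm, Matrix.trace_smul, Matrix.mul_vecMulVec, Matrix.trace_vecMulVec, smul_eq_mul,
    dotProduct_comm (A *ᵥ ket k), div_eq_inv_mul]

theorem matrixElement_mul (hE : IsEigensystem t U ket bra ev) (A B : Matrix I I ℂ)
    (i j : Fin (K + 1)) : bra i ⬝ᵥ ((A * B) *ᵥ ket j) =
      ∑ k, (bra i ⬝ᵥ (A *ᵥ ket k)) * (bra k ⬝ᵥ (B *ᵥ ket j)) / (bra k ⬝ᵥ ket k) := by
  conv_lhs => rw [← mul_one A, ← hE.resolution, Finset.mul_sum, Finset.sum_mul, Matrix.sum_mulVec]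
  rw [dotProduct_sum]
  refine Finset.sum_congr rfl fun k _ => ?_
  rw [mul_smul_comm, smul_mul_assoc, Matrix.smul_mulVec, Matrix.mul_vecMulVec,
    Matrix.vecMulVec_mul, Matrix.vecMulVec_mulVec, dotProduct_smul, ← Matrix.dotProduct_mulVec]
  simp only [dotProduct_smul, smul_eq_mul, MulOpposite.smul_eq_mul_unop, MulOpposite.unop_op]
  ring

theorem trace_pow (hE : IsEigensystem t U ket bra ev) {lam : ℂ} (hl : lam ∈ U) (p : ℕ) :
    (t lam ^ p).trace = ∑ k, ev k lam ^ p := by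
  rw [hE.trace_eq]
  refine Finset.sum_congr rfl fun k _ => ?_
  rw [hE.pow_mulVec hl, dotProduct_smul, smul_eq_mul, mul_div_cancel_right₀ _ (hE.normalizable k)]

theorem trace_mul_pow (hE : IsEigensystem t U ket bra ev) {lam : ℂ} (hl : lam ∈ U)
    (A : Matrix I I ℂ) (p : ℕ) :
    (A * t lam ^ p).trace =
      ∑ k, ev k lam ^ p * ((bra k ⬝ᵥ (A *ᵥ ket k)) / (bra k ⬝ᵥ ket k)) := by
  rw [hE.trace_eq]
  refine Finset.sum_congr rfl fun k _ => ?_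
  rw [← Matrix.mulVec_mulVec, hE.pow_mulVec hl, Matrix.mulVec_smul, dotProduct_smul, smul_eq_mul,
    mul_div_assoc]

theorem tendsto_sum_pow_div_pow {ι : Type*} [Fintype ι] {z c : ι → ℂ} {i : ι}
    (hi : z i ≠ 0) (h : ∀ k, k ≠ i → ‖z k‖ < ‖z i‖) :
    Filter.Tendsto (fun q : ℕ => (∑ k, z k ^ q * c k) / z i ^ q) Filter.atTop (𝓝 (c i)) := by
  classical
  have h1 : ∀ k, Filter.Tendsto (fun q : ℕ => (z k / z i) ^ q * c k) Filter.atTop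
      (𝓝 (if k = i then c i else 0)) := by
    intro k
    split_ifs with hk
    · subst hk
      simp [div_self hi]
    · have : ‖z k / z i‖ < 1 := by
        rw [norm_div, div_lt_one (norm_pos_iff.2 hi)]
        exact h k hk
      simpa using (tendsto_pow_atTop_nhds_zero_of_norm_lt_one this).mul_const (c k)
  have h2 := tendsto_finsetSum Finset.univ fun k _ => h1 k
  rw [Finset.sum_ite_eq' Finset.univ i, if_pos (Finset.mem_univ i)] at h2
  refine h2.congr fun q => ?_
  rw [Finset.sum_div]
  refine Finset.sum_congr rfl fun k _ => ?_
  rw [div_pow]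
  ring

/-- In the thermodynamic limit only the dominant state contributes. -/
theorem tendsto_trace_div (hE : IsEigensystem t U ket bra ev) {lam : ℂ} (hl : lam ∈ U)
    (hdom : ∀ k : Fin (K + 1), k ≠ 0 → ‖ev k lam‖ < ‖ev 0 lam‖) (h0 : ev 0 lam ≠ 0)
    (A : Matrix I I ℂ) (c : ℕ) :
    Filter.Tendsto (fun q : ℕ => (A * t lam ^ q).trace / (t lam ^ (c + q)).trace) Filter.atTop
      (𝓝 ((bra 0 ⬝ᵥ (A *ᵥ ket 0)) / (bra 0 ⬝ᵥ ket 0) / ev 0 lam ^ c)) := by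
  have h1 := tendsto_sum_pow_div_pow (z := fun k => ev k lam)
    (c := fun k => (bra k ⬝ᵥ (A *ᵥ ket k)) / (bra k ⬝ᵥ ket k)) h0 hdom
  have h2 := tendsto_sum_pow_div_pow (z := fun k => ev k lam)
    (c := fun k => ev k lam ^ c) h0 hdom
  refine (h1.div h2 (pow_ne_zero _ h0)).congr fun q => ?_
  rw [hE.trace_mul_pow hl, hE.trace_pow hl, Pi.div_apply,
    div_div_div_cancel_right₀ (pow_ne_zero _ h0)]
  congr 1
  exact Finset.sum_congr rfl fun k _ => by rw [pow_add, mul_comm]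

end IsEigensystem

/-! ### The two-point function at finite Trotter number -/

section TwoPoint

variable {d : ℕ} {R : ℂ → ℂ → Matrix (Fin d × Fin d) (Fin d × Fin d) ℂ} {U : Set ℂ} {kappa : ℂ}
  {phi : Matrix (Fin d) (Fin d) ℂ} {h T t : ℝ} {n : ℕ}

theorem theta_mul_theta (a b : ℂ) : theta phi a * theta phi b = theta phi (a + b) := by
  rw [theta, theta, theta, add_smul,
    Matrix.exp_add_of_commute _ _ (((Commute.refl phi).smul_left _).smul_right _)]

theorem trotterExp_eq (L : ℕ) (beta : ℂ) : trotterExp R kappa phi h n L beta =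
    (tens fun _ => theta phi (beta * h)) * rho R kappa n L beta := by
  rw [trotterExp, exp_smul_totalCharge]

theorem trotter_params_mem (hn : 0 < n) (hnu : ∀ j, qtmInhom kappa T t n j ∈ U) :
    (Complex.I * t / (kappa * (2 * n : ℕ)) ∈ U ∧ -(Complex.I * t / (kappa * (2 * n : ℕ))) ∈ U) ∧
    ((1 / (T : ℂ) - Complex.I * t) / (kappa * (2 * n : ℕ)) ∈ U ∧
      -((1 / (T : ℂ) - Complex.I * t) / (kappa * (2 * n : ℕ))) ∈ U) := by
  have l0 : 0 < qtmLength n := by simp only [qtmLength]; omega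
  have l1 : 1 < qtmLength n := by simp only [qtmLength]; omega
  have l2 : 2 * n < qtmLength n := by simp only [qtmLength]; omega
  have l3 : 2 * n + 1 < qtmLength n := by simp only [qtmLength]; omega
  have e0 := hnu ⟨0, l0⟩
  have e1 := hnu ⟨1, l1⟩
  have e2 := hnu ⟨2 * n, l2⟩
  have e3 := hnu ⟨2 * n + 1, l3⟩
  rw [qtmInhom_of_lt (by simp; omega)] at e0 e1
  rw [qtmInhom_of_le (by simp)] at e2 e3
  simp only [pow_zero, pow_succ, pow_mul, one_mul, neg_mul, mul_neg, mul_one, neg_neg,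
    one_pow] at e0 e1 e2 e3
  exact ⟨⟨e0, e1⟩, e2, e3⟩

/-- The rotation $e^{iht\hat\Phi}$ is moved left through `x`, where the charge gives the phase, and
through $\rho$, with which it commutes. It then merges with $e^{(1/T-it)h\hat\Phi}$ to the twist
$\theta(h/T)$ in every column. -/
theorem trace_trotterExp_eq (hn : 0 < n) (hU : U ∈ 𝓝 (0 : ℂ))
    (hphi : IsU1Symmetric R U phi) (hnu : ∀ j, qtmInhom kappa T t n j ∈ U) {L l off : ℕ}
    [NeZero L] {x : Fin l → Matrix (Fin d) (Fin d) ℂ} (D : Fin L → Matrix (Fin d) (Fin d) ℂ)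
    {s : ℂ} (hx : HasCharge phi x s) (hL : off + l ≤ L) :
    (trotterExp R kappa phi h n L (1 / (T : ℂ) - Complex.I * t) * localOp L off x *
      trotterExp R kappa phi h n L (Complex.I * t) * tens D).trace =
    Complex.exp (-(Complex.I * h * t * s)) * ((List.ofFn fun j : Fin L =>
      column R kappa phi h T t n (localFactor off x j) (D j)).prod).trace := by
  obtain ⟨_, hm1, hm2⟩ := trotter_params_mem hn hnu
  have hc := IsFundamental.tens_theta_commute_rho (L := L) hU hphi hm2 hm1 (Complex.I * t * h)
  have hX : localOp L off x * (tens fun _ => theta phi (Complex.I * t * h)) =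
      Complex.exp (-(Complex.I * h * t * s)) •
        ((tens fun _ => theta phi (Complex.I * t * h)) * localOp L off x) := by
    rw [hx.theta_mul hL, smul_smul, ← Complex.exp_add]
    have : -(Complex.I * h * t * s) + Complex.I * t * h * s = 0 := by ring
    rw [this, Complex.exp_zero, one_smul]
  have hT : (tens fun _ : Fin L => theta phi ((1 / (T : ℂ) - Complex.I * t) * h)) *
      (tens fun _ => theta phi (Complex.I * t * h)) = tens fun _ => theta phi ((h : ℂ) / T) := by
    rw [tens_mul]
    congr 1
    funext j
    rw [Pi.mul_apply, theta_mul_theta]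
    congr 1
    ring
  rw [← rho_mul_rho_trace R kappa phi h T t hn]
  have hY : (tens fun j : Fin L => D j * theta phi ((h : ℂ) / T)) =
      tens D * tens fun _ => theta phi ((h : ℂ) / T) := by
    rw [tens_mul]
    rfl
  rw [hY, ← localOp_eq_tens, ← hT, trotterExp_eq, trotterExp_eq, Matrix.trace_mul_comm]
  refine (congrArg Matrix.trace ?_).trans ((Matrix.trace_smul (Complex.exp (-(Complex.I * h * t * s))) _).trans
    (smul_eq_mul _ _))
  set A := tens fun _ : Fin L => theta phi ((1 / (T : ℂ) - Complex.I * t) * h)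
  set B := tens fun _ : Fin L => theta phi (Complex.I * t * h)
  set X := localOp L off x
  set ρ₁ := rho R kappa n L (Complex.I * t)
  set ρ₂ := rho R kappa n L (1 / (T : ℂ) - Complex.I * t)
  calc tens D * (A * ρ₂ * X * (B * ρ₁)) = tens D * A * ρ₂ * (X * B) * ρ₁ := by
        noncomm_ring
    _ = Complex.exp (-(Complex.I * h * t * s)) •
        (tens D * A * (ρ₂ * B) * X * ρ₁) := by
        rw [hX]
        simp only [mul_smul_comm, smul_mul_assoc, mul_assoc]
    _ = _ := by rw [← hc.eq]; simp only [mul_assoc]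

end TwoPoint


/-! ### The form-factor series as thermodynamic limit at fixed Trotter number. -/

section FormFactorSeries

variable {d : ℕ} {R : ℂ → ℂ → Matrix (Fin d × Fin d) (Fin d × Fin d) ℂ} {U : Set ℂ} {kappa : ℂ}
  {phi : Matrix (Fin d) (Fin d) ℂ} {h T t : ℝ} {n : ℕ}

theorem localOp_zero {d L : ℕ} (off : ℕ) (z : Fin 0 → Matrix (Fin d) (Fin d) ℂ) :
    localOp L off z = 1 := by simp [localOp]

theorem hasCharge_zero (z : Fin 0 → Matrix (Fin d) (Fin d) ℂ) : HasCharge phi z 0 := by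
  rw [HasCharge, localOp_zero]
  simp

theorem localFactor_zero (off : ℕ) (z : Fin 0 → Matrix (Fin d) (Fin d) ℂ) (j : ℕ) :
    localFactor off z j = 1 := by simp [localFactor]

/-- The normalization is the trace of a power of the quantum transfer matrix. -/
theorem trace_trotterExp_mul_trotterExp (hn : 0 < n) (hU : U ∈ 𝓝 (0 : ℂ))
    (hphi : IsU1Symmetric R U phi) (hnu : ∀ j, qtmInhom kappa T t n j ∈ U) {L : ℕ} [NeZero L] :
    (trotterExp R kappa phi h n L (1 / (T : ℂ) - Complex.I * t) *
      trotterExp R kappa phi h n L (Complex.I * t)).trace =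
      (qtm R kappa phi h T t n 0 ^ L).trace := by
  have := trace_trotterExp_eq (h := h) hn hU hphi hnu (L := L) (off := 0) 1
    (hasCharge_zero (d := d) (phi := phi) Fin.elim0) (Nat.zero_le _)
  rw [localOp_zero, tens_one, mul_one, mul_one] at this
  rw [this]
  simp only [localFactor_zero, Pi.one_apply, column_one_one, List.ofFn_const, List.prod_replicate,
    mul_zero, neg_zero, Complex.exp_zero, one_mul]

/-- Because `l ≤ m`, no column carries factors of both operators: there are `l` columns with `x`, `m
- l` bare ones, `r` with `y`, and `q` bare ones. -/
theorem trotterTwoPoint_eq (hn : 0 < n) (hU : U ∈ 𝓝 (0 : ℂ)) (hphi : IsU1Symmetric R U phi)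
    (hnu : ∀ j, qtmInhom kappa T t n j ∈ U) {l r m : ℕ} (hm : l ≤ m)
    {x : Fin l → Matrix (Fin d) (Fin d) ℂ} {y : Fin r → Matrix (Fin d) (Fin d) ℂ}
    {s : ℂ} (hx : HasCharge phi x s) {q : ℕ} (hq : 0 < q) :
    trotterTwoPoint R kappa phi h T t x y m n (m + r + q) =
      Complex.exp (-(Complex.I * h * t * s)) *
        ((insertion (rotated R kappa phi h T t n (2 * n) 0) x * qtm R kappa phi h T t n 0 ^ (m - l) *
          qtmInsertion R kappa phi h T t n y * qtm R kappa phi h T t n 0 ^ q).trace /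
          (qtm R kappa phi h T t n 0 ^ (m + r + q)).trace) := by
  have : NeZero (m + r + q) := ⟨by omega⟩
  rw [trotterTwoPoint, trace_trotterExp_mul_trotterExp hn hU hphi hnu, localOp_eq_tens m,
    trace_trotterExp_eq hn hU hphi hnu _ hx (by omega), mul_div_assoc]
  congr 3
  rw [prod_ofFn_blocks (F := fun j => column R kappa phi h T t n (localFactor 0 x j)
    (localFactor m y j)) (c := qtm R kappa phi h T t n 0) hm]
  · congr 3
    · rw [insertion]
      congr 2
      funext k
      have h1 : localFactor 0 x k = x k := by simp [localFactor]
      have h2 : localFactor m y k = 1 := by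
        rw [localFactor, dif_neg]; omega
      rw [h1, h2, column_one_right]
    · congr 1
      funext k
      have h1 : localFactor 0 x (m + k) = 1 := by
        rw [localFactor, dif_neg]; omega
      have h2 : localFactor m y (m + k) = y k := by simp [localFactor]
      rw [h1, h2, column_one_left]
  · intro j h1 h2
    have e1 : localFactor 0 x j = 1 := by rw [localFactor, dif_neg]; omega
    have e2 : localFactor m y j = 1 := by rw [localFactor, dif_neg]; omega
    simp only [e1, e2, column_one_one]
  · intro j h1
    have e1 : localFactor 0 x j = 1 := by rw [localFactor, dif_neg]; omega
    have e2 : localFactor m y j = 1 := by rw [localFactor, dif_neg]; omega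
    simp only [e1, e2, column_one_one]

theorem IsFundamental.trotterExp_zero (hU : U ∈ 𝓝 (0 : ℂ)) (hR : IsFundamental R U) (L : ℕ)
    [NeZero L] : trotterExp R kappa phi h n L 0 = 1 := by
  rw [trotterExp, rho, zero_mul, zero_smul, NormedSpace.exp_zero, zero_div, neg_zero,
    hR.rowTransfer_mul_rowTransferBar_zero hU, one_pow, one_mul]

/-- At $t=0$ nothing evolves between the two operators, so both can be placed in the top row. The
insertions then involve only the unrotated monodromy matrix and no eigenvalue has to be divided out.
-/
theorem trotterTwoPoint_eq_of_time_zero (hn : 0 < n) (hU : U ∈ 𝓝 (0 : ℂ)) (hR : IsFundamental R U)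
    (hphi : IsU1Symmetric R U phi)
    (hnu : ∀ j, qtmInhom kappa T 0 n j ∈ U) {l r m : ℕ} (hm : l ≤ m)
    (x : Fin l → Matrix (Fin d) (Fin d) ℂ) (y : Fin r → Matrix (Fin d) (Fin d) ℂ)
    {q : ℕ} (hq : 0 < q) :
    trotterTwoPoint R kappa phi h T 0 x y m n (m + r + q) =
        (qtmInsertion R kappa phi h T 0 n x * qtm R kappa phi h T 0 n 0 ^ (m - l) *
          qtmInsertion R kappa phi h T 0 n y * qtm R kappa phi h T 0 n 0 ^ q).trace /
          (qtm R kappa phi h T 0 n 0 ^ (m + r + q)).trace := by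
  have : NeZero (m + r + q) := ⟨by omega⟩
  rw [trotterTwoPoint, trace_trotterExp_mul_trotterExp hn hU hphi hnu]
  congr 1
  have h0 : trotterExp R kappa phi h n (m + r + q) (Complex.I * ((0 : ℝ) : ℂ)) = 1 := by
    rw [Complex.ofReal_zero, mul_zero, hR.trotterExp_zero hU]
  -- The middle row receives an empty operator of charge `0`; both operators enter through the
  -- top-row factor.
  have key := trace_trotterExp_eq (h := h) hn hU hphi hnu (L := m + r + q) (off := 0)
    (fun j => localFactor 0 x j * localFactor m y j)
    (hasCharge_zero (d := d) (phi := phi) Fin.elim0) (Nat.zero_le _)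
  have ht : (tens fun j : Fin (m + r + q) => localFactor 0 x j * localFactor m y j) =
      localOp (m + r + q) 0 x * localOp (m + r + q) m y := by
    rw [localOp_eq_tens, localOp_eq_tens, tens_mul]
    rfl
  rw [localOp_zero, ht, h0, mul_one, mul_one, ← mul_assoc] at key
  rw [h0, mul_one, key]
  simp only [mul_zero, neg_zero, Complex.exp_zero, one_mul, localFactor_zero, column_one_left]
  congr 1
  rw [prod_ofFn_blocks (F := fun j => ((aux (qtmLength n) (localFactor 0 x j * localFactor m y j) *
    qtmMonodromy R kappa phi h T 0 n 0).trace)) (c := qtm R kappa phi h T 0 n 0) hm]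
  · congr 3
    · rw [qtmInsertion]
      congr 2
      funext k
      have h1 : localFactor 0 x k = x k := by simp [localFactor]
      have h2 : localFactor m y k = 1 := by
        rw [localFactor, dif_neg]; omega
      rw [h1, h2, mul_one]
    · congr 1
      funext k
      have h1 : localFactor 0 x (m + k) = 1 := by
        rw [localFactor, dif_neg]; omega
      have h2 : localFactor m y (m + k) = y k := by simp [localFactor]
      rw [h1, h2, one_mul]
  · intro j h1 h2
    have e1 : localFactor 0 x j = 1 := by rw [localFactor, dif_neg]; omega
    have e2 : localFactor m y j = 1 := by rw [localFactor, dif_neg]; omega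
    simp only [e1, e2, mul_one, aux_one, one_mul, qtm]
  · intro j h1
    have e1 : localFactor 0 x j = 1 := by rw [localFactor, dif_neg]; omega
    have e2 : localFactor m y j = 1 := by rw [localFactor, dif_neg]; omega
    simp only [e1, e2, mul_one, aux_one, one_mul, qtm]

variable {K : ℕ} {ket bra : Fin (K + 1) → (Fin (qtmLength n) → Fin d) → ℂ}
  {ev : Fin (K + 1) → ℂ → ℂ}

/-- Moving an insertion through the first half of the quantum transfer matrix. -/
theorem matrixElement_insertion_rotated (hR : IsFundamental R U) (hphi : IsU1Symmetric R U phi)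
    (h0 : (0 : ℂ) ∈ U) (hnu : ∀ j, qtmInhom kappa T t n j ∈ U)
    (hE : IsEigensystem (qtm R kappa phi h T t n) U ket bra ev) {w : ℂ}
    (hw : w = Complex.I * t / (kappa * (2 * n : ℕ)))
    (hne : ∀ k, ev k w ≠ 0 ∧ ev k (-w) ≠ 0) {l : ℕ} (x : Fin l → Matrix (Fin d) (Fin d) ℂ)
    (i j : Fin (K + 1)) {p : ℕ} (hp : p ≤ n) :
    bra i ⬝ᵥ (insertion (rotated R kappa phi h T t n (2 * p) 0) x *ᵥ ket j) =
      (ev i w / ev j w) ^ p * (ev j (-w) / ev i (-w)) ^ p *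
        (bra i ⬝ᵥ (qtmInsertion R kappa phi h T t n x *ᵥ ket j)) := by
  induction p with
  | zero =>
    simp only [mul_zero, rotated_zero, pow_zero, one_mul]
    rfl
  | succ p ih =>
    have l1 : 2 * p < qtmLength n := by simp only [qtmLength]; omega
    have l2 : 2 * p + 1 < qtmLength n := by simp only [qtmLength]; omega
    have e1 : qtmInhom kappa T t n ⟨2 * p, l1⟩ = w := by
      rw [qtmInhom_of_lt (by simp; omega), hw]; simp
    have e2 : qtmInhom kappa T t n ⟨2 * p + 1, l2⟩ = -w := by
      rw [qtmInhom_of_lt (by simp; omega), hw]; simp [pow_succ]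
    have r1 := hE.mul_matrixElement (hnu ⟨2 * p, l1⟩)
      (mul_insertion_eq (hR.qtm_mul_rotated hphi h0 hnu l1 (by simp)) x) i j
    have r2 := hE.mul_matrixElement (hnu ⟨2 * p + 1, l2⟩)
      (mul_insertion_eq (hR.qtm_mul_rotated_succ hphi h0 hnu l2 (by simp)) x) i j
    rw [e1, ih (by omega)] at r1
    rw [e2] at r2
    rw [show 2 * (p + 1) = 2 * p + 1 + 1 by ring]
    -- The two moves go in opposite directions: the one at `w` divides by the eigenvalue of `j`, the
    -- one at `-w` by that of `i`.
    have s1 := eq_div_of_mul_eq (hne j).1 r1.symm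
    have s2 : bra i ⬝ᵥ (insertion (rotated R kappa phi h T t n (2 * p + 1 + 1) 0) x *ᵥ ket j) =
        (bra i ⬝ᵥ (insertion (rotated R kappa phi h T t n (2 * p + 1) 0) x *ᵥ ket j)) *
          ev j (-w) / ev i (-w) := eq_div_of_mul_eq (hne i).2 (by rw [← r2, mul_comm])
    rw [s2, s1, pow_succ, pow_succ]
    ring

/-- The dominant contribution written as a sum over intermediate states. -/
theorem sum_formFactorTerm_eq (hE : IsEigensystem (qtm R kappa phi h T t n) U ket bra ev)
    (h0 : (0 : ℂ) ∈ U) (hev : ev 0 0 ≠ 0) {l r m : ℕ} (hm : l ≤ m)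
    (A A' B : Op d (qtmLength n)) (w : ℂ)
    (hA : ∀ k, ev k 0 ≠ 0 → bra 0 ⬝ᵥ (A' *ᵥ ket k) =
      (ev 0 w / ev k w) ^ n * (ev k (-w) / ev 0 (-w)) ^ n * (bra 0 ⬝ᵥ (A *ᵥ ket k)))
    (hA0 : ∀ k, ev k 0 = 0 → bra 0 ⬝ᵥ (A' *ᵥ ket k) = 0 ∧ (ev 0 w / ev k w) ^ n = 0) :
    (bra 0 ⬝ᵥ ((A' * qtm R kappa phi h T t n 0 ^ (m - l) * B) *ᵥ ket 0)) / (bra 0 ⬝ᵥ ket 0) /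
        ev 0 0 ^ (m + r) = ∑ k, formFactorTerm ket bra ev A B l r m n w k := by
  rw [hE.matrixElement_mul, Finset.sum_div, Finset.sum_div]
  refine Finset.sum_congr rfl fun k _ => ?_
  rw [← Matrix.mulVec_mulVec, hE.pow_mulVec h0, Matrix.mulVec_smul, dotProduct_smul, smul_eq_mul,
    formFactorTerm]
  have n0 := hE.normalizable 0
  have nk := hE.normalizable k
  -- When the eigenvalue vanishes, both summands are zero by `hA0`; this gives meaning to the
  -- omission of such terms.
  by_cases hk : ev k 0 = 0
  · obtain ⟨z1, z2⟩ := hA0 k hk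
    rw [z1, z2]
    simp
  · rw [hA k hk, div_pow (ev k 0) (ev 0 0) m]
    have : ev k 0 ^ m = ev k 0 ^ (m - l) * ev k 0 ^ l := by rw [← pow_add, Nat.sub_add_cancel hm]
    rw [this, pow_add]
    generalize (ev 0 w / ev k w) ^ n = u
    generalize (ev k (-w) / ev 0 (-w)) ^ n = v
    field_simp

/-- The thermodynamic limit at finite Trotter number. -/
theorem tendsto_trotterTwoPoint_length (hn : 0 < n) (hU : U ∈ 𝓝 (0 : ℂ)) (hR : IsFundamental R U)
    (hphi : IsU1Symmetric R U phi) (hnu : ∀ j, qtmInhom kappa T t n j ∈ U)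
    (hE : IsEigensystem (qtm R kappa phi h T t n) U ket bra ev)
    (hdom : ∀ k : Fin (K + 1), k ≠ 0 → ‖ev k 0‖ < ‖ev 0 0‖) (hev : ev 0 0 ≠ 0)
    (hne : t ≠ 0 → ∀ k, ev k 0 ≠ 0 ∧ ev k (Complex.I * t / (kappa * (2 * n : ℕ))) ≠ 0 ∧
        ev k (-(Complex.I * t / (kappa * (2 * n : ℕ)))) ≠ 0)
    {l r m : ℕ} (hm : l ≤ m) {x : Fin l → Matrix (Fin d) (Fin d) ℂ}
    (y : Fin r → Matrix (Fin d) (Fin d) ℂ) {s : ℂ} (hx : HasCharge phi x s) :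
    Filter.Tendsto (fun L => trotterTwoPoint R kappa phi h T t x y m n L) Filter.atTop
      (𝓝 (Complex.exp (-(Complex.I * h * t * s)) * ∑ k, formFactorTerm ket bra ev
        (qtmInsertion R kappa phi h T t n x) (qtmInsertion R kappa phi h T t n y) l r m n
        (Complex.I * t / (kappa * (2 * n : ℕ))) k)) := by
  have h0 := mem_of_mem_nhds hU
  -- The chain length is written as `m + r` plus the number of bare columns to the right of both
  -- operators.
  rw [← Filter.tendsto_add_atTop_iff_nat (m + r)]
  by_cases ht : t = 0
  · subst ht
    have hA0 : ∀ k, ev k 0 = 0 →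
        bra 0 ⬝ᵥ (qtmInsertion R kappa phi h T 0 n x *ᵥ ket k) = 0 := by
      intro k hk
      have hk0 : (0 : Fin (K + 1)) ≠ k := by rintro rfl; exact hev hk
      have hpos : 0 < qtmLength n := by simp only [qtmLength]; omega
      rcases Nat.eq_zero_or_pos l with rfl | hl
      · simp [qtmInsertion, hE.orthogonal 0 k hk0]
      · obtain ⟨l, rfl⟩ := Nat.exists_eq_succ_of_ne_zero hl.ne'
        -- For `t = 0` the first inhomogeneity is `0`, so the last factor of the insertion is a
        -- local operator times $t(0|h)$, which annihilates a ket of eigenvalue zero. For `l = 0`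
        -- orthogonality to the dominant state was enough.
        rw [qtmInsertion, List.ofFn_succ', List.concat_eq_append, List.prod_append,
          List.prod_singleton, hR.trace_aux_mul_qtmMonodromy h0 hpos
            (by rw [qtmInhom_of_lt (by simp; omega)]; simp),
          ← Matrix.mulVec_mulVec, ← Matrix.mulVec_mulVec, hE.right 0 h0, hk]
        simp
    rw [← sum_formFactorTerm_eq hE h0 hev hm (qtmInsertion R kappa phi h T 0 n x)
      (qtmInsertion R kappa phi h T 0 n x) _ _ (fun k hk => ?_) (fun k hk => ⟨hA0 k hk, ?_⟩)]
    · have := hE.tendsto_trace_div h0 hdom hev (qtmInsertion R kappa phi h T 0 n x *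
        qtm R kappa phi h T 0 n 0 ^ (m - l) * qtmInsertion R kappa phi h T 0 n y) (m + r)
      rw [Complex.ofReal_zero, mul_zero, zero_mul, neg_zero, Complex.exp_zero, one_mul]
      refine this.congr' ?_
      filter_upwards [Filter.eventually_gt_atTop 0] with q hq
      rw [add_comm q, trotterTwoPoint_eq_of_time_zero hn hU hR hphi hnu hm x y hq]
    · simp only [Complex.ofReal_zero, mul_zero, zero_div, neg_zero]
      rw [← mul_pow, div_mul_div_cancel₀ hk, div_self hev, one_pow, one_mul]
    -- Here `w = 0`, and the quotient by `ev k 0 = 0` is `0` by convention; `n > 0` keeps its power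
    -- zero.
    · simp [hk, hn.ne']
  · have hne' := hne ht
    rw [← sum_formFactorTerm_eq hE h0 hev hm _
      (insertion (rotated R kappa phi h T t n (2 * n) 0) x) _ _ (fun k _ =>
        matrixElement_insertion_rotated hR hphi h0 hnu hE rfl (fun k => (hne' k).2) x 0 k le_rfl)
      (fun k hk => absurd hk (hne' k).1)]
    have := (hE.tendsto_trace_div h0 hdom hev (insertion (rotated R kappa phi h T t n (2 * n) 0) x *
        qtm R kappa phi h T t n 0 ^ (m - l) * qtmInsertion R kappa phi h T t n y) (m + r)).const_mul
        (Complex.exp (-(Complex.I * h * t * s)))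
    refine this.congr' ?_
    filter_upwards [Filter.eventually_gt_atTop 0] with q hq
    rw [add_comm q, trotterTwoPoint_eq hn hU hphi hnu hm hx hq]

theorem eventually_qtmInhom_mem (hU : U ∈ 𝓝 (0 : ℂ)) (kappa : ℂ) (T t : ℝ) :
    ∀ᶠ n in Filter.atTop, ∀ j, qtmInhom kappa T t n j ∈ U := by
  have key : ∀ c : ℂ, ∀ᶠ n : ℕ in Filter.atTop, c / (kappa * (2 * n : ℕ)) ∈ U := by
    intro c
    have h1 : Filter.Tendsto (fun n : ℕ => c / (2 * kappa) / (n : ℂ)) Filter.atTop (𝓝 0) :=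
      tendsto_const_div_atTop_nhds_zero_nat _
    filter_upwards [h1 hU] with n hn
    have : c / (kappa * (2 * n : ℕ)) = c / (2 * kappa) / n := by
      rw [div_div]; push_cast; ring_nf
    rw [this]
    exact hn
  filter_upwards [key (Complex.I * t), key (-(Complex.I * t)), key (1 / (T : ℂ) - Complex.I * t),
    key (-(1 / (T : ℂ) - Complex.I * t))] with n h1 h2 h3 h4 j
  rw [neg_div] at h2 h4
  rcases Nat.even_or_odd (j : ℕ) with hj | hj <;> rcases lt_or_ge (j : ℕ) (2 * n) with hlt | hle
  · rwa [qtmInhom_of_lt hlt, hj.neg_one_pow, one_mul]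
  · rwa [qtmInhom_of_le hle, hj.neg_one_pow, one_mul]
  · rwa [qtmInhom_of_lt hlt, hj.neg_one_pow, neg_one_mul]
  · rwa [qtmInhom_of_le hle, hj.neg_one_pow, neg_one_mul]

/-- A dominant eigenvalue is nonzero if some power of the transfer matrix has nonzero trace. -/
theorem dominant_ne_zero (hE : IsEigensystem (qtm R kappa phi h T t n) U ket bra ev)
    (h0 : (0 : ℂ) ∈ U) (hdom : ∀ k : Fin (K + 1), k ≠ 0 → ‖ev k 0‖ < ‖ev 0 0‖) {L : ℕ}
    (hL : L ≠ 0) (htr : (qtm R kappa phi h T t n 0 ^ L).trace ≠ 0) : ev 0 0 ≠ 0 := by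
  intro hev
  rw [hE.trace_pow h0] at htr
  refine htr (Finset.sum_eq_zero fun k _ => ?_)
  by_cases hk : k = 0
  · rw [hk, hev, zero_pow hL]
  · have := hdom k hk
    rw [hev, norm_zero] at this
    exact absurd this (norm_nonneg _).not_gt

end FormFactorSeries

end FormFactor

end

/-! ### The main theorem: exchanging the two limits. -/

theorem mainTheorem1 {d l r : ℕ}
    -- a fundamental model with `U(1)` symmetry
    (R : ℂ → ℂ → Matrix (Fin d × Fin d) (Fin d × Fin d) ℂ) (U : Set ℂ) (hU : U ∈ nhds (0 : ℂ))
    (hR : FormFactor.IsFundamental R U)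
    (phi : Matrix (Fin d) (Fin d) ℂ) (hphi : FormFactor.IsU1Symmetric R U phi)
    (kappa : ℂ) (hkappa : kappa ≠ 0)
    -- magnetic field, temperature, time, and local operators of fixed charge
    (h T t : ℝ) (hT : 0 < T)
    (x : Fin l → Matrix (Fin d) (Fin d) ℂ) (y : Fin r → Matrix (Fin d) (Fin d) ℂ)
    (sX sY : ℂ) (hx : FormFactor.HasCharge phi x sX) (hy : FormFactor.HasCharge phi y sY)
    (m : ℕ) (hm : l ≤ m)
    (hZ : ∀ᶠ L in Filter.atTop, FormFactor.partitionFunction R kappa phi h T L ≠ 0)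
    -- eigenstates of the dynamical quantum transfer matrix with Trotter number `N = 2n`
    (K : ℕ → ℕ)
    (ket bra : (n : ℕ) → Fin (K n + 1) → (Fin (FormFactor.qtmLength n) → Fin d) → ℂ)
    (ev : (n : ℕ) → Fin (K n + 1) → ℂ → ℂ)
    (heig : ∀ᶠ n in Filter.atTop,
      FormFactor.IsEigensystem (FormFactor.qtm R kappa phi h T t n) U (ket n) (bra n) (ev n))
    -- the dominant eigenvalue is non-degenerate
    (hdom : ∀ᶠ n in Filter.atTop, ∀ k : Fin (K n + 1), k ≠ 0 → ‖ev n k 0‖ < ‖ev n 0 0‖)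
    -- the denominators do not vanish
    (hne : t ≠ 0 → ∀ᶠ n : ℕ in Filter.atTop, ∀ k : Fin (K n + 1),
      ev n k 0 ≠ 0 ∧ ev n k (Complex.I * t / (kappa * (2 * n : ℕ))) ≠ 0 ∧
        ev n k (-(Complex.I * t / (kappa * (2 * n : ℕ)))) ≠ 0)
    -- the Trotter limit and the thermodynamic limit commute
    (hcomm : FormFactor.LimitsCommute
      (FormFactor.trotterTwoPoint R kappa phi h T t x y m)) :
    ∃ S : ℂ,
      Filter.Tendsto
        (fun n : ℕ => ∑ k : Fin (K n + 1),
          FormFactor.formFactorTerm (ket n) (bra n) (ev n)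
            (FormFactor.qtmInsertion R kappa phi h T t n x)
            (FormFactor.qtmInsertion R kappa phi h T t n y)
            l r m n (Complex.I * t / (kappa * (2 * n : ℕ))) k)
        Filter.atTop (nhds S) ∧
      Filter.Tendsto (fun L : ℕ => FormFactor.twoPoint R kappa phi h T t x y m L)
        Filter.atTop (nhds (Complex.exp (-(Complex.I * h * t * sX)) * S)) := by
  have hinhom := FormFactor.eventually_qtmInhom_mem hU kappa T t
  have hne' : ∀ᶠ n : ℕ in Filter.atTop, t ≠ 0 → ∀ k : Fin (K n + 1),
      ev n k 0 ≠ 0 ∧ ev n k (Complex.I * t / (kappa * (2 * n : ℕ))) ≠ 0 ∧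
        ev n k (-(Complex.I * t / (kappa * (2 * n : ℕ)))) ≠ 0 := by
    by_cases ht : t = 0
    · exact Filter.Eventually.of_forall fun n h0 => absurd ht h0
    · filter_upwards [hne ht] with n hn _ using hn
  -- Strict dominance says nothing when there is only one eigenvector. Instead one fixed length with
  -- $Z_L\ne0$ is used: the trace of $t(0|h)^L$ tends to $Z_L$ as $N\to\infty$, so it is eventually
  -- nonzero.
  have hev : ∀ᶠ n : ℕ in Filter.atTop, ev n 0 0 ≠ 0 := by
    obtain ⟨L, hZL, hL⟩ := (hZ.and (Filter.eventually_ge_atTop 2)).exists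
    have : NeZero L := ⟨by omega⟩
    have htr := (hR.tendsto_trace_trotterExp hL hU hphi kappa h T t).eventually_ne hZL
    filter_upwards [Filter.eventually_gt_atTop 0, htr, hinhom, heig, hdom]
      with n hn htr hnu hE hdom
    rw [FormFactor.trace_trotterExp_mul_trotterExp hn hU hphi hnu] at htr
    exact FormFactor.dominant_ne_zero hE (mem_of_mem_nhds hU) hdom (by omega) htr
  obtain ⟨g, hg1, hg2⟩ := hcomm (fun L => FormFactor.twoPoint R kappa phi h T t x y m L)
    (fun n => Complex.exp (-(Complex.I * h * t * sX)) * ∑ k : Fin (K n + 1),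
      FormFactor.formFactorTerm (ket n) (bra n) (ev n)
        (FormFactor.qtmInsertion R kappa phi h T t n x)
        (FormFactor.qtmInsertion R kappa phi h T t n y)
        l r m n (Complex.I * t / (kappa * (2 * n : ℕ))) k)
    (by
      filter_upwards [hZ, Filter.eventually_ge_atTop 2] with L hZL hL
      exact hR.tendsto_trotterTwoPoint hL hU hphi kappa h T t x y m hZL)
    (by
      filter_upwards [Filter.eventually_gt_atTop 0, hinhom, heig, hdom, hev, hne']
        with n hn hnu hE hdom hev hne
      exact FormFactor.tendsto_trotterTwoPoint_length hn hU hR hphi hnu hE hdom hev hne hm y hx)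
  -- The common limit `g` contains the phase $e^{-iht\,s(X)}$; multiplying by its inverse isolates
  -- the limit of the series.
  refine ⟨Complex.exp (Complex.I * h * t * sX) * g, ?_, ?_⟩
  · simpa only [← mul_assoc, ← Complex.exp_add, add_neg_cancel, Complex.exp_zero, one_mul] using
      hg2.const_mul (Complex.exp (Complex.I * h * t * sX))
  · simpa only [← mul_assoc, ← Complex.exp_add, neg_add_cancel, Complex.exp_zero, one_mul] using hg1
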